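/- Let $\alpha\in\mathbb R$, $x_2>0$, and let $\alpha(x)=\alpha$ for $0<x<x_2$ and $\alpha(x)=0$ for $x<0$ and for $x>x_2$. Let $\psi_0:\mathbb R\to\mathbb C$ be differentiable, with $\psi_0$ and $\psi_0'$ both in $L^1(\mathbb R)$ and both (locally) absolutely continuous. Let $\psi(x,t)$, $x\in\mathbb R$, $t\ge 0$, be a classical solution of $$i\psi_t=-\psi_{xx}+\alpha(x)\psi\quad(x\neq 0,x_2,\ t>0),\qquad \psi(x,0)=\psi_0(x),\qquad \lim_{|x|\to\infty}\psi(x,t)=0\quad(t>0),$$ that is: $\psi$ and $\psi_x$ exist and are continuous on $\mathbb R\times[0,\infty)$ (in particular across the interfaces $x=0$ and $x=x_2$); for $x\ne 0,x_2$ and $t>0$ the derivatives $\psi_t,\psi_{xx}$ exist and $\psi_t$ is continuous; and $\psi$, $\psi_x$ are in $L^1$, both over $\mathbb R$ at each time $t>0$ and over each strip $\mathbb R\times(0,T]$. Notation. Put $\omega_1(k)=\omega_3(k)=ik^2$, $\omega_2(k)=i(\alpha+k^2)$, $$\hat\psi_0^{(1)}(k)=\int_{-\infty}^0e^{-ikx}\psi_0(x)\,dx,\quad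 \hat\psi_0^{(2)}(k)=\int_0^{x_2}e^{-ikx}\psi_0(x)\,dx,\quad \hat\psi_0^{(3)}(k)=\int_{x_2}^\infty e^{-ikx}\psi_0(x)\,dx ,$$ $\nu=\nu(\kappa)=i\kappa\sqrt{1+\alpha/\kappa^2}$, $\sigma=\sigma(k)=\sqrt{1-\alpha/k^2}$, $\tau=\tau(k)=\sqrt{1+\alpha/k^2}$ (principal square roots), and $$\Delta(\kappa)=4i\pi\big((\alpha+2\kappa^2)\sin(x_2\nu)+2\kappa\nu\cos(x_2\nu)\big).$$ $D_R^{(j)}$ is the part $|k|>R$ of the open $j$-th quadrant of $\mathbb C$, and $\partial D_R^{(j)}$ is its boundary, oriented with $D_R^{(j)}$ on the left. Integrals over $\mathbb R$ and over $\partial D_R^{(j)}$ are improper: limits of the integrals over truncations, the two ends tending to infinity independently. Then for every $R>\sqrt{2|\alpha|}$ and every $t>0$ all the integrals below converge and the following formulas hold. **(A) Integrals over $\partial D_R^{(4)}$.** For $x<0$, $$\begin{aligned}\psi(x,t)={}&\frac1{2\pi}\int_{-\infty}^\infty e^{ikx-\omega_1t}\hat\psi_0^{(1)}(k)\,dk+\int_{\partial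 D_R^{(4)}}\frac{i\alpha(e^{-ix_2\nu}-e^{ix_2\nu})}{\Delta(\kappa)}e^{\kappa x+i\kappa^2t}\hat\psi_0^{(1)}(i\kappa)\,d\kappa\\&-\int_{\partial D_R^{(4)}}\frac{2i\kappa(\kappa-i\nu)}{\Delta(\kappa)}e^{\kappa x-ix_2\nu+i\kappa^2t}\hat\psi_0^{(2)}(-\nu)\,d\kappa+\int_{\partial D_R^{(4)}}\frac{2i\kappa(\kappa+i\nu)}{\Delta(\kappa)}e^{\kappa x+ix_2\nu+i\kappa^2t}\hat\psi_0^{(2)}(\nu)\,d\kappa\\&-\int_{\partial D_R^{(4)}}\frac{4\kappa\nu}{\Delta(\kappa)}e^{\kappa(x+x_2)+i\kappa^2t}\hat\psi_0^{(3)}(-i\kappa)\,d\kappa .\end{aligned}$$ For $0<x<x_2$, $$\begin{aligned}\psi(x,t)={}&\frac1{2\pi}\int_{-\infty}^\infty e^{ikx-\omega_2t}\hat\psi_0^{(2)}(k)\,dk+\int_{\partial D_R^{(4)}}\frac{2i\kappa(\kappa+i\nu)}{\Delta(\kappa)}e^{i\nu(x_2-x)+i\kappa^2t}\hat\psi_0^{(1)}(i\kappa)\,d\kappa\\&+\int_{\partial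 D_R^{(4)}}\frac{\kappa(\kappa+i\nu)^2}{\nu\Delta(\kappa)}e^{i\nu(x_2-x)+i\kappa^2t}\hat\psi_0^{(2)}(-\nu)\,d\kappa+\int_{\partial D_R^{(4)}}\frac{\alpha\kappa}{\nu\Delta(\kappa)}e^{i\nu(x_2-x)+i\kappa^2t}\hat\psi_0^{(2)}(\nu)\,d\kappa\\&-\int_{\partial D_R^{(4)}}\frac{2i\kappa(\kappa-i\nu)}{\Delta(\kappa)}e^{-i\nu x+\kappa x_2+i\kappa^2t}\hat\psi_0^{(3)}(-i\kappa)\,d\kappa-\int_{\partial D_R^{(4)}}\frac{2i\kappa(\kappa-i\nu)}{\Delta(\kappa)}e^{i\nu(x-x_2)+i\kappa^2t}\hat\psi_0^{(1)}(i\kappa)\,d\kappa\\&+\int_{\partial D_R^{(4)}}\frac{\alpha\kappa}{\nu\Delta(\kappa)}e^{i\nu(x-x_2)+i\kappa^2t}\hat\psi_0^{(2)}(-\nu)\,d\kappa+\int_{\partial D_R^{(4)}}\frac{\kappa(\kappa+i\nu)^2}{\nu\Delta(\kappa)}e^{i\nu(x_2+x)+i\kappa^2t}\hat\psi_0^{(2)}(\nu)\,d\kappa\\&+\int_{\partial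 D_R^{(4)}}\frac{2i\kappa(\kappa+i\nu)}{\Delta(\kappa)}e^{i\nu x+\kappa x_2+i\kappa^2t}\hat\psi_0^{(3)}(-i\kappa)\,d\kappa .\end{aligned}$$ For $x>x_2$, $$\begin{aligned}\psi(x,t)={}&\frac1{2\pi}\int_{-\infty}^\infty e^{ikx-\omega_3t}\hat\psi_0^{(3)}(k)\,dk-\int_{\partial D_R^{(4)}}\frac{4\kappa\nu}{\Delta(\kappa)}e^{\kappa(x_2-x)+i\kappa^2t}\hat\psi_0^{(1)}(i\kappa)\,d\kappa\\&+\int_{\partial D_R^{(4)}}\frac{2i\kappa(\kappa+i\nu)}{\Delta(\kappa)}e^{\kappa(x_2-x)+i\kappa^2t}\hat\psi_0^{(2)}(-\nu)\,d\kappa-\int_{\partial D_R^{(4)}}\frac{2i\kappa(\kappa-i\nu)}{\Delta(\kappa)}e^{\kappa(x_2-x)+i\kappa^2t}\hat\psi_0^{(2)}(\nu)\,d\kappa\\&+\int_{\partial D_R^{(4)}}\frac{i\alpha(e^{-ix_2\nu}-e^{ix_2\nu})}{\Delta(\kappa)}e^{\kappa(2x_2-x)+i\kappa^2t}\hat\psi_0^{(3)}(-i\kappa)\,d\kappa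 .\end{aligned}$$ **(B) Integrals over $\partial D_R^{(1)}$ and $\partial D_R^{(3)}$.** For $x<0$, $$\begin{aligned}\psi(x,t)={}&\frac1{2\pi}\int_{-\infty}^\infty e^{ikx-\omega_1t}\hat\psi_0^{(1)}(k)\,dk+\int_{\partial D_R^{(3)}}\frac{\alpha(e^{-ikx_2\sigma}-e^{ikx_2\sigma})}{\Delta(ik)}e^{ikx-\omega_1t}\hat\psi_0^{(1)}(-k)\,dk\\&-\int_{\partial D_R^{(3)}}\frac{2k^2(1+\sigma)}{\Delta(ik)}e^{ik(x+x_2\sigma)-\omega_1t}\hat\psi_0^{(2)}(k\sigma)\,dk+\int_{\partial D_R^{(3)}}\frac{2k^2(1-\sigma)}{\Delta(ik)}e^{ik(x-x_2\sigma)-\omega_1t}\hat\psi_0^{(2)}(-k\sigma)\,dk\\&-\int_{\partial D_R^{(3)}}\frac{4k^2\sigma}{\Delta(ik)}e^{ik(x+x_2)-\omega_1t}\hat\psi_0^{(3)}(k)\,dk .\end{aligned}$$ For $0<x<x_2$, $$\begin{aligned}\psi(x,t)={}&\frac1{2\pi}\int_{-\infty}^\infty e^{ikx-\omega_2t}\hat\psi_0^{(2)}(k)\,dk-\int_{\partial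 D_R^{(3)}}\frac{2k^2(1-\tau)}{\Delta(ik\tau)}e^{ik(x-x_2)-\omega_2t}\hat\psi_0^{(1)}(-k\tau)\,dk\\&-\int_{\partial D_R^{(3)}}\frac{k^2(\tau-1)^2}{\Delta(ik\tau)}e^{ik(x-x_2)-\omega_2t}\hat\psi_0^{(2)}(k)\,dk+\int_{\partial D_R^{(3)}}\frac{\alpha}{\Delta(ik\tau)}e^{ik(x-x_2)-\omega_2t}\hat\psi_0^{(2)}(-k)\,dk\\&-\int_{\partial D_R^{(3)}}\frac{2k^2(1+\tau)}{\Delta(ik\tau)}e^{ik(x+x_2\tau)-\omega_2t}\hat\psi_0^{(3)}(k\tau)\,dk+\int_{\partial D_R^{(1)}}\frac{2k^2(1+\tau)}{\Delta(-ik\tau)}e^{ik(x-x_2)-\omega_2t}\hat\psi_0^{(1)}(k\tau)\,dk\\&+\int_{\partial D_R^{(1)}}\frac{k^2(\tau-1)^2}{\Delta(-ik\tau)}e^{ik(x+x_2)-\omega_2t}\hat\psi_0^{(2)}(k)\,dk-\int_{\partial D_R^{(1)}}\frac{\alpha}{\Delta(-ik\tau)}e^{ik(x-x_2)-\omega_2t}\hat\psi_0^{(2)}(-k)\,dk\\&+\int_{\partial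 D_R^{(1)}}\frac{2k^2(1-\tau)}{\Delta(-ik\tau)}e^{ik(x-x_2\tau)-\omega_2t}\hat\psi_0^{(3)}(-k\tau)\,dk .\end{aligned}$$ For $x>x_2$, $$\begin{aligned}\psi(x,t)={}&\frac1{2\pi}\int_{-\infty}^\infty e^{ikx-\omega_3t}\hat\psi_0^{(3)}(k)\,dk+\int_{\partial D_R^{(1)}}\frac{4k^2\sigma}{\Delta(-ik)}e^{ik(x-x_2)-\omega_3t}\hat\psi_0^{(1)}(k)\,dk\\&+\int_{\partial D_R^{(1)}}\frac{2k^2(1+\sigma)}{\Delta(-ik)}e^{ik(x-x_2)-\omega_3t}\hat\psi_0^{(2)}(k\sigma)\,dk-\int_{\partial D_R^{(1)}}\frac{2k^2(1-\sigma)}{\Delta(-ik)}e^{ik(x-x_2)-\omega_3t}\hat\psi_0^{(2)}(-k\sigma)\,dk\\&+\int_{\partial D_R^{(1)}}\frac{\alpha(e^{-ikx_2\sigma}-e^{ikx_2\sigma})}{\Delta(-ik)}e^{ik(x-2x_2)-\omega_3t}\hat\psi_0^{(3)}(-k)\,dk .\end{aligned}$$ -/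

import Mathlib

open MeasureTheory Filter Topology
open Complex (I exp sin cos)

noncomputable section

namespace SquareWell

/-- The piecewise constant potential: `α` on `(0, x₂)`, zero for `x < 0` and for `x > x₂`.
The values at the two interfaces are irrelevant. -/
def potential (α x₂ x : ℝ) : ℝ := if 0 < x ∧ x < x₂ then α else 0

/-- Admissible initial data: the function and its derivative are integrable on the line and
(locally) absolutely continuous. -/
structure IsInitialDatum (ψ₀ : ℝ → ℂ) : Prop where
  differentiable : Differentiable ℝ ψ₀
  integrable : Integrable ψ₀
  integrable_deriv : Integrable (deriv ψ₀)
  absolutelyContinuous : ∀ a b : ℝ, AbsolutelyContinuousOnInterval ψ₀ a b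
  absolutelyContinuous_deriv : ∀ a b : ℝ, AbsolutelyContinuousOnInterval (deriv ψ₀) a b

/-- Classical solutions `ψ x t`, `t ≥ 0`, of `i ψ_t = -ψ_xx + α(x) ψ` with initial value `ψ₀`.
The restrictions of `ψ` to `x < 0`, `0 < x < x₂`, `x > x₂` are the three functions
`ψ⁽¹⁾, ψ⁽²⁾, ψ⁽³⁾`; continuity of `ψ` and `ψ_x` on the closed half plane contains the
interface conditions at `x = 0` and `x = x₂`. -/
structure IsSolution (α x₂ : ℝ) (ψ₀ : ℝ → ℂ) (ψ : ℝ → ℝ → ℂ) : Prop where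
  /-- `ψ` is continuous up to the initial time and across the interfaces. -/
  continuousOn : ContinuousOn (fun p : ℝ × ℝ => ψ p.1 p.2) {p | 0 ≤ p.2}
  /-- `ψ_x` exists and is continuous up to the initial time and across the interfaces. -/
  differentiable_x : ∀ t : ℝ, 0 ≤ t → Differentiable ℝ (fun x => ψ x t)
  continuousOn_x : ContinuousOn (fun p : ℝ × ℝ => deriv (fun x => ψ x p.2) p.1) {p | 0 ≤ p.2}
  /-- Away from the interfaces `ψ_t` and `ψ_xx` exist, and `ψ_t` is continuous. -/
  differentiableAt_t : ∀ x t : ℝ, x ≠ 0 → x ≠ x₂ → 0 < t →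
    DifferentiableAt ℝ (fun s => ψ x s) t
  differentiableAt_xx : ∀ x t : ℝ, x ≠ 0 → x ≠ x₂ → 0 < t →
    DifferentiableAt ℝ (deriv (fun y => ψ y t)) x
  continuousOn_t : ContinuousOn (fun p : ℝ × ℝ => deriv (fun s => ψ p.1 s) p.2)
    {p | p.1 ≠ 0 ∧ p.1 ≠ x₂ ∧ 0 < p.2}
  /-- The Schrödinger equation in each of the three regions. -/
  equation : ∀ x t : ℝ, x ≠ 0 → x ≠ x₂ → 0 < t →
    I * deriv (fun s => ψ x s) t
      = -deriv (deriv (fun y => ψ y t)) x + (potential α x₂ x : ℂ) * ψ x t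
  /-- The initial condition. -/
  initial : ∀ x : ℝ, ψ x 0 = ψ₀ x
  /-- Decay as `|x| → ∞`. -/
  tendsto_zero : ∀ t : ℝ, 0 < t → Tendsto (fun x => ψ x t) (cocompact ℝ) (𝓝 0)
  /-- `ψ` and `ψ_x` are in `L¹`, at each time and on each strip `ℝ × (0, T]`. -/
  integrable : ∀ t : ℝ, 0 < t → Integrable (fun x => ψ x t)
  integrable_x : ∀ t : ℝ, 0 < t → Integrable (deriv (fun x => ψ x t))
  integrableOn_strip : ∀ T : ℝ, 0 < T →
    IntegrableOn (fun p : ℝ × ℝ => ψ p.1 p.2) (Set.univ ×ˢ Set.Ioc 0 T)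
  integrableOn_strip_x : ∀ T : ℝ, 0 < T →
    IntegrableOn (fun p : ℝ × ℝ => deriv (fun x => ψ x p.2) p.1) (Set.univ ×ˢ Set.Ioc 0 T)

/-- `ψ̂₀⁽¹⁾(k) = ∫_{-∞}^0 e^{-ikx} ψ₀(x) dx`, for `Im k ≥ 0`. -/
def hat₁ (ψ₀ : ℝ → ℂ) (k : ℂ) : ℂ := ∫ x in Set.Iic (0 : ℝ), exp (-(I * k * x)) * ψ₀ x

/-- `ψ̂₀⁽²⁾(k) = ∫_0^{x₂} e^{-ikx} ψ₀(x) dx`. -/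
def hat₂ (x₂ : ℝ) (ψ₀ : ℝ → ℂ) (k : ℂ) : ℂ := ∫ x in (0 : ℝ)..x₂, exp (-(I * k * x)) * ψ₀ x

/-- `ψ̂₀⁽³⁾(k) = ∫_{x₂}^∞ e^{-ikx} ψ₀(x) dx`, for `Im k ≤ 0`. -/
def hat₃ (x₂ : ℝ) (ψ₀ : ℝ → ℂ) (k : ℂ) : ℂ := ∫ x in Set.Ioi x₂, exp (-(I * k * x)) * ψ₀ x

/-- `ω(k) = i (a + k²)` for the potential level `a`. -/
def ω (a : ℝ) (k : ℂ) : ℂ := I * (a + k ^ 2)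

/-- `√(1 + a / k²)`, with the principal branch of the square root. -/
def root (a : ℝ) (k : ℂ) : ℂ := (1 + (a : ℂ) / k ^ 2) ^ (1 / 2 : ℂ)

/-- `ν⁽²⁾(κ) = i κ √(1 + α / κ²)`. -/
def ν (α : ℝ) (κ : ℂ) : ℂ := I * κ * root α κ

/-- `Δ(κ) = 4 i π ((α + 2 κ²) sin (x₂ ν⁽²⁾) + 2 κ ν⁽²⁾ cos (x₂ ν⁽²⁾))`. -/
def Δ (α x₂ : ℝ) (κ : ℂ) : ℂ :=
  4 * I * Real.pi *
    ((α + 2 * κ ^ 2) * sin (x₂ * ν α κ) + 2 * κ * ν α κ * cos (x₂ * ν α κ))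

/-- The improper integral `∫_{-∞}^∞ f(k) dk` converges, to `v`. -/
def HasLineIntegral (f : ℝ → ℂ) (v : ℂ) : Prop :=
  Tendsto (fun c : ℝ × ℝ => ∫ k in (-c.1)..c.2, f k) atTop (𝓝 v)

/-- The integral of `f` along the following path: from `a e^{iθ₁}` radially to `R e^{iθ₁}`, along
the circle `|z| = R` to `R e^{iθ₀}`, radially to `b e^{iθ₀}`. -/
def wedgeIntegral (θ₁ θ₀ R : ℝ) (f : ℂ → ℂ) (a b : ℝ) : ℂ :=
  (-∫ r in R..a, f (r * exp (θ₁ * I)) * exp (θ₁ * I))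
    + (∫ θ in θ₁..θ₀, f (R * exp (θ * I)) * (I * (R * exp (θ * I))))
    + ∫ r in R..b, f (r * exp (θ₀ * I)) * exp (θ₀ * I)

/-- The improper integral of `f` over the boundary of `{r e^{iθ} : r > R, θ₀ < θ < θ₁}`, taken
with the region on the left, converges, to `v`. -/
def HasWedgeIntegral (θ₁ θ₀ R : ℝ) (f : ℂ → ℂ) (v : ℂ) : Prop :=
  Tendsto (fun c : ℝ × ℝ => wedgeIntegral θ₁ θ₀ R f c.1 c.2) atTop (𝓝 v)

/-- `∫_{∂D_R⁽¹⁾} f = v`, where `D_R⁽¹⁾` is the part `|k| > R` of the open first quadrant. -/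
def HasIntegralD1 (R : ℝ) (f : ℂ → ℂ) (v : ℂ) : Prop :=
  HasWedgeIntegral (Real.pi / 2) 0 R f v

/-- `∫_{∂D_R⁽³⁾} f = v`, where `D_R⁽³⁾` is the part `|k| > R` of the open third quadrant. -/
def HasIntegralD3 (R : ℝ) (f : ℂ → ℂ) (v : ℂ) : Prop :=
  HasWedgeIntegral (-(Real.pi / 2)) (-Real.pi) R f v

/-- `∫_{∂D_R⁽⁴⁾} f = v`, where `D_R⁽⁴⁾` is the part `|k| > R` of the open fourth quadrant. -/
def HasIntegralD4 (R : ℝ) (f : ℂ → ℂ) (v : ℂ) : Prop :=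
  HasWedgeIntegral 0 (-(Real.pi / 2)) R f v

end SquareWell

end

open SquareWell

/-!
The proof is the unified transform method, carried out for the truncated Laplace transform in time
`Ψ(x) = ∫_0^T e^{-iζτ} ψ(x, τ) dτ` with a fixed `T > t`. In each region `Ψ` satisfies
`Ψ'' = θ² Ψ + (data at the times 0 and T)`, where `θ² = ζ` outside and `θ² = ζ + α` inside the well.
Multiplication by `e^{±θx}` and integration give the global relations (`global_relation`). On the
half lines integrability removes the term at infinity, and continuity of `ψ` and `ψ_x` at the
interfaces turns the relations into a linear system for the boundary values of `Ψ`. Its determinant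
`(κ + λ)² - (κ - λ)² e^{-2λx₂}`, with `κ² = ζ` and `λ² = ζ + α`, has no zeros where `κ` and `λ` lie
in the closed right half plane and enclose an acute angle (`ampDet_ne_zero`). Hence `Ψ` is explicit:
`timeTransform_left`, `timeTransform_middle`, `timeTransform_right`.

With `z² = ζ` up to a shift, the boundary of the sector `|z| > R` of the fourth quadrant is a
deformation of the real `ζ` line, so that Fourier inversion at a point of differentiability recovers
`ψ(x, t)` from `Ψ(x)` (`hasSymmIntegral_laplace_inversion`). The terms of `Ψ` then fall into three
classes.

* Data at time `T` carry the factor `e^{iζ(t - T)}`, which decays in the sector; by Cauchy's theorem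
  and Jordan's lemma they contribute nothing (`hasSymmIntegral_term_zero`).
* The data of the region that contains `x`, transported without reflection, give the integral over
  the line. The substitution `w = √(z² + a)` reduces this to path independence for the entire
  functions `e^{itw² - yw}` and one more application of Jordan's lemma
  (`exists_hasLineIntegral_free`).
* All other terms have the shape `mode`: an amplitude holomorphic in the sector with a limit at
  infinity, an exponential that decays on the real ray, and a Laplace transform of a piece of the
  initial datum, which is `O(1/z)` since the derivative of the datum is integrable. On the real ray
  the integrals converge absolutely. On the imaginary ray the part of the amplitude that vanishes at
  infinity gives an absolutely convergent integral, and the limit value leaves a superposition of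
  Fresnel integrals, which converges by dominated convergence (`exists_hasIntegralD4_term`).

The inversion is performed with both ends of the path tending to infinity at the same rate
(`HasSymmIntegral`). This suffices to identify the values, and convergence with independent ends
is what the last item provides.

The result is `solution_left`, `solution_middle`, `solution_right`, in a variable `z = √(ζ - b)`
with a free level `b`. For `b = 0` it gives the formulas over the boundary in the fourth quadrant. A
rotation by a right angle, with `b = 0` outside and `b = -α` inside the well, gives those over the
boundaries in the first and third quadrants.
-/

open MeasureTheory Filter Topology
open Complex (I exp sin cos)

noncomputable section

namespace SquareWell

/-! ### The closed sector and integrals over its boundary -/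

/-- The closure of `D_R⁽⁴⁾`: the part `|z| ≥ R` of the closed fourth quadrant. -/
def closedSector (R : ℝ) : Set ℂ := {z | R ≤ ‖z‖ ∧ 0 ≤ z.re ∧ z.im ≤ 0}

/-- The open sector `D_R⁽⁴⁾`: the part `|z| > R` of the open fourth quadrant. -/
def openSector (R : ℝ) : Set ℂ := {z | R < ‖z‖ ∧ 0 < z.re ∧ z.im < 0}

lemma openSector_subset (R : ℝ) : openSector R ⊆ closedSector R :=
  fun _ h => ⟨h.1.le, h.2.1.le, h.2.2.le⟩

lemma ofReal_mem_closedSector {R r : ℝ} (hR : 0 < R) (h : R ≤ r) : (r : ℂ) ∈ closedSector R := by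
  refine ⟨?_, ?_, by simp⟩
  · rw [Complex.norm_real, Real.norm_eq_abs]; exact h.trans (le_abs_self r)
  · simpa using (hR.trans_le h).le

lemma neg_I_mul_mem_closedSector {R r : ℝ} (hR : 0 < R) (h : R ≤ r) :
    (-(I * r) : ℂ) ∈ closedSector R := by
  refine ⟨?_, by simp, ?_⟩
  · rw [norm_neg, norm_mul, Complex.norm_I, one_mul, Complex.norm_real, Real.norm_eq_abs]
    exact h.trans (le_abs_self r)
  · simpa using (hR.trans_le h).le

lemma arc_mem_closedSector {R c θ : ℝ} (hR : 0 < R) (hc : R ≤ c)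
    (h : θ ∈ Set.Icc (-(Real.pi / 2)) 0) : (c * exp (θ * I) : ℂ) ∈ closedSector R := by
  have hc0 : 0 ≤ c := (hR.trans_le hc).le
  refine ⟨?_, ?_, ?_⟩
  · rw [norm_mul, Complex.norm_exp_ofReal_mul_I, mul_one, Complex.norm_real, Real.norm_eq_abs]
    exact hc.trans (le_abs_self c)
  · rw [Complex.re_ofReal_mul, Complex.exp_ofReal_mul_I_re]
    exact mul_nonneg hc0 (Real.cos_nonneg_of_neg_pi_div_two_le_of_le h.1
      (h.2.trans (by positivity)))
  · rw [Complex.im_ofReal_mul, Complex.exp_ofReal_mul_I_im]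
    exact mul_nonpos_of_nonneg_of_nonpos hc0 (Real.sin_nonpos_of_nonpos_of_neg_pi_le h.2
      (by linarith [h.1, Real.pi_pos]))

lemma exp_neg_half_pi : exp ((-(Real.pi / 2) : ℝ) * I) = -I := by
  have : ((-(Real.pi / 2) : ℝ) : ℂ) * I = -(Real.pi / 2 * I) := by push_cast; ring
  rw [this, Complex.exp_neg, Complex.exp_pi_div_two_mul_I, Complex.inv_I]

/-- The integral over the truncated boundary of the closed sector. -/
abbrev sectorIntegral (R : ℝ) (f : ℂ → ℂ) (a b : ℝ) : ℂ :=
  wedgeIntegral 0 (-(Real.pi / 2)) R f a b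

lemma sectorIntegral_eq (R : ℝ) (f : ℂ → ℂ) (a b : ℝ) :
    sectorIntegral R f a b = -(∫ r in R..a, f r)
      + (∫ θ in (0 : ℝ)..(-(Real.pi / 2)), f (R * exp (θ * I)) * (I * (R * exp (θ * I))))
      + ∫ r in R..b, f (-(I * r)) * -I := by
  unfold sectorIntegral wedgeIntegral
  rw [exp_neg_half_pi]
  simp only [Complex.ofReal_zero, zero_mul, Complex.exp_zero, mul_one]
  congr 1
  refine intervalIntegral.integral_congr fun r _ => ?_
  simp only [mul_neg, mul_comm]

lemma sectorIntegral_congr {R : ℝ} (hR : 0 < R) {f g : ℂ → ℂ} (h : Set.EqOn f g (closedSector R))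
    {a b : ℝ} (ha : R ≤ a) (hb : R ≤ b) : sectorIntegral R f a b = sectorIntegral R g a b := by
  have hpi := Real.pi_pos
  simp only [sectorIntegral_eq]
  congr 1
  · congr 1
    · congr 1
      refine intervalIntegral.integral_congr fun r hr => ?_
      rw [Set.uIcc_of_le ha] at hr
      exact h (ofReal_mem_closedSector hR hr.1)
    · refine intervalIntegral.integral_congr fun θ hθ => ?_
      rw [Set.uIcc_of_ge (by linarith)] at hθ
      simp only [h (arc_mem_closedSector hR le_rfl hθ)]
  · refine intervalIntegral.integral_congr fun r hr => ?_
    rw [Set.uIcc_of_le hb] at hr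
    simp only [h (neg_I_mul_mem_closedSector hR hr.1)]

section Integrable
variable {R : ℝ} (hR : 0 < R) {f : ℂ → ℂ} (hf : ContinuousOn f (closedSector R))
include hR hf

lemma intervalIntegrable_real {a : ℝ} (ha : R ≤ a) :
    IntervalIntegrable (fun r : ℝ => f r) volume R a := by
  refine ContinuousOn.intervalIntegrable (hf.comp (by fun_prop) fun r hr => ?_)
  rw [Set.uIcc_of_le ha] at hr
  exact ofReal_mem_closedSector hR hr.1

lemma continuousOn_imag : ContinuousOn (fun r : ℝ => f (-(I * r)) * -I) (Set.Ici R) :=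
  (hf.comp (f := fun r : ℝ => (-(I * r) : ℂ)) (by fun_prop)
    fun r hr => neg_I_mul_mem_closedSector hR hr).mul continuousOn_const

lemma intervalIntegrable_imag {a : ℝ} (ha : R ≤ a) :
    IntervalIntegrable (fun r : ℝ => f (-(I * r)) * -I) volume R a := by
  refine ContinuousOn.intervalIntegrable ((continuousOn_imag hR hf).mono fun r hr => ?_)
  rw [Set.uIcc_of_le ha] at hr
  exact hr.1

lemma intervalIntegrable_arc {c : ℝ} (hc : R ≤ c) :
    IntervalIntegrable (fun θ : ℝ => f (c * exp (θ * I)) * (I * (c * exp (θ * I)))) volume 0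
      (-(Real.pi / 2)) := by
  refine ContinuousOn.intervalIntegrable (ContinuousOn.mul
    (hf.comp (f := fun θ : ℝ => (c * exp (θ * I) : ℂ)) (by fun_prop) fun θ hθ => ?_) (by fun_prop))
  rw [Set.uIcc_of_ge (by linarith [Real.pi_pos])] at hθ
  exact arc_mem_closedSector hR hc hθ

lemma sectorIntegral_add {g : ℂ → ℂ} (hg : ContinuousOn g (closedSector R)) {a b : ℝ}
    (ha : R ≤ a) (hb : R ≤ b) :
    sectorIntegral R (fun z => f z + g z) a b
      = sectorIntegral R f a b + sectorIntegral R g a b := by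
  simp only [sectorIntegral_eq, add_mul]
  rw [intervalIntegral.integral_add (intervalIntegrable_real hR hf ha)
      (intervalIntegrable_real hR hg ha),
    intervalIntegral.integral_add (intervalIntegrable_arc hR hf le_rfl)
      (intervalIntegrable_arc hR hg le_rfl),
    intervalIntegral.integral_add (intervalIntegrable_imag hR hf hb)
      (intervalIntegrable_imag hR hg hb)]
  ring

end Integrable

lemma sectorIntegral_const_mul (R : ℝ) (f : ℂ → ℂ) (k : ℂ) (a b : ℝ) :
    sectorIntegral R (fun z => k * f z) a b = k * sectorIntegral R f a b := by
  simp only [sectorIntegral_eq, mul_assoc, intervalIntegral.integral_const_mul]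
  ring

/-- `f` is continuous on the closed sector and its improper integral over the boundary, the two
ends tending to infinity at the same rate, converges to `v`. -/
def HasSymmIntegral (R : ℝ) (f : ℂ → ℂ) (v : ℂ) : Prop :=
  ContinuousOn f (closedSector R) ∧ Tendsto (fun c => sectorIntegral R f c c) atTop (𝓝 v)

namespace HasSymmIntegral
variable {R : ℝ} {f g : ℂ → ℂ} {v w : ℂ}

lemma add (hR : 0 < R) (hf : HasSymmIntegral R f v) (hg : HasSymmIntegral R g w) :
    HasSymmIntegral R (fun z => f z + g z) (v + w) := by
  refine ⟨hf.1.add hg.1, (hf.2.add hg.2).congr' ?_⟩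
  filter_upwards [eventually_ge_atTop R] with c hc
  exact (sectorIntegral_add hR hf.1 hg.1 hc hc).symm

lemma const_mul (k : ℂ) (hf : HasSymmIntegral R f v) :
    HasSymmIntegral R (fun z => k * f z) (k * v) := by
  refine ⟨continuousOn_const.mul hf.1, ?_⟩
  simp only [sectorIntegral_const_mul]
  exact hf.2.const_mul k

lemma sub (hR : 0 < R) (hf : HasSymmIntegral R f v) (hg : HasSymmIntegral R g w) :
    HasSymmIntegral R (fun z => f z - g z) (v - w) := by
  simpa only [neg_one_mul, ← sub_eq_add_neg] using hf.add hR (hg.const_mul (-1))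

lemma congr (hR : 0 < R) (hf : HasSymmIntegral R f v) (h : Set.EqOn g f (closedSector R)) :
    HasSymmIntegral R g v := by
  refine ⟨hf.1.congr h, hf.2.congr' ?_⟩
  filter_upwards [eventually_ge_atTop R] with c hc
  exact (sectorIntegral_congr hR h hc hc).symm

lemma unique (hf : HasSymmIntegral R f v) (hg : HasSymmIntegral R f w) : v = w :=
  tendsto_nhds_unique hf.2 hg.2

end HasSymmIntegral

lemma HasIntegralD4.hasSymmIntegral {R : ℝ} {f : ℂ → ℂ} {v : ℂ}
    (h : HasIntegralD4 R f v) (hf : ContinuousOn f (closedSector R)) : HasSymmIntegral R f v := by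
  have h2 : Tendsto (fun c : ℝ => (c, c)) atTop (atTop : Filter (ℝ × ℝ)) := tendsto_atTop_diagonal
  have h' : Tendsto (fun c : ℝ × ℝ => wedgeIntegral 0 (-(Real.pi / 2)) R f c.1 c.2) atTop (𝓝 v) := h
  have h3 := Tendsto.comp h' h2
  exact And.intro hf h3

lemma HasIntegralD4.congr {R : ℝ} (hR : 0 < R) {f g : ℂ → ℂ} {v : ℂ} (hf : HasIntegralD4 R f v)
    (h : Set.EqOn g f (closedSector R)) : HasIntegralD4 R g v := by
  refine Tendsto.congr' ?_ hf
  rw [← prod_atTop_atTop_eq]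
  filter_upwards [prod_mem_prod (Ici_mem_atTop R) (Ici_mem_atTop R)] with c hc
  exact (sectorIntegral_congr hR h hc.1 hc.2).symm

lemma HasIntegralD4.neg {R : ℝ} {f : ℂ → ℂ} {v : ℂ} (hf : HasIntegralD4 R f v) :
    HasIntegralD4 R (fun z => -f z) (-v) := by
  refine (Tendsto.neg hf).congr fun c => ?_
  have h := sectorIntegral_const_mul R f (-1) c.1 c.2
  simp only [neg_one_mul] at h
  exact h.symm

/-- The two ends of the path may be treated separately, since the arc has finite length. -/
lemma hasIntegralD4_of_rays {R : ℝ} {f : ℂ → ℂ} {v w : ℂ}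
    (hre : Tendsto (fun a : ℝ => ∫ r in R..a, f r) atTop (𝓝 v))
    (him : Tendsto (fun b : ℝ => ∫ r in R..b, f (-(I * r)) * -I) atTop (𝓝 w)) :
    ∃ J, HasIntegralD4 R f J := by
  refine ⟨-v + (∫ θ in (0 : ℝ)..(-(Real.pi / 2)), f (R * exp (θ * I)) * (I * (R * exp (θ * I))))
    + w, ?_⟩
  have : ∀ c : ℝ × ℝ, wedgeIntegral 0 (-(Real.pi / 2)) R f c.1 c.2 = _ :=
    fun c => sectorIntegral_eq R f c.1 c.2
  unfold HasIntegralD4 HasWedgeIntegral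
  simp only [this]
  rw [← prod_atTop_atTop_eq]
  exact ((hre.comp tendsto_fst).neg.add tendsto_const_nhds).add (him.comp tendsto_snd)

/-- Rotating the path of integration by a right angle turns the boundary of the sector in the
third quadrant into that in the fourth. -/
lemma HasIntegralD4.hasIntegralD3 {R : ℝ} (hR : 0 < R) {f g : ℂ → ℂ} {v : ℂ}
    (hf : HasIntegralD4 R f v) (h : ∀ z ∈ closedSector R, f z = g (-(I * z)) * -I) :
    HasIntegralD3 R g v := by
  refine Tendsto.congr (fun c => ?_) (hf.congr hR (g := fun z => g (-(I * z)) * -I)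
    fun z hz => (h z hz).symm)
  have e1 : exp ((-(Real.pi / 2) : ℝ) * I) = -I := exp_neg_half_pi
  have e2 : exp ((-Real.pi : ℝ) * I) = -1 := by
    push_cast; rw [neg_mul, Complex.exp_neg, Complex.exp_pi_mul_I]; norm_num
  have hs : ∀ θ : ℝ, exp ((θ + -(Real.pi / 2) : ℝ) * I) = -I * exp (θ * I) := fun θ => by
    rw [← e1, ← Complex.exp_add]; congr 1; push_cast; ring
  refine (sectorIntegral_eq R _ c.1 c.2).trans ?_
  unfold wedgeIntegral
  rw [e1, e2]
  congr 1
  · congr 1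
    · congr 1
      refine intervalIntegral.integral_congr fun r _ => ?_
      simp only [mul_neg, mul_comm I]
    · have := intervalIntegral.integral_comp_add_right (a := (0 : ℝ)) (b := -(Real.pi / 2))
        (fun θ : ℝ => g (R * exp (θ * I)) * (I * (R * exp (θ * I)))) (-(Real.pi / 2))
      rw [zero_add, show -(Real.pi / 2) + -(Real.pi / 2) = -Real.pi by ring] at this
      rw [← this]
      refine intervalIntegral.integral_congr fun θ _ => ?_
      simp only [hs]
      rw [show -(I * (R * exp (θ * I))) = R * (-I * exp (θ * I)) by ring]
      ring
  · refine intervalIntegral.integral_congr fun r _ => ?_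
    rw [show -(I * -(I * (r : ℂ))) = r * -1 by linear_combination (r : ℂ) * Complex.I_mul_I,
      mul_assoc, neg_mul_neg, Complex.I_mul_I]

/-- Rotating the path of integration by a right angle turns the boundary of the sector in the
first quadrant into that in the fourth. -/
lemma HasIntegralD4.hasIntegralD1 {R : ℝ} (hR : 0 < R) {f g : ℂ → ℂ} {v : ℂ}
    (hf : HasIntegralD4 R f v) (h : ∀ z ∈ closedSector R, f z = g (I * z) * I) :
    HasIntegralD1 R g v := by
  refine Tendsto.congr (fun c => ?_) (hf.congr hR (g := fun z => g (I * z) * I)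
    fun z hz => (h z hz).symm)
  have e1 : exp ((Real.pi / 2 : ℝ) * I) = I := by
    push_cast; exact Complex.exp_pi_div_two_mul_I
  have e2 : exp ((0 : ℝ) * I) = 1 := by simp
  have hs : ∀ θ : ℝ, exp ((θ + Real.pi / 2 : ℝ) * I) = I * exp (θ * I) := fun θ => by
    nth_rw 2 [← e1]; rw [← Complex.exp_add]; congr 1; push_cast; ring
  refine (sectorIntegral_eq R _ c.1 c.2).trans ?_
  unfold wedgeIntegral
  rw [e1, e2]
  congr 1
  · congr 1
    · congr 1
      refine intervalIntegral.integral_congr fun r _ => ?_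
      simp only [mul_comm I]
    · have := intervalIntegral.integral_comp_add_right (a := (0 : ℝ)) (b := -(Real.pi / 2))
        (fun θ : ℝ => g (R * exp (θ * I)) * (I * (R * exp (θ * I)))) (Real.pi / 2)
      rw [zero_add, neg_add_cancel] at this
      rw [← this]
      refine intervalIntegral.integral_congr fun θ _ => ?_
      simp only [hs]
      rw [show I * (R * exp (θ * I)) = R * (I * exp (θ * I)) by ring]
      ring
  · refine intervalIntegral.integral_congr fun r _ => ?_
    rw [show I * -(I * (r : ℂ)) = r * 1 by linear_combination -(r : ℂ) * Complex.I_mul_I,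
      mul_assoc, mul_neg, Complex.I_mul_I, neg_neg]

/-! ### The square roots `√(1 + a / z²)` and `√(z² + a)` -/

lemma root_sq (a : ℝ) (z : ℂ) : root a z ^ 2 = 1 + a / z ^ 2 := by
  have := Complex.cpow_nat_inv_pow (1 + (a : ℂ) / z ^ 2) (n := 2) two_ne_zero
  rw [root, one_div]; exact_mod_cast this

@[simp] lemma root_zero (z : ℂ) : root 0 z = 1 := by simp [root]

lemma norm_div_sq_lt {a : ℝ} {z : ℂ} (h : 2 * |a| < ‖z‖ ^ 2) : ‖(a : ℂ) / z ^ 2‖ < 1 / 2 := by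
  have h0 : 0 < ‖z‖ ^ 2 := lt_of_le_of_lt (by positivity) h
  rw [norm_div, norm_pow, Complex.norm_real, Real.norm_eq_abs, div_lt_iff₀ h0]
  linarith

lemma re_radicand_pos {a : ℝ} {z : ℂ} (h : 2 * |a| < ‖z‖ ^ 2) : 0 < (1 + (a : ℂ) / z ^ 2).re := by
  have h1 := (abs_le.1 (Complex.abs_re_le_norm ((a : ℂ) / z ^ 2))).1
  have h2 := norm_div_sq_lt h
  rw [Complex.add_re, Complex.one_re]
  linarith

lemma re_root_pos {a : ℝ} {z : ℂ} (h : 2 * |a| < ‖z‖ ^ 2) : 0 < (root a z).re := by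
  rw [root, one_div, Complex.cpow_inv_two_re]
  have := re_radicand_pos h
  positivity

lemma root_ne_zero {a : ℝ} {z : ℂ} (h : 2 * |a| < ‖z‖ ^ 2) : root a z ≠ 0 := fun h0 => by
  simpa [h0] using re_root_pos h

lemma abs_im_root_lt {a : ℝ} {z : ℂ} (h : 2 * |a| < ‖z‖ ^ 2) :
    |(root a z).im| < (root a z).re := by
  have h1 := re_radicand_pos h
  rw [← root_sq, sq, Complex.mul_re] at h1
  exact abs_lt_of_sq_lt_sq (by nlinarith) (re_root_pos h).le

lemma differentiableAt_root {a : ℝ} {z : ℂ} (h : 2 * |a| < ‖z‖ ^ 2) :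
    DifferentiableAt ℂ (root a) z := by
  have hz : z ≠ 0 := by
    rintro rfl
    simp only [norm_zero, ne_eq, OfNat.ofNat_ne_zero, not_false_eq_true, zero_pow] at h
    linarith [abs_nonneg a]
  refine DifferentiableAt.cpow_const ?_ (Or.inl (re_radicand_pos h))
  fun_prop (disch := positivity)

/-- A branch of `√(z² + a)`, holomorphic for `|z|² > 2|a|` and asymptotic to `z`. -/
def ell (a : ℝ) (z : ℂ) : ℂ := z * root a z

@[simp] lemma ell_zero (z : ℂ) : ell 0 z = z := by simp [ell]

lemma ell_sq {a : ℝ} {z : ℂ} (hz : z ≠ 0) : ell a z ^ 2 = z ^ 2 + a := by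
  rw [ell, mul_pow, root_sq]; field_simp

section Sector
variable {R a : ℝ} {z : ℂ}

lemma lt_norm_sq (hR : 0 < R) (ha : 2 * |a| < R ^ 2) (hz : z ∈ closedSector R) :
    2 * |a| < ‖z‖ ^ 2 :=
  ha.trans_le (pow_le_pow_left₀ hR.le hz.1 2)

lemma ne_zero_of_mem (hR : 0 < R) (hz : z ∈ closedSector R) : z ≠ 0 :=
  norm_pos_iff.1 (hR.trans_le hz.1)

variable (hR : 0 < R) (ha : 2 * |a| < R ^ 2)
include hR ha

lemma ell_ne_zero (hz : z ∈ closedSector R) : ell a z ≠ 0 :=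
  mul_ne_zero (ne_zero_of_mem hR hz) (root_ne_zero (lt_norm_sq hR ha hz))

/-- The branch `ell` is singled out by its direction. -/
lemma eq_ell {w : ℂ} (hz : z ∈ closedSector R) (h : w ^ 2 = z ^ 2 + a)
    (hp : 0 < (w * (starRingEnd ℂ) z).re) : w = ell a z := by
  rw [← ell_sq (ne_zero_of_mem hR hz), sq_eq_sq_iff_eq_or_eq_neg] at h
  refine h.resolve_right fun h => ?_
  have h1 := re_root_pos (lt_norm_sq hR ha hz)
  have h2 : w * (starRingEnd ℂ) z = ((-‖z‖ ^ 2 : ℝ) : ℂ) * root a z := by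
    rw [h, ell]; push_cast; rw [← Complex.mul_conj']; ring
  rw [h2, Complex.re_ofReal_mul] at hp
  nlinarith [sq_nonneg ‖z‖]

lemma ell_ofReal {r : ℝ} (hr : R ≤ r) : ell a r = (√(r ^ 2 + a) : ℝ) := by
  have hz := ofReal_mem_closedSector hR hr
  have h1 := neg_abs_le a
  have h2 : R ^ 2 ≤ r ^ 2 := pow_le_pow_left₀ hR.le hr 2
  have hp : 0 < r ^ 2 + a := by linarith [abs_nonneg a]
  refine (eq_ell hR ha hz ?_ ?_).symm
  · rw [← Complex.ofReal_pow, Real.sq_sqrt hp.le]; push_cast; rfl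
  · rw [Complex.conj_ofReal, ← Complex.ofReal_mul, Complex.ofReal_re]
    have := hR.trans_le hr
    positivity

lemma ell_neg_I_mul {r : ℝ} (hr : R ≤ r) : ell a (-(I * r)) = -(I * (√(r ^ 2 - a) : ℝ)) := by
  have hz := neg_I_mul_mem_closedSector hR hr
  have h1 := le_abs_self a
  have h2 : R ^ 2 ≤ r ^ 2 := pow_le_pow_left₀ hR.le hr 2
  have hp : 0 < r ^ 2 - a := by linarith [abs_nonneg a]
  refine (eq_ell hR ha hz ?_ ?_).symm
  · rw [neg_sq, mul_pow, ← Complex.ofReal_pow, Real.sq_sqrt hp.le, neg_sq, mul_pow]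
    push_cast; rw [Complex.I_sq]; ring
  · have h3 : -(I * (√(r ^ 2 - a) : ℝ)) * (starRingEnd ℂ) (-(I * r))
        = ((√(r ^ 2 - a) * r : ℝ) : ℂ) := by
      simp only [map_neg, map_mul, Complex.conj_I, Complex.conj_ofReal]
      push_cast
      linear_combination -((√(r ^ 2 - a) : ℝ) : ℂ) * r * Complex.I_mul_I
    rw [h3, Complex.ofReal_re]
    have := hR.trans_le hr
    positivity

/-- `√(z² + a)` stays in the right half plane: its square has the imaginary part of `z²`, and it
makes an acute angle with `z`. -/
lemma re_ell_nonneg (hz : z ∈ closedSector R) : 0 ≤ (ell a z).re := by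
  by_contra! hneg
  have h1 := re_root_pos (lt_norm_sq hR ha hz)
  have h2 : ell a z * (starRingEnd ℂ) z = ((‖z‖ ^ 2 : ℝ) : ℂ) * root a z := by
    rw [ell]; push_cast; rw [← Complex.mul_conj']; ring
  have h3 := congrArg Complex.re h2
  rw [Complex.re_ofReal_mul, Complex.mul_re, Complex.conj_re, Complex.conj_im] at h3
  have h4 := congrArg Complex.im (ell_sq (a := a) (ne_zero_of_mem hR hz))
  simp only [sq, Complex.mul_im, Complex.add_im, Complex.ofReal_im] at h4
  have h5 : 0 < ‖z‖ ^ 2 * (root a z).re := mul_pos (by have := hR.trans_le hz.1; positivity) h1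
  have h6 : 0 ≤ (ell a z).im := by
    by_contra! h
    nlinarith [mul_pos_of_neg_of_neg hneg h, mul_nonneg hz.2.1 (neg_nonneg.2 hz.2.2)]
  nlinarith [mul_nonneg hz.2.1 (neg_pos.2 hneg).le, mul_nonneg h6 (neg_nonneg.2 hz.2.2)]

lemma re_ell_pos (hz : z ∈ openSector R) : 0 < (ell a z).re := by
  have hz' := openSector_subset R hz
  refine (re_ell_nonneg hR ha hz').lt_of_ne fun h => ?_
  have h4 := congrArg Complex.im (ell_sq (a := a) (ne_zero_of_mem hR hz'))
  simp only [sq, Complex.mul_im, Complex.add_im, Complex.ofReal_im, ← h] at h4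
  nlinarith [mul_pos hz.2.1 (neg_pos.2 hz.2.2)]

lemma differentiableAt_ell (hz : z ∈ closedSector R) : DifferentiableAt ℂ (ell a) z :=
  differentiableAt_id.mul (differentiableAt_root (lt_norm_sq hR ha hz))

lemma continuousOn_ell : ContinuousOn (ell a) (closedSector R) :=
  fun _ hz => (differentiableAt_ell hR ha hz).continuousAt.continuousWithinAt

lemma differentiableOn_ell : DifferentiableOn ℂ (ell a) (openSector R) :=
  fun _ hz => (differentiableAt_ell hR ha (openSector_subset R hz)).differentiableWithinAt

lemma hasDerivAt_ell (hz : z ∈ closedSector R) : HasDerivAt (ell a) (root a z)⁻¹ z := by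
  have hd := (differentiableAt_ell hR ha hz).hasDerivAt
  have h0 := ne_zero_of_mem hR hz
  have h1 := root_ne_zero (lt_norm_sq hR ha hz)
  have e : (fun w => ell a w ^ 2) =ᶠ[𝓝 z] fun w => w ^ 2 + a := by
    filter_upwards [isOpen_ne.mem_nhds h0] with w hw using ell_sq hw
  have h2 := (hd.pow 2).unique (((hasDerivAt_pow 2 z).add_const (a : ℂ)).congr_of_eventuallyEq e)
  rw [ell] at h2
  simp only [Nat.cast_ofNat, Nat.add_one_sub_one, pow_one] at h2
  have h3 : (root a z)⁻¹ = deriv (ell a) z :=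
    inv_eq_of_mul_eq_one_right (mul_left_cancel₀ (mul_ne_zero two_ne_zero h0)
      (by linear_combination h2))
  rwa [h3]

lemma norm_le_of_root_add_one (hz : z ∈ closedSector R) : 1 ≤ ‖root a z + 1‖ := by
  refine le_trans ?_ (Complex.re_le_norm _)
  have := re_root_pos (lt_norm_sq hR ha hz)
  simp only [Complex.add_re, Complex.one_re]; linarith

lemma root_sub_one_mul (hz : z ∈ closedSector R) :
    z * (root a z - 1) = a * z⁻¹ * (root a z + 1)⁻¹ := by
  have h0 := ne_zero_of_mem hR hz
  have h1 : root a z + 1 ≠ 0 := norm_pos_iff.1 (by linarith [norm_le_of_root_add_one hR ha hz])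
  have h2 := root_sq a z
  field_simp at h2 ⊢
  linear_combination h2

end Sector

/-! ### Amplitudes -/

/-- The filter of points of the closed sector tending to infinity. -/
def farSector (R : ℝ) : Filter ℂ := comap norm atTop ⊓ 𝓟 (closedSector R)

lemma mem_farSector (R : ℝ) : closedSector R ∈ farSector R :=
  mem_inf_of_right (mem_principal_self _)

lemma tendsto_norm_farSector (R : ℝ) : Tendsto norm (farSector R) atTop :=
  tendsto_comap.mono_left inf_le_left

lemma tendsto_inv_farSector (R : ℝ) : Tendsto (fun z : ℂ => z⁻¹) (farSector R) (𝓝 0) := by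
  rw [tendsto_zero_iff_norm_tendsto_zero]
  simp only [norm_inv]
  exact tendsto_inv_atTop_zero.comp (tendsto_norm_farSector R)

lemma tendsto_ofReal_farSector {R : ℝ} (hR : 0 < R) :
    Tendsto (fun r : ℝ => (r : ℂ)) atTop (farSector R) := by
  refine tendsto_inf.2 ⟨tendsto_comap_iff.2 ?_, tendsto_principal.2 ?_⟩
  · refine tendsto_id.congr' ?_
    filter_upwards [eventually_ge_atTop 0] with r hr
    simp [abs_of_nonneg hr]
  · filter_upwards [eventually_ge_atTop R] with r hr using ofReal_mem_closedSector hR hr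

lemma tendsto_neg_I_mul_farSector {R : ℝ} (hR : 0 < R) :
    Tendsto (fun r : ℝ => (-(I * r) : ℂ)) atTop (farSector R) := by
  refine tendsto_inf.2 ⟨tendsto_comap_iff.2 ?_, tendsto_principal.2 ?_⟩
  · refine tendsto_id.congr' ?_
    filter_upwards [eventually_ge_atTop 0] with r hr
    simp [abs_of_nonneg hr]
  · filter_upwards [eventually_ge_atTop R] with r hr using neg_I_mul_mem_closedSector hR hr

/-- Functions that are holomorphic in the open sector, continuous up to its boundary and equal to
`m + O(1 / z)` at infinity. -/
structure IsAmplitude (R : ℝ) (A : ℂ → ℂ) (m : ℂ) : Prop where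
  cont : ContinuousOn A (closedSector R)
  diff : DifferentiableOn ℂ A (openSector R)
  isBigO : (fun z => A z - m) =O[farSector R] fun z => z⁻¹

namespace IsAmplitude
variable {R : ℝ} {A B : ℂ → ℂ} {m n : ℂ}

lemma const (R : ℝ) (m : ℂ) : IsAmplitude R (fun _ => m) m :=
  ⟨continuousOn_const, differentiableOn_const _, by
    simpa using Asymptotics.isBigO_zero (fun z : ℂ => z⁻¹) (farSector R)⟩

lemma congr (h : IsAmplitude R A m) (e : Set.EqOn B A (closedSector R)) : IsAmplitude R B m := by
  refine ⟨h.cont.congr e, h.diff.congr (e.mono (openSector_subset R)),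
    h.isBigO.congr' ?_ EventuallyEq.rfl⟩
  filter_upwards [mem_farSector R] with z hz
  rw [e hz]

lemma tendsto (h : IsAmplitude R A m) : Tendsto A (farSector R) (𝓝 m) := by
  have := (h.isBigO.trans_tendsto (tendsto_inv_farSector R)).add_const m
  simpa using this

lemma add (h : IsAmplitude R A m) (k : IsAmplitude R B n) :
    IsAmplitude R (fun z => A z + B z) (m + n) :=
  ⟨h.cont.add k.cont, h.diff.add k.diff, by
    simpa only [add_sub_add_comm] using h.isBigO.add k.isBigO⟩

lemma mul (h : IsAmplitude R A m) (k : IsAmplitude R B n) :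
    IsAmplitude R (fun z => A z * B z) (m * n) := by
  refine ⟨h.cont.mul k.cont, h.diff.mul k.diff, ?_⟩
  have h1 : (fun z => (A z - m) * B z) =O[farSector R] fun z => z⁻¹ * 1 :=
    h.isBigO.mul (k.tendsto.isBigO_one ℂ)
  have h2 := (k.isBigO.const_mul_left m)
  simp only [mul_one] at h1
  refine (h1.add h2).congr_left fun z => by ring

lemma const_mul (k : ℂ) (h : IsAmplitude R A m) : IsAmplitude R (fun z => k * A z) (k * m) :=
  (const R k).mul h

lemma sub (h : IsAmplitude R A m) (k : IsAmplitude R B n) :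
    IsAmplitude R (fun z => A z - B z) (m - n) := by
  simpa only [neg_one_mul, ← sub_eq_add_neg] using h.add (k.const_mul (-1))

lemma inv (h : IsAmplitude R A m) (hm : m ≠ 0) (h0 : ∀ z ∈ closedSector R, A z ≠ 0) :
    IsAmplitude R (fun z => (A z)⁻¹) m⁻¹ := by
  refine ⟨h.cont.inv₀ h0, h.diff.inv fun z hz => h0 z (openSector_subset R hz), ?_⟩
  have h1 : (fun z => (A z)⁻¹ * (A z - m)) =O[farSector R] fun z => 1 * z⁻¹ :=
    ((h.tendsto.inv₀ hm).isBigO_one ℂ).mul h.isBigO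
  simp only [one_mul] at h1
  refine (h1.const_mul_left (-m⁻¹)).congr' ?_ EventuallyEq.rfl
  filter_upwards [mem_farSector R] with z hz
  have := h0 z hz
  field_simp
  ring

/-- A bounded factor is harmless next to an amplitude that vanishes at infinity. -/
lemma mul_bounded (h : IsAmplitude R A 0) (hc : ContinuousOn B (closedSector R))
    (hd : DifferentiableOn ℂ B (openSector R)) (hb : B =O[farSector R] fun _ => (1 : ℂ)) :
    IsAmplitude R (fun z => A z * B z) 0 := by
  refine ⟨h.cont.mul hc, h.diff.mul hd, ?_⟩
  have h1 : (fun z => A z * B z) =O[farSector R] fun z => z⁻¹ * 1 := by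
    simpa using h.isBigO.mul hb
  simpa using h1

lemma exp (h : IsAmplitude R A 0) : IsAmplitude R (fun z => Complex.exp (A z)) 1 := by
  refine ⟨h.cont.cexp, h.diff.cexp, ?_⟩
  have h1 := (Complex.hasDerivAt_exp 0).isBigO_sub
  have h2 := (h1.comp_tendsto h.tendsto).congr_left (f₂ := fun z => Complex.exp (A z) - 1)
    fun z => by simp
  exact h2.trans (by simpa [Function.comp_def] using h.isBigO)

end IsAmplitude

lemma isAmplitude_inv {R : ℝ} (hR : 0 < R) : IsAmplitude R (fun z => z⁻¹) 0 :=
  ⟨continuousOn_id.inv₀ fun _ hz => ne_zero_of_mem hR hz,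
    differentiableOn_id.inv fun _ hz => ne_zero_of_mem hR (openSector_subset R hz), by
    simpa using Asymptotics.isBigO_refl _ _⟩

section Root
variable {R a : ℝ} (hR : 0 < R) (ha : 2 * |a| < R ^ 2)
include hR ha

lemma isAmplitude_mul_root_sub_one : IsAmplitude R (fun z => z * (root a z - 1)) 0 := by
  have hd : ∀ z ∈ closedSector R, DifferentiableAt ℂ (fun z => z * (root a z - 1)) z :=
    fun z hz => differentiableAt_id.mul
      ((differentiableAt_root (lt_norm_sq hR ha hz)).sub_const 1)
  refine ⟨fun z hz => (hd z hz).continuousAt.continuousWithinAt,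
    fun z hz => (hd z (openSector_subset R hz)).differentiableWithinAt, ?_⟩
  refine Asymptotics.IsBigO.of_bound |a| ?_
  filter_upwards [mem_farSector R] with z hz
  rw [sub_zero, root_sub_one_mul hR ha hz, norm_mul, norm_mul, Complex.norm_real, Real.norm_eq_abs,
    norm_inv (root a z + 1)]
  exact mul_le_of_le_one_right (by positivity) (inv_le_one_of_one_le₀
    (norm_le_of_root_add_one hR ha hz))

lemma isAmplitude_root : IsAmplitude R (root a) 1 := by
  have h := (isAmplitude_mul_root_sub_one hR ha).mul (isAmplitude_inv hR)
  have h2 := h.add (IsAmplitude.const R 1)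
  have e : Set.EqOn (root a) (fun z => z * (root a z - 1) * z⁻¹ + 1) (closedSector R) :=
    fun z hz => by have := ne_zero_of_mem hR hz; field_simp; ring
  simpa using h2.congr e

lemma isAmplitude_root_inv : IsAmplitude R (fun z => (root a z)⁻¹) 1 := by
  simpa using (isAmplitude_root hR ha).inv one_ne_zero
    fun z hz => root_ne_zero (lt_norm_sq hR ha hz)

/-- Two branches `√(z² + a)`, `√(z² + b)` may be exchanged in an exponential. -/
lemma isAmplitude_exp_ell_sub {b : ℝ} (hb : 2 * |b| < R ^ 2) (p : ℝ) :
    IsAmplitude R (fun z => exp (p * (ell a z - ell b z))) 1 := by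
  have h := ((isAmplitude_mul_root_sub_one hR ha).sub
    (isAmplitude_mul_root_sub_one hR hb)).const_mul p
  have e : ∀ z : ℂ, p * (ell a z - ell b z) = p * (z * (root a z - 1) - z * (root b z - 1)) :=
    fun z => by unfold ell; ring
  simp only [e]
  refine IsAmplitude.exp ?_
  simpa using h

end Root

/-! ### Fresnel integrals -/

lemma integrable_kernel {μ : Measure ℝ} [SFinite μ] {G : ℝ → ℂ} (hG : Integrable G μ)
    {k : ℝ → ℝ → ℂ} {a b C : ℝ}
    (hk : ContinuousOn (Function.uncurry k) (Set.uIcc a b ×ˢ Set.univ))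
    (hC : ∀ᵐ y ∂μ, ∀ m ∈ Set.uIcc a b, ‖k m y‖ ≤ C) :
    Integrable (fun p : ℝ × ℝ => k p.1 p.2 * G p.2) ((volume.restrict (Set.uIoc a b)).prod μ) := by
  have : IsFiniteMeasure (volume.restrict (Set.uIoc a b)) := ⟨by simp [Set.uIoc]⟩
  have h1 : Integrable (fun p : ℝ × ℝ => G p.2) ((volume.restrict (Set.uIoc a b)).prod μ) :=
    hG.comp_snd _
  have e : (volume.restrict (Set.uIoc a b)).prod μ
      = (volume.prod μ).restrict (Set.uIoc a b ×ˢ Set.univ) := by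
    rw [← Measure.prod_restrict, Measure.restrict_univ]
  have hm : AEStronglyMeasurable (Function.uncurry k)
      ((volume.restrict (Set.uIoc a b)).prod μ) := by
    rw [e]
    exact (hk.mono (Set.prod_mono_left Set.uIoc_subset_uIcc)).aestronglyMeasurable
      (measurableSet_uIoc.prod MeasurableSet.univ)
  refine Integrable.bdd_mul (c := C) h1 hm ?_
  filter_upwards [Measure.quasiMeasurePreserving_snd.ae hC,
    Measure.quasiMeasurePreserving_fst.ae (ae_restrict_mem measurableSet_uIoc)] with p h1 h2
  exact h1 p.1 (Set.uIoc_subset_uIcc h2)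

/-- Change of the order of integration for a bounded continuous kernel and an integrable density. -/
lemma intervalIntegral_kernel_swap {μ : Measure ℝ} [SFinite μ] {G : ℝ → ℂ} (hG : Integrable G μ)
    {k : ℝ → ℝ → ℂ} {a b C : ℝ}
    (hk : ContinuousOn (Function.uncurry k) (Set.uIcc a b ×ˢ Set.univ))
    (hC : ∀ᵐ y ∂μ, ∀ m ∈ Set.uIcc a b, ‖k m y‖ ≤ C) :
    ∫ m in a..b, ∫ y, k m y * G y ∂μ = ∫ y, (∫ m in a..b, k m y) * G y ∂μ := by
  simp_rw [← intervalIntegral.integral_mul_const]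
  exact intervalIntegral_integral_swap (integrable_kernel hG hk hC)

lemma integrable_intervalIntegral_kernel {μ : Measure ℝ} [SFinite μ] {G : ℝ → ℂ}
    (hG : Integrable G μ) {k : ℝ → ℝ → ℂ} {a b C : ℝ}
    (hk : ContinuousOn (Function.uncurry k) (Set.uIcc a b ×ˢ Set.univ))
    (hC : ∀ᵐ y ∂μ, ∀ m ∈ Set.uIcc a b, ‖k m y‖ ≤ C) :
    Integrable (fun y => (∫ m in a..b, k m y) * G y) μ := by
  have h := (integrable_kernel hG hk hC).integral_prod_right
  simp_rw [intervalIntegral.intervalIntegral_eq_integral_uIoc, smul_mul_assoc]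
  refine Integrable.smul _ ?_
  simpa only [integral_mul_const] using h

/-- `∫_0^u e^{-itr²} dr`. -/
def fresnel (t u : ℝ) : ℂ := ∫ r in (0 : ℝ)..u, exp (-(I * t * r ^ 2))

lemma norm_exp_neg_I_mul_sq (t r : ℝ) : ‖exp (-(I * t * r ^ 2))‖ = 1 := by
  rw [show -(I * t * r ^ 2) = ((-(t * r ^ 2) : ℝ) : ℂ) * I by push_cast; ring,
    Complex.norm_exp_ofReal_mul_I]

/-- An integration by parts shows that the Fresnel integral converges. -/
lemma exists_tendsto_fresnel {t : ℝ} (ht : 0 < t) : ∃ v, Tendsto (fresnel t) atTop (𝓝 v) := by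
  set h : ℝ → ℂ := fun r => exp (-(I * t * r ^ 2)) * (I / (2 * t * r)) with hh
  set q : ℝ → ℂ := fun r => I / (2 * t) * ((r ^ (-2 : ℝ) : ℝ) * exp (-(I * t * r ^ 2))) with hq
  have ht' : (t : ℂ) ≠ 0 := by exact_mod_cast ht.ne'
  have hqi : IntegrableOn q (Set.Ioi 1) := by
    refine Integrable.const_mul ?_ _
    have h1 : IntegrableOn (fun r : ℝ => ((r ^ (-2 : ℝ) : ℝ) : ℂ)) (Set.Ioi 1) :=
      (integrableOn_Ioi_rpow_of_lt (by norm_num) one_pos).ofReal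
    exact h1.mul_bdd (c := 1)
      (Continuous.aestronglyMeasurable (by fun_prop))
      (ae_of_all _ fun r => (norm_exp_neg_I_mul_sq t r).le)
  -- `h` is the boundary term of the partial integration and `q` the remaining integrand `O(r⁻²)`.
  have hder : ∀ r : ℝ, 0 < r → HasDerivAt h (exp (-(I * t * r ^ 2)) - q r) r := by
    intro r hr
    have hr' : (r : ℂ) ≠ 0 := by exact_mod_cast hr.ne'
    have d0 : HasDerivAt (fun r : ℂ => exp (-(I * t * r ^ 2)) * (I / (2 * t * r)))
        (exp (-(I * t * r ^ 2)) * -(I * t * (2 * r)) * (I / (2 * t * r))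
          + exp (-(I * t * r ^ 2)) * (-(I * (2 * t)) / (2 * t * r) ^ 2)) (r : ℂ) := by
      have e1 : HasDerivAt (fun r : ℂ => exp (-(I * t * r ^ 2)))
          (exp (-(I * t * r ^ 2)) * -(I * t * (2 * r))) (r : ℂ) := by
        have := ((hasDerivAt_pow 2 (r : ℂ)).const_mul (I * t)).neg.cexp
        simpa using this
      have e2 : HasDerivAt (fun r : ℂ => I / (2 * t * r))
          (-(I * (2 * t)) / (2 * t * r) ^ 2) (r : ℂ) := by
        have := (hasDerivAt_const (r : ℂ) I).fun_div
          ((hasDerivAt_id (r : ℂ)).const_mul (2 * (t : ℂ))) (by simp [ht', hr'])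
        simpa using this
      exact e1.mul e2
    have d1 := d0.comp_ofReal
    convert d1 using 1
    simp only [hq, Real.rpow_neg hr.le, Real.rpow_ofNat]
    push_cast
    field_simp
    linear_combination (2 * t * (r : ℂ) ^ 2) * Complex.I_sq
  have hcont : Continuous fun r : ℝ => exp (-(I * t * r ^ 2)) := by fun_prop
  have hev : ∀ᶠ u in atTop, fresnel t 1 + (h u - h 1 + ∫ r in (1 : ℝ)..u, q r) = fresnel t u := by
    filter_upwards [eventually_ge_atTop 1] with u hu
    have hqu : IntervalIntegrable q volume 1 u :=
      (intervalIntegrable_iff_integrableOn_Ioc_of_le hu).2 (hqi.mono_set Set.Ioc_subset_Ioi_self)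
    have := intervalIntegral.integral_eq_sub_of_hasDerivAt (a := 1) (b := u)
      (f := h) (f' := fun r : ℝ => exp (-(I * t * r ^ 2)) - q r)
      (fun r hr => hder r (by rw [Set.uIcc_of_le hu] at hr; linarith [hr.1]))
      ((hcont.intervalIntegrable _ _).sub hqu)
    rw [intervalIntegral.integral_sub (hcont.intervalIntegrable _ _) hqu] at this
    rw [← this, sub_add_cancel, fresnel, fresnel, intervalIntegral.integral_add_adjacent_intervals
      (hcont.intervalIntegrable _ _) (hcont.intervalIntegrable _ _)]
  have hlim : Tendsto h atTop (𝓝 0) := by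
    rw [tendsto_zero_iff_norm_tendsto_zero]
    have : Tendsto (fun r : ℝ => 1 / (2 * t) * r⁻¹) atTop (𝓝 0) := by
      simpa using tendsto_inv_atTop_zero.const_mul (1 / (2 * t))
    refine this.congr' ?_
    filter_upwards [eventually_gt_atTop 0] with r hr
    simp only [hh, norm_mul, norm_exp_neg_I_mul_sq, one_mul, norm_div, Complex.norm_I,
      Complex.norm_real, Complex.norm_ofNat, Real.norm_eq_abs, abs_of_pos hr, abs_of_pos ht]
    field_simp
  exact ⟨_, ((tendsto_const_nhds.add ((hlim.sub_const (h 1)).add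
    (intervalIntegral_tendsto_integral_Ioi 1 hqi tendsto_id))).congr' hev)⟩

lemma fresnel_neg (t u : ℝ) : fresnel t (-u) = -fresnel t u := by
  have := intervalIntegral.integral_comp_neg (a := 0) (b := u)
    (fun r : ℝ => exp (-(I * t * r ^ 2)))
  simp only [Complex.ofReal_neg, neg_sq, neg_zero] at this
  rw [fresnel, fresnel, this, intervalIntegral.integral_symm]

lemma exists_norm_fresnel_le {t : ℝ} (ht : 0 < t) : ∃ C, ∀ u, ‖fresnel t u‖ ≤ C := by
  obtain ⟨v, hv⟩ := exists_tendsto_fresnel ht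
  obtain ⟨N, hN⟩ := eventually_atTop.1 (hv.norm.eventually (gt_mem_nhds (lt_add_one ‖v‖)))
  have key : ∀ u, 0 ≤ u → ‖fresnel t u‖ ≤ |N| + (‖v‖ + 1) := by
    intro u hu
    rcases le_total u |N| with h | h
    · have := intervalIntegral.norm_integral_le_of_norm_le_const (a := 0) (b := u) (C := 1)
        (f := fun r : ℝ => exp (-(I * t * r ^ 2))) fun r _ => (norm_exp_neg_I_mul_sq t r).le
      rw [one_mul, sub_zero, abs_of_nonneg hu] at this
      exact this.trans (h.trans (le_add_of_nonneg_right (by positivity)))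
    · exact (hN u ((le_abs_self N).trans h)).le.trans (le_add_of_nonneg_left (abs_nonneg N))
  refine ⟨|N| + (‖v‖ + 1), fun u => ?_⟩
  rcases le_total 0 u with h | h
  · exact key u h
  · have := key (-u) (by linarith)
    rwa [fresnel_neg, norm_neg] at this

/-- Completing the square. -/
lemma integral_fresnel_mul_exp {t : ℝ} (ht : 0 < t) (y a b : ℝ) :
    ∫ r in a..b, exp (-(I * t * r ^ 2)) * exp (I * r * y)
      = exp (I * y ^ 2 / (4 * t))
        * (fresnel t (b - y / (2 * t)) - fresnel t (a - y / (2 * t))) := by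
  have hcont : Continuous fun r : ℝ => exp (-(I * t * r ^ 2)) := by fun_prop
  have ht' : (t : ℂ) ≠ 0 := by exact_mod_cast ht.ne'
  rw [fresnel, fresnel, intervalIntegral.integral_interval_sub_left (hcont.intervalIntegrable _ _)
    (hcont.intervalIntegrable _ _), ← intervalIntegral.integral_comp_sub_right
      (fun r : ℝ => exp (-(I * t * r ^ 2))), ← intervalIntegral.integral_const_mul]
  refine intervalIntegral.integral_congr fun r _ => ?_
  simp only [← Complex.exp_add]
  congr 1
  push_cast
  field_simp
  ring

/-- Integrals of Fresnel type converge after superposition with an integrable density. -/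
lemma exists_tendsto_fresnel_superposition {t : ℝ} (ht : 0 < t) {G : ℝ → ℂ} (hG : Integrable G)
    (a : ℝ) : ∃ v, Tendsto (fun b : ℝ => ∫ m in a..b,
      exp (-(I * t * m ^ 2)) * ∫ y : ℝ, exp (I * m * y) * G y) atTop (𝓝 v) := by
  obtain ⟨v, hv⟩ := exists_tendsto_fresnel ht
  obtain ⟨C, hC⟩ := exists_norm_fresnel_le ht
  have hn : ∀ m y : ℝ, ‖exp (I * m * y)‖ = 1 := fun m y => by
    rw [show I * m * y = ((m * y : ℝ) : ℂ) * I by push_cast; ring, Complex.norm_exp_ofReal_mul_I]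
  -- After the change of the order of integration the inner integrals are uniformly bounded and
  -- converge pointwise.
  have hsw : ∀ b : ℝ, (∫ y : ℝ, exp (I * y ^ 2 / (4 * t))
      * (fresnel t (b - y / (2 * t)) - fresnel t (a - y / (2 * t))) * G y)
      = ∫ m in a..b, exp (-(I * t * m ^ 2)) * ∫ y : ℝ, exp (I * m * y) * G y := by
    intro b
    simp only [← integral_fresnel_mul_exp ht, ← integral_const_mul, ← mul_assoc]
    refine (intervalIntegral_kernel_swap (C := 1) hG
      (Continuous.continuousOn (by fun_prop)) (ae_of_all _ fun y m _ => ?_)).symm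
    rw [norm_mul, norm_exp_neg_I_mul_sq, hn, one_mul]
  have hE : ∀ y : ℝ, ‖exp (I * y ^ 2 / (4 * t))‖ = 1 := fun y => by
    rw [show I * y ^ 2 / (4 * t) = ((y ^ 2 / (4 * t) : ℝ) : ℂ) * I by push_cast; ring,
      Complex.norm_exp_ofReal_mul_I]
  have hfc : Continuous (fresnel t) := by
    refine intervalIntegral.continuous_primitive (fun _ _ => Continuous.intervalIntegrable ?_ _ _) 0
    fun_prop
  refine ⟨∫ y : ℝ, exp (I * y ^ 2 / (4 * t)) * (v - fresnel t (a - y / (2 * t))) * G y,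
    Tendsto.congr hsw ?_⟩
  refine tendsto_integral_filter_of_dominated_convergence (fun y => (C + C) * ‖G y‖) ?_ ?_
    (hG.norm.const_mul _) ?_
  · refine Eventually.of_forall fun b => AEStronglyMeasurable.mul ?_ hG.aestronglyMeasurable
    exact Continuous.aestronglyMeasurable (by fun_prop)
  · refine Eventually.of_forall fun b => ae_of_all _ fun y => ?_
    rw [norm_mul, norm_mul, hE, one_mul]
    gcongr
    exact (norm_sub_le _ _).trans (add_le_add (hC _) (hC _))
  · refine ae_of_all _ fun y => ((tendsto_const_nhds.mul (Tendsto.sub_const ?_ _)).mul_const _)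
    exact hv.comp (tendsto_atTop_add_const_right _ _ tendsto_id)

lemma exists_hasLineIntegral {t : ℝ} (ht : 0 < t) {G : ℝ → ℂ} (hG : Integrable G) :
    ∃ F, HasLineIntegral (fun k : ℝ => exp (-(I * t * k ^ 2)) * ∫ y : ℝ, exp (I * k * y) * G y)
      F := by
  obtain ⟨v, hv⟩ := exists_tendsto_fresnel_superposition ht hG 0
  obtain ⟨w, hw⟩ := exists_tendsto_fresnel_superposition ht hG.comp_neg 0
  refine ⟨w + v, ?_⟩
  unfold HasLineIntegral
  rw [← prod_atTop_atTop_eq]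
  refine ((hw.comp tendsto_fst).add (hv.comp tendsto_snd)).congr fun c => ?_
  have hcont : Continuous fun k : ℝ => exp (-(I * t * k ^ 2)) * ∫ y : ℝ, exp (I * k * y) * G y := by
    refine Continuous.mul (by fun_prop) (continuous_of_dominated (bound := fun y => ‖G y‖)
      (fun k => ?_) (fun k => ae_of_all _ fun y => ?_) hG.norm (ae_of_all _ fun y => by fun_prop))
    · exact (Continuous.aestronglyMeasurable (by fun_prop)).mul hG.aestronglyMeasurable
    · rw [norm_mul, show I * k * y = ((k * y : ℝ) : ℂ) * I by push_cast; ring,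
        Complex.norm_exp_ofReal_mul_I, one_mul]
  rw [← intervalIntegral.integral_add_adjacent_intervals (b := 0)
    (hcont.intervalIntegrable _ _) (hcont.intervalIntegrable _ _)]
  simp only [Function.comp]
  congr 1
  have := intervalIntegral.integral_comp_neg (a := 0) (b := c.1)
    (fun k : ℝ => exp (-(I * t * k ^ 2)) * ∫ y : ℝ, exp (I * k * y) * G y)
  rw [neg_zero] at this
  rw [← this]
  refine intervalIntegral.integral_congr fun k _ => ?_
  simp only [Complex.ofReal_neg, neg_sq]
  congr 1
  rw [← integral_neg_eq_self]
  refine integral_congr_ae (ae_of_all _ fun y => ?_)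
  simp

/-! ### Jordan's lemma and Cauchy's theorem in the sector -/

/-- Jordan's inequality, applied on both halves of the interval. -/
lemma integral_exp_neg_mul_sin_le {K : ℝ} (hK : 0 < K) :
    ∫ θ in (0 : ℝ)..(Real.pi / 2), Real.exp (-(K * Real.sin (2 * θ))) ≤ Real.pi / (2 * K) := by
  have hpi := Real.pi_pos
  set a : ℝ := 4 * K / Real.pi with ha
  have ha0 : 0 < a := by positivity
  -- On `[0, π/4]` the first summand bounds the integrand, on `[π/4, π/2]` the second one does.
  set q : ℝ → ℝ := fun θ => Real.exp (-(a * θ)) + Real.exp (-(a * (Real.pi / 2 - θ))) with hq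
  have hle : ∀ θ ∈ Set.Icc 0 (Real.pi / 2), Real.exp (-(K * Real.sin (2 * θ))) ≤ q θ := by
    intro θ hθ
    rcases le_total θ (Real.pi / 4) with h | h
    · refine le_add_of_le_of_nonneg (Real.exp_le_exp.2 ?_) (Real.exp_pos _).le
      have h1 := Real.mul_le_sin (x := 2 * θ) (by linarith [hθ.1]) (by linarith)
      have h2 : a * θ = K * (2 / Real.pi * (2 * θ)) := by rw [ha]; field_simp; ring
      rw [h2]
      exact neg_le_neg (mul_le_mul_of_nonneg_left h1 hK.le)
    · refine le_add_of_nonneg_of_le (Real.exp_pos _).le (Real.exp_le_exp.2 ?_)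
      have h1 := Real.mul_le_sin (x := Real.pi - 2 * θ) (by linarith [hθ.2]) (by linarith)
      rw [Real.sin_pi_sub] at h1
      have h2 : a * (Real.pi / 2 - θ) = K * (2 / Real.pi * (Real.pi - 2 * θ)) := by
        rw [ha]; field_simp; ring
      rw [h2]
      exact neg_le_neg (mul_le_mul_of_nonneg_left h1 hK.le)
  have hqc : Continuous q := by fun_prop
  have hder : ∀ θ : ℝ, HasDerivAt
      (fun θ => (Real.exp (-(a * (Real.pi / 2 - θ))) - Real.exp (-(a * θ))) / a) (q θ) θ := by
    intro θ
    have h1 : HasDerivAt (fun θ : ℝ => Real.exp (-(a * (Real.pi / 2 - θ))))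
        (Real.exp (-(a * (Real.pi / 2 - θ))) * a) θ := by
      have := (((hasDerivAt_id θ).const_sub (Real.pi / 2)).const_mul a).neg.exp
      simpa using this
    have h2 : HasDerivAt (fun θ : ℝ => Real.exp (-(a * θ))) (Real.exp (-(a * θ)) * -a) θ := by
      have := ((hasDerivAt_id θ).const_mul a).neg.exp
      simpa using this
    refine ((h1.sub h2).div_const a).congr_deriv ?_
    simp only [hq]
    field_simp
    ring
  calc ∫ θ in (0 : ℝ)..(Real.pi / 2), Real.exp (-(K * Real.sin (2 * θ)))
      ≤ ∫ θ in (0 : ℝ)..(Real.pi / 2), q θ :=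
        intervalIntegral.integral_mono_on (by positivity)
          (Continuous.intervalIntegrable (by fun_prop) _ _) (hqc.intervalIntegrable _ _) hle
    _ ≤ 2 / a := by
        rw [intervalIntegral.integral_eq_sub_of_hasDerivAt (fun θ _ => hder θ)
          (hqc.intervalIntegrable _ _), ← sub_div]
        gcongr
        simp only [sub_self, mul_zero, neg_zero, Real.exp_zero, sub_zero]
        linarith [Real.exp_pos (-(a * (Real.pi / 2)))]
    _ = Real.pi / (2 * K) := by rw [ha]; field_simp; ring

/-- Jordan's lemma, as a bound for integrals over a quarter circle. -/
lemma norm_arc_integral_le {K C : ℝ} (hK : 0 < K) {F : ℝ → ℂ}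
    (hF : ∀ θ ∈ Set.Icc 0 (Real.pi / 2), ‖F θ‖ ≤ C * Real.exp (-(K * Real.sin (2 * θ)))) :
    ‖∫ θ in (0 : ℝ)..(Real.pi / 2), F θ‖ ≤ C * (Real.pi / (2 * K)) := by
  have hpi := Real.pi_pos
  have hC : 0 ≤ C := by
    have := (norm_nonneg _).trans (hF 0 ⟨le_rfl, by positivity⟩)
    simpa using this
  refine (intervalIntegral.norm_integral_le_of_norm_le (by positivity)
    (ae_of_all _ fun θ hθ => hF θ (Set.Ioc_subset_Icc_self hθ))
    (Continuous.intervalIntegrable (by fun_prop) _ _)).trans ?_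
  rw [intervalIntegral.integral_const_mul]
  exact mul_le_mul_of_nonneg_left (integral_exp_neg_mul_sin_le hK) hC

lemma norm_exp_I_mul_sq_arc (t c θ : ℝ) :
    ‖exp (I * (c * exp (θ * I)) ^ 2 * t)‖ = Real.exp (-(c ^ 2 * t * Real.sin (2 * θ))) := by
  rw [Complex.norm_exp]
  congr 1
  have : I * (c * exp (θ * I)) ^ 2 * t = ((c ^ 2 * t : ℝ) : ℂ) * (I * exp ((2 * θ : ℝ) * I)) := by
    rw [mul_pow, ← Complex.exp_nat_mul]
    push_cast
    ring_nf
  rw [this, Complex.re_ofReal_mul, Complex.I_mul_re, Complex.exp_ofReal_mul_I_im]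
  ring

lemma mem_closedSector_exp {R x y : ℝ} (hR : 0 < R) (hx : Real.log R ≤ x)
    (hy : y ∈ Set.Icc (-(Real.pi / 2)) 0) : exp (x + y * I) ∈ closedSector R := by
  rw [Complex.exp_add, ← Complex.ofReal_exp]
  exact arc_mem_closedSector hR (by rwa [← Real.log_le_iff_le_exp hR]) hy

/-- Cauchy's theorem for the annular sector `R ≤ |z| ≤ c`, which is the image of a rectangle under
the exponential function. -/
lemma sectorIntegral_eq_arc {R c : ℝ} (hR : 0 < R) (hc : R ≤ c) {f : ℂ → ℂ}
    (hf : ContinuousOn f (closedSector R)) (hd : DifferentiableOn ℂ f (openSector R)) :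
    sectorIntegral R f c c
      = ∫ θ in (0 : ℝ)..(-(Real.pi / 2)), f (c * exp (θ * I)) * (I * (c * exp (θ * I))) := by
  have hpi := Real.pi_pos
  have hc0 : 0 < c := hR.trans_le hc
  have hlog : Real.log R ≤ Real.log c := Real.log_le_log hR hc
  have hexp : ∀ {r : ℝ}, 0 < r → exp (Real.log r : ℝ) = r := fun hr => by
    rw [← Complex.ofReal_exp, Real.exp_log hr]
  -- The map `w ↦ exp w` carries `[log R, log c] × [-π/2, 0]` onto the annular sector.
  have key := Complex.integral_boundary_rect_eq_zero_of_continuousOn_of_differentiableOn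
    (fun w => f (exp w) * exp w) (⟨Real.log R, -(Real.pi / 2)⟩ : ℂ) (⟨Real.log c, 0⟩ : ℂ) ?_ ?_
  rotate_left
  · refine (hf.comp Complex.continuous_exp.continuousOn fun w hw => ?_).mul
      Complex.continuous_exp.continuousOn
    rw [Complex.mem_reProdIm, Set.uIcc_of_le hlog, Set.uIcc_of_le (by simp; positivity)] at hw
    rw [← Complex.re_add_im w]
    exact mem_closedSector_exp hR hw.1.1 hw.2
  · refine (hd.comp Complex.differentiable_exp.differentiableOn fun w hw => ?_).mul
      Complex.differentiable_exp.differentiableOn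
    simp only [Complex.mem_reProdIm, min_eq_left hlog, max_eq_right hlog] at hw
    rw [min_eq_left (by linarith), max_eq_right (by linarith)] at hw
    refine ⟨?_, ?_, ?_⟩
    · rw [Complex.norm_exp]; exact (Real.log_lt_iff_lt_exp hR).1 hw.1.1
    · rw [Complex.exp_re]
      exact mul_pos (Real.exp_pos _) (Real.cos_pos_of_mem_Ioo ⟨hw.2.1, by linarith [hw.2.2]⟩)
    · rw [Complex.exp_im]
      exact mul_neg_of_pos_of_neg (Real.exp_pos _)
        (Real.sin_neg_of_neg_of_neg_pi_lt hw.2.2 (by linarith [hw.2.1]))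
  have hsub : ∀ g : ℝ → ℂ, ContinuousOn g (Set.Icc R c) →
      ∫ x in Real.log R..Real.log c, g (Real.exp x) * Real.exp x = ∫ r in R..c, g r := by
    intro g hg
    have := intervalIntegral.integral_deriv_smul_comp' (a := Real.log R) (b := Real.log c)
      (f := Real.exp) (f' := Real.exp) (g := g) (fun x _ => Real.hasDerivAt_exp x)
      Real.continuous_exp.continuousOn (hg.mono ?_)
    · rw [Real.exp_log hR, Real.exp_log hc0] at this
      rw [← this]
      refine intervalIntegral.integral_congr fun x _ => ?_
      simp only [Function.comp, Complex.real_smul, mul_comm]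
    · rintro _ ⟨x, hx, rfl⟩
      rw [Set.uIcc_of_le hlog] at hx
      exact ⟨(Real.log_le_iff_le_exp hR).1 hx.1, (Real.le_log_iff_exp_le hc0).1 hx.2⟩
  have hre := hsub (fun r => f r) (hf.comp (by fun_prop) fun r hr =>
    ofReal_mem_closedSector hR hr.1)
  have him := hsub (fun r => f (-(I * r)) * -I) ((continuousOn_imag hR hf).mono
    Set.Icc_subset_Ici_self)
  have harc : ∀ {r : ℝ}, 0 < r → ∫ y in (-(Real.pi / 2))..(0 : ℝ),
      f (exp (Real.log r + y * I)) * exp (Real.log r + y * I) * I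
      = ∫ θ in (-(Real.pi / 2))..(0 : ℝ), f (r * exp (θ * I)) * (I * (r * exp (θ * I))) := by
    intro r hr
    refine intervalIntegral.integral_congr fun θ _ => ?_
    simp only [Complex.exp_add, hexp hr]
    ring
  have e1 : ∫ x in Real.log R..Real.log c, f (exp (x + (-(Real.pi / 2) : ℝ) * I))
      * exp (x + (-(Real.pi / 2) : ℝ) * I) = ∫ r in R..c, f (-(I * r)) * -I := by
    rw [← him]
    refine intervalIntegral.integral_congr fun x _ => ?_
    simp only [Complex.exp_add, exp_neg_half_pi, Complex.ofReal_exp]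
    rw [show exp (x : ℂ) * -I = -(I * exp x) by ring]
    ring
  have e2 : ∫ x in Real.log R..Real.log c, f (exp (x + (0 : ℝ) * I)) * exp (x + (0 : ℝ) * I)
      = ∫ r in R..c, f r := by
    rw [← hre]
    refine intervalIntegral.integral_congr fun x _ => ?_
    simp
  have a1 := harc hR
  have a2 := harc hc0
  rw [intervalIntegral.integral_mul_const] at a1 a2
  simp only [smul_eq_mul] at key
  rw [e1, e2, mul_comm I, a2, mul_comm I, a1] at key
  rw [sectorIntegral_eq, intervalIntegral.integral_symm (-(Real.pi / 2)) 0,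
    intervalIntegral.integral_symm (-(Real.pi / 2)) 0]
  linear_combination key

/-- For negative times the exponential factor decays in the sector, which may therefore be closed
at infinity. -/
lemma hasSymmIntegral_zero {R t : ℝ} (hR : 0 < R) (ht : t < 0) {H : ℂ → ℂ}
    (hc : ContinuousOn H (closedSector R)) (hd : DifferentiableOn ℂ H (openSector R))
    (hb : H =O[farSector R] fun _ => (1 : ℂ)) :
    HasSymmIntegral R (fun z => H z * exp (I * z ^ 2 * t)) 0 := by
  have hpi := Real.pi_pos
  have hc' : ContinuousOn (fun z => H z * exp (I * z ^ 2 * t)) (closedSector R) :=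
    hc.mul (Continuous.continuousOn (by fun_prop))
  have hd' : DifferentiableOn ℂ (fun z => H z * exp (I * z ^ 2 * t)) (openSector R) :=
    hd.mul (Differentiable.differentiableOn (by fun_prop))
  refine ⟨hc', ?_⟩
  obtain ⟨C, hC⟩ := hb.bound
  rw [farSector, eventually_inf_principal, eventually_comap] at hC
  obtain ⟨N, hN⟩ := eventually_atTop.1 hC
  have hlim : Tendsto (fun c : ℝ => C * Real.pi / (2 * -t) * c⁻¹) atTop (𝓝 0) := by
    simpa using tendsto_inv_atTop_zero.const_mul (C * Real.pi / (2 * -t))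
  refine squeeze_zero_norm' ?_ hlim
  filter_upwards [eventually_ge_atTop R, eventually_ge_atTop N] with c hcR hcN
  have hc0 : 0 < c := hR.trans_le hcR
  rw [sectorIntegral_eq_arc hR hcR hc' hd']
  have hrev := intervalIntegral.integral_comp_neg (a := 0) (b := Real.pi / 2) (fun θ : ℝ =>
    H (c * exp (θ * I)) * exp (I * (c * exp (θ * I)) ^ 2 * t) * (I * (c * exp (θ * I))))
  rw [neg_zero] at hrev
  rw [intervalIntegral.integral_symm, norm_neg, ← hrev]
  refine (norm_arc_integral_le (K := c ^ 2 * -t) (C := C * c) (by nlinarith [sq_pos_of_pos hc0])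
    fun θ hθ => ?_).trans (le_of_eq ?_)
  · have hmem : (c * exp ((-θ : ℝ) * I) : ℂ) ∈ closedSector R :=
      arc_mem_closedSector hR hcR ⟨by linarith [hθ.2], by linarith [hθ.1]⟩
    have hn : ‖(c * exp ((-θ : ℝ) * I) : ℂ)‖ = c := by
      rw [norm_mul, Complex.norm_exp_ofReal_mul_I, mul_one, Complex.norm_real, Real.norm_eq_abs,
        abs_of_pos hc0]
    have h1 := hN c hcN _ hn hmem
    rw [norm_one, mul_one] at h1
    rw [norm_mul, norm_mul, norm_exp_I_mul_sq_arc, norm_mul, Complex.norm_I, one_mul, hn,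
      mul_neg 2 θ, Real.sin_neg,
      show -(c ^ 2 * t * -Real.sin (2 * θ)) = -(c ^ 2 * -t * Real.sin (2 * θ)) by ring,
      mul_right_comm C c]
    gcongr
  · have : t ≠ 0 := ht.ne
    field_simp

/-! ### Laplace transforms -/

/-- The Laplace transform `∫_0^∞ e^{-zy} g(y) dy`. -/
def lap (g : ℝ → ℂ) (z : ℂ) : ℂ := ∫ y in Set.Ioi (0 : ℝ), exp (-(z * y)) * g y

lemma norm_exp_neg_mul_le_one {z : ℂ} (hz : 0 ≤ z.re) {y : ℝ} (hy : 0 ≤ y) :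
    ‖exp (-(z * y))‖ ≤ 1 := by
  rw [Complex.norm_exp, Real.exp_le_one_iff, Complex.neg_re, Complex.re_mul_ofReal]
  exact neg_nonpos.2 (mul_nonneg hz hy)

section
variable {g : ℝ → ℂ} (hg : IntegrableOn g (Set.Ioi 0))
include hg

lemma integrableOn_lap {z : ℂ} (hz : 0 ≤ z.re) :
    IntegrableOn (fun y : ℝ => exp (-(z * y)) * g y) (Set.Ioi 0) := by
  refine Integrable.bdd_mul (c := 1) hg (Continuous.aestronglyMeasurable (by fun_prop)) ?_
  filter_upwards [ae_restrict_mem measurableSet_Ioi] with y hy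
  exact norm_exp_neg_mul_le_one hz (le_of_lt hy)

lemma norm_lap_le {z : ℂ} (hz : 0 ≤ z.re) : ‖lap g z‖ ≤ ∫ y in Set.Ioi (0 : ℝ), ‖g y‖ := by
  refine norm_integral_le_of_norm_le hg.norm ?_
  filter_upwards [ae_restrict_mem measurableSet_Ioi] with y hy
  rw [norm_mul]
  exact mul_le_of_le_one_left (norm_nonneg _) (norm_exp_neg_mul_le_one hz (le_of_lt hy))

lemma continuousOn_lap : ContinuousOn (lap g) {z | 0 ≤ z.re} := by
  refine continuousOn_of_dominated (bound := fun y => ‖g y‖) (fun z hz => ?_) (fun z hz => ?_)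
    hg.norm (ae_of_all _ fun y => Continuous.continuousOn (by fun_prop))
  · exact (integrableOn_lap hg hz).aestronglyMeasurable
  · filter_upwards [ae_restrict_mem measurableSet_Ioi] with y hy
    rw [norm_mul]
    exact mul_le_of_le_one_left (norm_nonneg _) (norm_exp_neg_mul_le_one hz (le_of_lt hy))

lemma differentiableAt_lap {z : ℂ} (hz : 0 < z.re) : DifferentiableAt ℂ (lap g) z := by
  set δ := z.re / 2 with hδ
  have hδ0 : 0 < δ := by positivity
  have hs : {w : ℂ | δ < w.re} ∈ 𝓝 z :=
    (isOpen_lt continuous_const Complex.continuous_re).mem_nhds (by simp [hδ, hz])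
  refine (hasDerivAt_integral_of_dominated_loc_of_deriv_le
    (F := fun (w : ℂ) (y : ℝ) => exp (-(w * y)) * g y)
    (F' := fun w y => exp (-(w * y)) * -y * g y) (bound := fun y => δ⁻¹ * ‖g y‖) hs ?_
    (integrableOn_lap hg hz.le) ?_ ?_ (hg.norm.const_mul _) ?_).2.differentiableAt
  · filter_upwards [hs] with w hw
    exact (integrableOn_lap hg (hδ0.trans hw).le).aestronglyMeasurable
  · exact AEStronglyMeasurable.mul (Continuous.aestronglyMeasurable (by fun_prop))
      hg.aestronglyMeasurable
  · filter_upwards [ae_restrict_mem measurableSet_Ioi] with y hy w hw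
    rw [norm_mul]
    refine mul_le_mul_of_nonneg_right ?_ (norm_nonneg _)
    have hy0 : 0 < y := hy
    rw [norm_mul, Complex.norm_exp, norm_neg, Complex.norm_real, Real.norm_eq_abs, abs_of_pos hy0,
      Complex.neg_re, Complex.re_mul_ofReal, Real.exp_neg, ← div_eq_inv_mul, div_le_iff₀
        (Real.exp_pos _), ← div_eq_inv_mul, le_div_iff₀ hδ0]
    have h1 := Real.add_one_le_exp (w.re * y)
    have h2 : δ * y ≤ w.re * y := mul_le_mul_of_nonneg_right (le_of_lt hw) hy0.le
    linarith
  · refine ae_of_all _ fun y w _ => ?_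
    have := (((hasDerivAt_id w).mul_const (y : ℂ)).neg.cexp).mul_const (g y)
    simpa using this

end

/-- The Laplace transform decays like `1 / z` in the closed right half plane. -/
def HasLapDecay (g : ℝ → ℂ) : Prop := ∃ C : ℝ, ∀ z : ℂ, 0 ≤ z.re → z ≠ 0 → ‖lap g z‖ ≤ C * ‖z‖⁻¹

lemma hasLapDecay_of_differentiable {g : ℝ → ℂ} (hd : Differentiable ℝ g)
    (hg : IntegrableOn g (Set.Ioi 0)) (hg' : IntegrableOn (deriv g) (Set.Ioi 0)) :
    HasLapDecay g := by
  refine ⟨‖g 0‖ + ∫ y in Set.Ioi (0 : ℝ), ‖deriv g y‖, fun z hz hz0 => ?_⟩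
  have hlim : Tendsto g atTop (𝓝 0) := tendsto_zero_of_hasDerivAt_of_integrableOn_Ioi (a := 0)
    (fun y _ => (hd y).hasDerivAt) hg' hg
  have h1 := integrableOn_lap hg hz
  have h2 := integrableOn_lap hg' hz
  have hder : ∀ y : ℝ, HasDerivAt (fun y : ℝ => exp (-(z * y)) * g y)
      (exp (-(z * y)) * deriv g y - z * (exp (-(z * y)) * g y)) y := by
    intro y
    have e1 : HasDerivAt (fun y : ℝ => exp (-(z * y))) (exp (-(z * y)) * -z) y := by
      have := (((hasDerivAt_id (y : ℂ)).const_mul z).neg.cexp).comp_ofReal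
      simpa using this
    exact (e1.mul (hd y).hasDerivAt).congr_deriv (by ring)
  have hlim' : Tendsto (fun y : ℝ => exp (-(z * y)) * g y) atTop (𝓝 0) := by
    rw [tendsto_zero_iff_norm_tendsto_zero] at hlim ⊢
    refine squeeze_zero' (Eventually.of_forall fun _ => norm_nonneg _) ?_ hlim
    filter_upwards [eventually_ge_atTop 0] with y hy
    rw [norm_mul]
    exact mul_le_of_le_one_left (norm_nonneg _) (norm_exp_neg_mul_le_one hz hy)
  have key := integral_Ioi_of_hasDerivAt_of_tendsto' (a := 0) (fun y _ => hder y)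
    (h2.sub (h1.const_mul z)) hlim'
  rw [integral_sub h2 (h1.const_mul z), integral_const_mul] at key
  have hz' : 0 < ‖z‖ := norm_pos_iff.2 hz0
  rw [← div_eq_mul_inv, le_div_iff₀ hz', mul_comm, ← norm_mul]
  have e : z * lap g z = g 0 + lap (deriv g) z := by
    simp only [Complex.ofReal_zero, mul_zero, neg_zero, Complex.exp_zero, one_mul] at key
    simp only [lap]
    linear_combination -key
  rw [e]
  exact (norm_add_le _ _).trans (by gcongr; exact norm_lap_le hg' hz)

lemma lap_indicator_Iic {X : ℝ} (hX : 0 ≤ X) (g : ℝ → ℂ) (z : ℂ) :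
    lap ((Set.Iic X).indicator g) z = ∫ y in (0 : ℝ)..X, exp (-(z * y)) * g y := by
  rw [lap, intervalIntegral.integral_of_le hX, ← Set.Ioi_inter_Iic,
    ← setIntegral_indicator measurableSet_Iic]
  refine integral_congr_ae (ae_of_all _ fun y => ?_)
  by_cases hy : y ∈ Set.Iic X <;> simp [hy]

lemma hasLapDecay_indicator {g : ℝ → ℂ} (hd : Differentiable ℝ g)
    (hg' : Integrable (deriv g)) {X : ℝ} (hX : 0 ≤ X) :
    HasLapDecay ((Set.Iic X).indicator g) := by
  refine ⟨‖g X‖ + ‖g 0‖ + ∫ y, ‖deriv g y‖, fun z hz hz0 => ?_⟩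
  rw [lap_indicator_Iic hX]
  have hder : ∀ y : ℝ, HasDerivAt (fun y : ℝ => exp (-(z * y)) * g y)
      (exp (-(z * y)) * deriv g y - z * (exp (-(z * y)) * g y)) y := by
    intro y
    have e1 : HasDerivAt (fun y : ℝ => exp (-(z * y))) (exp (-(z * y)) * -z) y := by
      have := (((hasDerivAt_id (y : ℂ)).const_mul z).neg.cexp).comp_ofReal
      simpa using this
    exact (e1.mul (hd y).hasDerivAt).congr_deriv (by ring)
  have h1 : IntervalIntegrable (fun y : ℝ => exp (-(z * y)) * g y) volume 0 X :=
    Continuous.intervalIntegrable (by have := hd.continuous; fun_prop) _ _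
  have h2 : IntervalIntegrable (fun y : ℝ => exp (-(z * y)) * deriv g y) volume 0 X :=
    hg'.intervalIntegrable.continuousOn_mul (Continuous.continuousOn (by fun_prop))
  have key := intervalIntegral.integral_eq_sub_of_hasDerivAt (fun y _ => hder y)
    (h2.sub (h1.const_mul z))
  rw [intervalIntegral.integral_sub h2 (h1.const_mul z), intervalIntegral.integral_const_mul] at key
  have hz' : 0 < ‖z‖ := norm_pos_iff.2 hz0
  rw [← div_eq_mul_inv, le_div_iff₀ hz', mul_comm, ← norm_mul]
  have e : z * ∫ y in (0 : ℝ)..X, exp (-(z * y)) * g y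
      = -(exp (-(z * X)) * g X) + g 0 + ∫ y in (0 : ℝ)..X, exp (-(z * y)) * deriv g y := by
    simp only [Complex.ofReal_zero, mul_zero, neg_zero, Complex.exp_zero, one_mul] at key
    linear_combination -key
  rw [e]
  refine (norm_add_le _ _).trans (add_le_add ((norm_add_le _ _).trans ?_) ?_)
  · gcongr
    rw [norm_neg, norm_mul]
    exact mul_le_of_le_one_left (norm_nonneg _) (norm_exp_neg_mul_le_one hz hX)
  · rw [intervalIntegral.integral_of_le hX]
    refine (norm_integral_le_of_norm_le hg'.norm.integrableOn ?_).trans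
      (setIntegral_le_integral hg'.norm (ae_of_all _ fun _ => norm_nonneg _))
    filter_upwards [ae_restrict_mem measurableSet_Ioc] with y hy
    rw [norm_mul]
    exact mul_le_of_le_one_left (norm_nonneg _) (norm_exp_neg_mul_le_one hz hy.1.le)

/-! ### Convergence of the contour integrals -/

/-- The common shape of all integrands: an amplitude times a Laplace transform in `ℓ = √(z² + a)`
times the oscillating factor. -/
def term (a : ℝ) (A : ℂ → ℂ) (δ : ℝ) (g : ℝ → ℂ) (t : ℝ) (z : ℂ) : ℂ :=
  A z * (exp (-(ell a z * δ)) * lap g (ell a z)) * exp (I * z ^ 2 * t)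

section
variable {R a δ t : ℝ} (hR : 0 < R) (ha : 2 * |a| < R ^ 2) {A : ℂ → ℂ} {m : ℂ} {g : ℝ → ℂ}
  (hg : IntegrableOn g (Set.Ioi 0))
include hR ha

lemma ell_isBigO_inv : (fun z => (ell a z)⁻¹) =O[farSector R] fun z => z⁻¹ := by
  have h := ((isAmplitude_root_inv hR ha).tendsto.isBigO_one ℂ).mul
    (Asymptotics.isBigO_refl (fun z : ℂ => z⁻¹) (farSector R))
  simp only [one_mul] at h
  exact h.congr_left fun z => by rw [ell, mul_inv, mul_comm]

lemma lap_isBigO_inv (hdec : HasLapDecay g) :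
    (fun z => lap g (ell a z)) =O[farSector R] fun z => z⁻¹ := by
  obtain ⟨C, hC⟩ := hdec
  refine Asymptotics.IsBigO.trans (Asymptotics.IsBigO.of_bound C ?_) (ell_isBigO_inv hR ha)
  filter_upwards [mem_farSector R] with z hz
  rw [norm_inv]
  exact hC _ (re_ell_nonneg hR ha hz) (ell_ne_zero hR ha hz)

lemma exp_ell_isBigO_one (hδ : 0 ≤ δ) :
    (fun z => exp (-(ell a z * δ))) =O[farSector R] fun _ => (1 : ℂ) := by
  refine Asymptotics.IsBigO.of_bound 1 ?_
  filter_upwards [mem_farSector R] with z hz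
  rw [norm_one, mul_one]
  exact norm_exp_neg_mul_le_one (re_ell_nonneg hR ha hz) hδ

include hg

lemma continuousOn_lap_ell : ContinuousOn (fun z => lap g (ell a z)) (closedSector R) :=
  (continuousOn_lap hg).comp (continuousOn_ell hR ha) fun _ hz => re_ell_nonneg hR ha hz

lemma differentiableOn_lap_ell :
    DifferentiableOn ℂ (fun z => lap g (ell a z)) (openSector R) := fun _ hz =>
  ((differentiableAt_lap hg (re_ell_pos hR ha hz)).comp _ (differentiableAt_ell hR ha
    (openSector_subset R hz))).differentiableWithinAt

lemma continuousOn_term (hA : IsAmplitude R A m) :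
    ContinuousOn (term a A δ g t) (closedSector R) :=
  (hA.cont.mul (((continuousOn_ell hR ha).mul continuousOn_const).neg.cexp.mul
    (continuousOn_lap_ell hR ha hg))).mul (Continuous.continuousOn (by fun_prop))

/-- At negative times the terms do not contribute. -/
lemma hasSymmIntegral_term_zero (hA : IsAmplitude R A m) (hδ : 0 ≤ δ) (ht : t < 0) :
    HasSymmIntegral R (term a A δ g t) 0 := by
  refine hasSymmIntegral_zero hR ht (hA.cont.mul (((continuousOn_ell hR ha).mul
    continuousOn_const).neg.cexp.mul (continuousOn_lap_ell hR ha hg)))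
    (hA.diff.mul (((differentiableOn_ell hR ha).mul_const _).neg.cexp.mul
    (differentiableOn_lap_ell hR ha hg))) ?_
  have h1 : (fun z => lap g (ell a z)) =O[farSector R] fun _ => (1 : ℂ) := by
    refine Asymptotics.IsBigO.of_bound (∫ y in Set.Ioi (0 : ℝ), ‖g y‖) ?_
    filter_upwards [mem_farSector R] with z hz
    rw [norm_one, mul_one]
    exact norm_lap_le hg (re_ell_nonneg hR ha hz)
  simpa using (hA.tendsto.isBigO_one ℂ).mul ((exp_ell_isBigO_one hR ha hδ).mul h1)

omit hR ha hg in
lemma exists_tendsto_of_isBigO {f : ℝ → ℂ} (hf : ContinuousOn f (Set.Ici R))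
    (hO : f =O[atTop] fun r => ((r : ℂ)⁻¹ * (r : ℂ)⁻¹)) :
    ∃ v, Tendsto (fun b : ℝ => ∫ r in R..b, f r) atTop (𝓝 v) := by
  have h1 : IntegrableOn f (Set.Ici R) := by
    refine (hf.locallyIntegrableOn measurableSet_Ici).integrableOn_of_isBigO_atTop
      (g := fun r : ℝ => r ^ (-2 : ℝ)) (hO.trans (Asymptotics.IsBigO.of_bound 1 ?_))
      (integrableAtFilter_rpow_atTop_iff.2 (by norm_num))
    filter_upwards [eventually_gt_atTop 0] with r hr
    rw [Real.rpow_neg hr.le, Real.rpow_ofNat, norm_mul, norm_inv, Complex.norm_real, norm_inv,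
      norm_pow, one_mul, ← mul_inv, sq]
  exact ⟨_, intervalIntegral_tendsto_integral_Ioi R (h1.mono_set Set.Ioi_subset_Ici_self)
    tendsto_id⟩

/-- On the real ray the integrand converges absolutely. -/
lemma exists_tendsto_term_real (hA : IsAmplitude R A m) (hdec : HasLapDecay g) (hδ : 0 < δ) :
    ∃ v, Tendsto (fun b : ℝ => ∫ r in R..b, term a A δ g t r) atTop (𝓝 v) := by
  refine exists_tendsto_of_isBigO ((continuousOn_term hR ha hg hA).comp (by fun_prop)
    fun r hr => ofReal_mem_closedSector hR hr) ?_
  have hreal := tendsto_ofReal_farSector hR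
  have h1 := (hA.tendsto.isBigO_one ℂ).comp_tendsto hreal
  have h2 := (lap_isBigO_inv hR ha hdec).comp_tendsto hreal
  have h3 : (fun r : ℝ => exp (-(ell a r * δ))) =O[atTop] fun r : ℝ => (r : ℂ)⁻¹ := by
    refine Asymptotics.IsBigO.trans (Asymptotics.IsBigO.of_bound δ⁻¹ ?_)
      ((ell_isBigO_inv hR ha).comp_tendsto hreal)
    filter_upwards [eventually_ge_atTop R] with r hr
    have hpos : 0 < √(r ^ 2 + a) := by
      have := ell_ne_zero hR ha (ofReal_mem_closedSector hR hr)
      rw [ell_ofReal hR ha hr, Complex.ofReal_ne_zero] at this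
      exact (Real.sqrt_nonneg _).lt_of_ne this.symm
    rw [Function.comp, ell_ofReal hR ha hr, Complex.norm_exp, norm_inv, Complex.norm_real,
      Real.norm_eq_abs, abs_of_pos hpos, ← Complex.ofReal_mul, ← Complex.ofReal_neg,
      Complex.ofReal_re, Real.exp_neg, ← mul_inv, mul_comm]
    refine inv_anti₀ (by positivity) ?_
    linarith [Real.add_one_le_exp (δ * √(r ^ 2 + a))]
  have h4 : (fun r : ℝ => exp (I * (r : ℂ) ^ 2 * t)) =O[atTop] fun _ => (1 : ℂ) := by
    refine Asymptotics.IsBigO.of_bound 1 (Eventually.of_forall fun r => ?_)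
    rw [show I * (r : ℂ) ^ 2 * t = ((r ^ 2 * t : ℝ) : ℂ) * I by push_cast; ring,
      Complex.norm_exp_ofReal_mul_I, norm_one, one_mul]
  have h5 := (h1.mul (h3.mul h2)).mul h4
  simpa [Function.comp_def, term] using h5

omit hR ha hg in
lemma norm_exp_I_mul_neg_I_mul_sq (t r : ℝ) : ‖exp (I * (-(I * r)) ^ 2 * t)‖ = 1 := by
  rw [show I * (-(I * r)) ^ 2 * t = ((-(r ^ 2 * t) : ℝ) : ℂ) * I by
    push_cast; linear_combination (r : ℂ) ^ 2 * t * I * Complex.I_sq, Complex.norm_exp_ofReal_mul_I]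

/-- On the imaginary ray the integrand converges absolutely if the amplitude vanishes at
infinity. -/
lemma exists_tendsto_term_imag_zero (hA : IsAmplitude R A 0) (hdec : HasLapDecay g) (hδ : 0 ≤ δ) :
    ∃ v, Tendsto (fun b : ℝ => ∫ r in R..b, term a A δ g t (-(I * r)) * -I) atTop (𝓝 v) := by
  refine exists_tendsto_of_isBigO (continuousOn_imag hR (continuousOn_term hR ha hg hA)) ?_
  have himag := tendsto_neg_I_mul_farSector hR
  have h0 := hA.isBigO
  simp only [sub_zero] at h0
  have h1 := h0.mul ((exp_ell_isBigO_one hR ha hδ).mul (lap_isBigO_inv hR ha hdec))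
  have h2 := h1.comp_tendsto himag
  have h4 : (fun r : ℝ => exp (I * (-(I * r)) ^ 2 * t) * -I) =O[atTop] fun _ => (1 : ℂ) := by
    refine Asymptotics.IsBigO.of_bound 1 (Eventually.of_forall fun r => ?_)
    rw [norm_mul, norm_exp_I_mul_neg_I_mul_sq, norm_neg, Complex.norm_I, norm_one]
  have h5 := h2.mul h4
  refine (h5.congr_left fun r => ?_).trans (Asymptotics.IsBigO.of_bound 1
    (Eventually.of_forall fun r => ?_))
  · simp only [Function.comp_def, term]; ring
  · simp

/-- The integral of the leading part over the imaginary ray becomes a superposition of Fresnel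
integrals if `√(r² - a)` is taken as the variable of integration. -/
lemma exists_tendsto_term_imag_main (ht : 0 < t) :
    ∃ v, Tendsto (fun b : ℝ => ∫ r in R..b, term a (fun z => (root a z)⁻¹) δ g t (-(I * r)) * -I)
      atTop (𝓝 v) := by
  set G : ℝ → ℂ := fun y => (Set.Ioi 0).indicator g (y - δ) with hG
  have hGi : Integrable G := (hg.integrable_indicator measurableSet_Ioi).comp_sub_right δ
  have hGint : ∀ s : ℝ,
      exp (-(-(I * s) * δ)) * lap g (-(I * s)) = ∫ y : ℝ, exp (I * s * y) * G y := by
    intro s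
    have e2 := integral_sub_right_eq_self (μ := volume)
      (fun y : ℝ => exp (I * s * (y + δ : ℝ)) * (Set.Ioi 0).indicator g y) δ
    simp only [sub_add_cancel] at e2
    rw [e2, lap, ← integral_const_mul, ← integral_indicator measurableSet_Ioi]
    refine integral_congr_ae (ae_of_all _ fun y => ?_)
    by_cases hy : y ∈ Set.Ioi (0 : ℝ)
    · simp only [hy, Set.indicator_of_mem, ← mul_assoc, ← Complex.exp_add]
      congr 2
      push_cast
      ring
    · simp [hy]
  -- `G` is `g` shifted by `δ`, which absorbs the factor `e^{-δℓ}`.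
  obtain ⟨v, hv⟩ := exists_tendsto_fresnel_superposition ht hGi √(R ^ 2 - a)
  have hRa : ∀ {r : ℝ}, R ≤ r → 0 < r ^ 2 - a := fun {r} hr => by
    have h1 := le_abs_self a
    have h2 : R ^ 2 ≤ r ^ 2 := pow_le_pow_left₀ hR.le hr 2
    linarith [abs_nonneg a]
  set Y : ℝ → ℂ := fun s => exp (-(I * t * s ^ 2)) * ∫ y : ℝ, exp (I * s * y) * G y with hY
  have hYc : Continuous Y := by
    refine Continuous.mul (by fun_prop) (continuous_of_dominated (bound := fun y => ‖G y‖)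
      (fun k => ?_) (fun k => ae_of_all _ fun y => ?_) hGi.norm (ae_of_all _ fun y => by fun_prop))
    · exact (Continuous.aestronglyMeasurable (by fun_prop)).mul hGi.aestronglyMeasurable
    · rw [norm_mul, show I * k * y = ((k * y : ℝ) : ℂ) * I by push_cast; ring,
        Complex.norm_exp_ofReal_mul_I, one_mul]
  have hlim : Tendsto (fun b : ℝ => √(b ^ 2 - a)) atTop atTop :=
    Real.tendsto_sqrt_atTop.comp (tendsto_atTop_add_const_right _ _ (tendsto_pow_atTop two_ne_zero))
  refine ⟨_, ((hv.comp hlim).const_mul (-I * exp (-(I * t * a)))).congr' ?_⟩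
  filter_upwards [eventually_ge_atTop R] with b hb
  have hder : ∀ r ∈ Set.uIcc R b, HasDerivAt (fun r : ℝ => √(r ^ 2 - a)) (r / √(r ^ 2 - a)) r := by
    intro r hr
    rw [Set.uIcc_of_le hb] at hr
    have := (((hasDerivAt_pow 2 r).sub_const a).sqrt (hRa hr.1).ne')
    refine this.congr_deriv ?_
    have := Real.sqrt_pos.2 (hRa hr.1)
    field_simp
    simp
  have hsub := intervalIntegral.integral_deriv_smul_comp' (g := Y) hder ?_ hYc.continuousOn
  · rw [Function.comp, ← hsub, ← intervalIntegral.integral_const_mul]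
    refine intervalIntegral.integral_congr fun r hr => ?_
    rw [Set.uIcc_of_le hb] at hr
    have hp := Real.sqrt_pos.2 (hRa hr.1)
    have hp' : ((√(r ^ 2 - a) : ℝ) : ℂ) ≠ 0 := by exact_mod_cast hp.ne'
    have hz := neg_I_mul_mem_closedSector hR hr.1
    have hroot : (root a (-(I * r)))⁻¹ = r / (√(r ^ 2 - a) : ℝ) := by
      have h1 := ell_neg_I_mul hR ha hr.1
      have h2 := root_ne_zero (lt_norm_sq hR ha hz)
      rw [ell] at h1
      have h3 : (r : ℂ) * root a (-(I * r)) = (√(r ^ 2 - a) : ℝ) := by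
        have := mul_left_cancel₀ Complex.I_ne_zero (a := I) (b := r * root a (-(I * r)))
          (c := (√(r ^ 2 - a) : ℝ)) (by linear_combination -h1)
        exact this
      rw [← h3]
      have hr0 : (r : ℂ) ≠ 0 := by exact_mod_cast (hR.trans_le hr.1).ne'
      field_simp
    simp only [term, Function.comp, hY, ell_neg_I_mul hR ha hr.1, hroot, ← hGint, Complex.real_smul]
    have hexp : exp (I * (-(I * r)) ^ 2 * t)
        = exp (-(I * t * a)) * exp (-(I * t * (√(r ^ 2 - a) : ℝ) ^ 2)) := by
      rw [← Complex.exp_add, ← Complex.ofReal_pow, Real.sq_sqrt (hRa hr.1).le]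
      congr 1
      push_cast
      linear_combination (r : ℂ) ^ 2 * t * I * Complex.I_sq
    rw [hexp]
    push_cast
    ring
  · refine ContinuousOn.div continuousOn_id (Continuous.continuousOn (by fun_prop)) fun r hr => ?_
    rw [Set.uIcc_of_le hb] at hr
    exact (Real.sqrt_pos.2 (hRa hr.1)).ne'

/-- At positive times the integral of each term converges. -/
theorem exists_hasIntegralD4_term (hA : IsAmplitude R A m) (hdec : HasLapDecay g) (hδ : 0 < δ)
    (ht : 0 < t) : ∃ J, HasIntegralD4 R (term a A δ g t) J := by
  obtain ⟨v, hv⟩ := exists_tendsto_term_real (t := t) hR ha hg hA hdec hδ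
  -- Only the value `m` at infinity prevents absolute convergence on the imaginary ray. Subtracting
  -- `m / √(1 + a / z²)` rather than `m` leaves a term for which `ℓ` is an exact new variable.
  have hB : IsAmplitude R (fun z => A z - m * (root a z)⁻¹) 0 := by
    simpa using hA.sub ((isAmplitude_root_inv hR ha).const_mul m)
  obtain ⟨w, hw⟩ := exists_tendsto_term_imag_zero (t := t) hR ha hg hB hdec hδ.le
  obtain ⟨w', hw'⟩ := exists_tendsto_term_imag_main (δ := δ) hR ha hg ht
  refine hasIntegralD4_of_rays hv ((hw.add (hw'.const_mul m)).congr' ?_)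
  filter_upwards [eventually_ge_atTop R] with b hb
  rw [← intervalIntegral.integral_const_mul, ← intervalIntegral.integral_add
    (intervalIntegrable_imag hR (continuousOn_term hR ha hg hB) hb)
    ((intervalIntegrable_imag hR (continuousOn_term hR ha hg (isAmplitude_root_inv hR ha))
      hb).const_mul m)]
  refine intervalIntegral.integral_congr fun r _ => ?_
  simp only [term]
  ring

end

/-! ### The free term -/

section Swap
variable {g : ℝ → ℂ} (hg : IntegrableOn g (Set.Ioi 0)) {w l : ℝ → ℂ} {a b : ℝ}
  (hw : ContinuousOn w (Set.uIcc a b)) (hl : ContinuousOn l (Set.uIcc a b))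
  (hre : ∀ m ∈ Set.uIcc a b, 0 ≤ (l m).re)
include hw hl

lemma continuousOn_lap_kernel : ContinuousOn
    (Function.uncurry fun (m y : ℝ) => w m * exp (-(l m * y))) (Set.uIcc a b ×ˢ Set.univ) := by
  have h1 : ContinuousOn (fun p : ℝ × ℝ => w p.1) (Set.uIcc a b ×ˢ Set.univ) :=
    hw.comp continuousOn_fst fun p hp => hp.1
  have h2 : ContinuousOn (fun p : ℝ × ℝ => l p.1) (Set.uIcc a b ×ˢ Set.univ) :=
    hl.comp continuousOn_fst fun p hp => hp.1
  exact h1.mul (h2.mul (Continuous.continuousOn (by fun_prop))).neg.cexp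

include hre

omit hl in
lemma exists_norm_lap_kernel_le : ∃ C, ∀ᵐ y : ℝ ∂(volume.restrict (Set.Ioi (0 : ℝ))),
    ∀ m ∈ Set.uIcc a b, ‖w m * exp (-(l m * y))‖ ≤ C := by
  obtain ⟨C, hC⟩ := isCompact_uIcc.exists_bound_of_continuousOn hw
  refine ⟨C, ?_⟩
  filter_upwards [ae_restrict_mem measurableSet_Ioi] with y hy m hm
  rw [norm_mul]
  exact (mul_le_of_le_one_right (norm_nonneg _)
    (norm_exp_neg_mul_le_one (hre m hm) (le_of_lt hy))).trans (hC m hm)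

include hg

lemma intervalIntegral_mul_lap : ∫ m in a..b, w m * lap g (l m)
    = ∫ y in Set.Ioi (0 : ℝ), (∫ m in a..b, w m * exp (-(l m * y))) * g y := by
  obtain ⟨C, hC⟩ := exists_norm_lap_kernel_le hw hre
  rw [← intervalIntegral_kernel_swap hg (continuousOn_lap_kernel hw hl) hC]
  simp only [lap, ← integral_const_mul, mul_assoc]

lemma integrableOn_intervalIntegral_lap : IntegrableOn
    (fun y : ℝ => (∫ m in a..b, w m * exp (-(l m * y))) * g y) (Set.Ioi 0) := by
  obtain ⟨C, hC⟩ := exists_norm_lap_kernel_le hw hre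
  exact integrable_intervalIntegral_kernel hg (continuousOn_lap_kernel hw hl) hC

end Swap

lemma sectorIntegral_mul_lap {R a b : ℝ} (hR : 0 < R) {g : ℝ → ℂ} (hg : IntegrableOn g (Set.Ioi 0))
    {w l : ℂ → ℂ} (hw : ContinuousOn w (closedSector R)) (hl : ContinuousOn l (closedSector R))
    (hre : ∀ z ∈ closedSector R, 0 ≤ (l z).re) (ha : R ≤ a) (hb : R ≤ b) :
    IntegrableOn (fun y : ℝ => sectorIntegral R (fun z => w z * exp (-(l z * y))) a b * g y)
      (Set.Ioi 0) ∧
    sectorIntegral R (fun z => w z * lap g (l z)) a b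
      = ∫ y in Set.Ioi (0 : ℝ), sectorIntegral R (fun z => w z * exp (-(l z * y))) a b * g y := by
  have hpi := Real.pi_pos
  have c1 : Set.MapsTo (fun r : ℝ => (r : ℂ)) (Set.uIcc R a) (closedSector R) := fun r hr => by
    rw [Set.uIcc_of_le ha] at hr; exact ofReal_mem_closedSector hR hr.1
  have c2 : Set.MapsTo (fun θ : ℝ => (R * exp (θ * I) : ℂ)) (Set.uIcc 0 (-(Real.pi / 2)))
      (closedSector R) := fun θ hθ => by
    rw [Set.uIcc_of_ge (by linarith)] at hθ; exact arc_mem_closedSector hR le_rfl hθ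
  have c3 : Set.MapsTo (fun r : ℝ => (-(I * r) : ℂ)) (Set.uIcc R b) (closedSector R) :=
    fun r hr => by rw [Set.uIcc_of_le hb] at hr; exact neg_I_mul_mem_closedSector hR hr.1
  have k1 : ContinuousOn (fun r : ℝ => (r : ℂ)) (Set.uIcc R a) := by fun_prop
  have k2 : ContinuousOn (fun θ : ℝ => (R * exp (θ * I) : ℂ)) (Set.uIcc 0 (-(Real.pi / 2))) := by
    fun_prop
  have k3 : ContinuousOn (fun r : ℝ => (-(I * r) : ℂ)) (Set.uIcc R b) := by fun_prop
  have w2 : ContinuousOn (fun θ : ℝ => w (R * exp (θ * I)) * (I * (R * exp (θ * I))))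
      (Set.uIcc 0 (-(Real.pi / 2))) := (hw.comp k2 c2).mul (by fun_prop)
  have w3 : ContinuousOn (fun r : ℝ => w (-(I * r)) * -I) (Set.uIcc R b) :=
    (hw.comp k3 c3).mul continuousOn_const
  have e1 := intervalIntegral_mul_lap hg (hw.comp k1 c1) (hl.comp k1 c1) fun m hm => hre _ (c1 hm)
  have e2 := intervalIntegral_mul_lap hg w2 (hl.comp k2 c2) fun m hm => hre _ (c2 hm)
  have e3 := intervalIntegral_mul_lap hg w3 (hl.comp k3 c3) fun m hm => hre _ (c3 hm)
  have i1 := integrableOn_intervalIntegral_lap hg (hw.comp k1 c1) (hl.comp k1 c1)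
    fun m hm => hre _ (c1 hm)
  have i2 := integrableOn_intervalIntegral_lap hg w2 (hl.comp k2 c2) fun m hm => hre _ (c2 hm)
  have i3 := integrableOn_intervalIntegral_lap hg w3 (hl.comp k3 c3) fun m hm => hre _ (c3 hm)
  simp only [sectorIntegral_eq, mul_right_comm _ (lap _ _), mul_right_comm _ (exp (-(_ * _)))]
  simp only [Function.comp_def] at e1 e2 e3 i1 i2 i3
  simp only [add_mul, neg_mul]
  refine ⟨(i1.neg.add i2).add i3, ?_⟩
  have i1' := i1.neg
  simp only [Pi.neg_def] at i1'
  rw [e1, e2, e3, ← integral_neg, ← integral_add i1' i2]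
  exact (integral_add (i1'.add i2) i3).symm

/-- Path independence. -/
lemma sectorIntegral_of_hasDerivAt {R a b : ℝ} (hR : 0 < R) {f Φ : ℂ → ℂ}
    (hf : ContinuousOn f (closedSector R)) (hd : ∀ z ∈ closedSector R, HasDerivAt Φ (f z) z)
    (ha : R ≤ a) (hb : R ≤ b) : sectorIntegral R f a b = Φ (-(I * b)) - Φ a := by
  have hpi := Real.pi_pos
  have e1 : ∫ r in R..a, f r = Φ a - Φ R :=
    intervalIntegral.integral_eq_sub_of_hasDerivAt (f := fun r : ℝ => Φ r) (fun r hr => by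
      rw [Set.uIcc_of_le ha] at hr
      exact (hd _ (ofReal_mem_closedSector hR hr.1)).comp_ofReal) (intervalIntegrable_real hR hf ha)
  have e2 : ∫ θ in (0 : ℝ)..(-(Real.pi / 2)), f (R * exp (θ * I)) * (I * (R * exp (θ * I)))
      = Φ (R * exp ((-(Real.pi / 2) : ℝ) * I)) - Φ (R * exp ((0 : ℝ) * I)) :=
    intervalIntegral.integral_eq_sub_of_hasDerivAt (f := fun θ : ℝ => Φ (R * exp (θ * I)))
      (fun θ hθ => by
        rw [Set.uIcc_of_ge (by linarith)] at hθ
        have h1 : HasDerivAt (fun θ : ℂ => R * exp (θ * I)) (I * (R * exp (θ * I))) (θ : ℂ) := by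
          have := (((hasDerivAt_id (θ : ℂ)).mul_const I).cexp).const_mul (R : ℂ)
          simp only [id, one_mul] at this
          exact this.congr_deriv (by ring)
        exact ((hd _ (arc_mem_closedSector hR le_rfl hθ)).comp (θ : ℂ) h1).comp_ofReal)
      (intervalIntegrable_arc hR hf le_rfl)
  have e3 : ∫ r in R..b, f (-(I * r)) * -I = Φ (-(I * b)) - Φ (-(I * R)) :=
    intervalIntegral.integral_eq_sub_of_hasDerivAt (f := fun r : ℝ => Φ (-(I * r))) (fun r hr => by
      rw [Set.uIcc_of_le hb] at hr
      have h1 : HasDerivAt (fun r : ℂ => -(I * r)) (-I) (r : ℂ) := by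
        simpa using ((hasDerivAt_id (r : ℂ)).const_mul I).fun_neg
      exact ((hd _ (neg_I_mul_mem_closedSector hR hr.1)).comp (r : ℂ) h1).comp_ofReal)
      (intervalIntegrable_imag hR hf hb)
  rw [sectorIntegral_eq, e1, e2, e3, exp_neg_half_pi, Complex.ofReal_zero, zero_mul,
    Complex.exp_zero, mul_one, mul_neg, mul_comm (R : ℂ) I]
  ring

/-- Two paths from `p > 0` and from `is` to a common end point give almost the same integral of
`e^{itz² - yz}` if `p` and `s` are large and close to each other. -/
lemma norm_primitive_sub_le {t y s p : ℝ} (ht : 0 < t) (hy : 0 ≤ y) (hs : 0 < s) (hp : 0 < p)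
    {E : ℂ → ℂ} (hE : ∀ z, HasDerivAt E (exp (I * z ^ 2 * t) * exp (-(z * y))) z) :
    ‖E (I * s) - E p‖ ≤ Real.pi / (2 * t) / s + |s - p| := by
  have hpi := Real.pi_pos
  have e1 : ∫ θ in (0 : ℝ)..(Real.pi / 2), exp (I * (s * exp (θ * I)) ^ 2 * t)
      * exp (-((s * exp (θ * I)) * y)) * (I * (s * exp (θ * I)))
      = E (s * exp ((Real.pi / 2 : ℝ) * I)) - E (s * exp ((0 : ℝ) * I)) := by
    refine intervalIntegral.integral_eq_sub_of_hasDerivAt (f := fun θ : ℝ => E (s * exp (θ * I)))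
      (fun θ hθ => ?_) (Continuous.intervalIntegrable (by fun_prop) _ _)
    have h1 : HasDerivAt (fun θ : ℂ => s * exp (θ * I)) (I * (s * exp (θ * I))) (θ : ℂ) := by
      have := (((hasDerivAt_id (θ : ℂ)).mul_const I).cexp).const_mul (s : ℂ)
      simp only [id, one_mul] at this
      exact this.congr_deriv (by ring)
    exact ((hE _).comp (θ : ℂ) h1).comp_ofReal
  have e2 : ∫ r in p..s, exp (I * (r : ℂ) ^ 2 * t) * exp (-((r : ℂ) * y)) = E s - E p :=
    intervalIntegral.integral_eq_sub_of_hasDerivAt (f := fun r : ℝ => E r)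
      (fun r _ => (hE _).comp_ofReal) (Continuous.intervalIntegrable (by fun_prop) _ _)
  -- The quarter circle from `s` to `is` is estimated by Jordan's lemma, the real segment trivially.
  have b1 : ‖E (I * s) - E s‖ ≤ Real.pi / (2 * t) / s := by
    have h1 : exp ((Real.pi / 2 : ℝ) * I) = I := by push_cast; exact Complex.exp_pi_div_two_mul_I
    rw [h1, Complex.ofReal_zero, zero_mul, Complex.exp_zero, mul_one, mul_comm] at e1
    rw [← e1]
    refine (norm_arc_integral_le (K := s ^ 2 * t) (C := s) (by positivity)
      fun θ hθ => ?_).trans (le_of_eq (by field_simp))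
    have h2 : ‖exp (-((s * exp (θ * I)) * y))‖ ≤ 1 := by
      refine norm_exp_neg_mul_le_one ?_ hy
      rw [Complex.re_ofReal_mul, Complex.exp_ofReal_mul_I_re]
      exact mul_nonneg hs.le (Real.cos_nonneg_of_neg_pi_div_two_le_of_le (by linarith [hθ.1]) hθ.2)
    rw [norm_mul, norm_mul, norm_exp_I_mul_sq_arc, norm_mul I, Complex.norm_I, one_mul, norm_mul,
      Complex.norm_exp_ofReal_mul_I, mul_one, Complex.norm_real, Real.norm_eq_abs, abs_of_pos hs,
      mul_comm s]
    exact mul_le_mul_of_nonneg_right (mul_le_of_le_one_right (Real.exp_pos _).le h2) hs.le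
  have b2 : ‖E s - E p‖ ≤ |s - p| := by
    rw [← e2]
    refine (intervalIntegral.norm_integral_le_of_norm_le_const (C := 1) fun r hr => ?_).trans
      (by rw [one_mul])
    have hr0 : 0 ≤ r := (lt_min hp hs).le.trans hr.1.le
    rw [norm_mul, show I * (r : ℂ) ^ 2 * t = ((r ^ 2 * t : ℝ) : ℂ) * I by push_cast; ring,
      Complex.norm_exp_ofReal_mul_I, one_mul]
    exact norm_exp_neg_mul_le_one (by simpa using hr0) hy
  calc ‖E (I * s) - E p‖ = ‖(E (I * s) - E s) + (E s - E p)‖ := by rw [sub_add_sub_cancel]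
    _ ≤ _ := (norm_add_le _ _).trans (add_le_add b1 b2)

/-- On a symmetric interval the Fourier transform may be folded to a Laplace transform, since the
factor `e^{-itk²}` is even. -/
lemma integral_line_eq {t s : ℝ} {G : ℝ → ℂ} (hG : Integrable G) :
    ∫ k in (-s)..s, exp (-(I * t * k ^ 2)) * ∫ y : ℝ, exp (I * k * y) * G y
      = ∫ k in (-s)..s, exp (-(I * t * k ^ 2)) * lap (fun y => G y + G (-y)) (-(I * k)) := by
  have hl : ∀ (k : ℝ) {h : ℝ → ℂ}, Integrable h → IntegrableOn
      (fun y : ℝ => exp (-(-(I * k) * y)) * h y) (Set.Ioi 0) :=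
    fun k h hh => integrableOn_lap hh.integrableOn (by simp)
  have hsplit : ∀ k : ℝ, ∫ y : ℝ, exp (I * k * y) * G y
      = lap G (-(I * k)) + lap (fun y => G (-y)) (-(I * (-k : ℝ))) := by
    intro k
    have hint : Integrable fun y : ℝ => exp (I * k * y) * G y := by
      refine Integrable.bdd_mul (c := 1) hG (Continuous.aestronglyMeasurable (by fun_prop))
        (ae_of_all _ fun y => ?_)
      rw [show I * k * y = ((k * y : ℝ) : ℂ) * I by push_cast; ring, Complex.norm_exp_ofReal_mul_I]
    rw [← integral_add_compl (measurableSet_Ioi (a := (0 : ℝ))) hint, Set.compl_Ioi]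
    congr 1
    · simp only [lap, neg_mul, neg_neg]
    · have h := integral_comp_neg_Ioi (0 : ℝ) (fun y : ℝ => exp (I * k * y) * G y)
      rw [neg_zero] at h
      rw [← h, lap]
      simp
  have hc : ∀ {h : ℝ → ℂ}, Integrable h → Continuous fun k : ℝ => lap h (-(I * k)) := fun {h} hh =>
    ((continuousOn_lap hh.integrableOn).comp_continuous (by fun_prop) fun k => by simp)
  have hadd : ∀ k : ℝ, lap (fun y => G y + G (-y)) (-(I * k))
      = lap G (-(I * k)) + lap (fun y => G (-y)) (-(I * k)) := by
    intro k
    simp only [lap, mul_add]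
    exact integral_add (hl k hG) (hl k hG.comp_neg)
  simp only [hsplit, hadd, mul_add]
  have i1 : ∀ {h : ℝ → ℂ}, Integrable h → IntervalIntegrable
      (fun k : ℝ => exp (-(I * t * k ^ 2)) * lap h (-(I * k))) volume (-s) s := fun {h} hh =>
    Continuous.intervalIntegrable (by have := hc hh; fun_prop) _ _
  have i2 : IntervalIntegrable (fun k : ℝ => exp (-(I * t * k ^ 2))
      * lap (fun y => G (-y)) (-(I * (-k : ℝ)))) volume (-s) s :=
    Continuous.intervalIntegrable (by
      have := (hc hG.comp_neg).comp continuous_neg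
      simp only [Function.comp_def] at this
      fun_prop) _ _
  rw [intervalIntegral.integral_add (i1 hG) i2, intervalIntegral.integral_add (i1 hG)
    (i1 hG.comp_neg)]
  congr 1
  have := intervalIntegral.integral_comp_neg (a := -s) (b := s) (fun k : ℝ =>
    exp (-(I * t * k ^ 2)) * lap (fun y => G (-y)) (-(I * k)))
  rw [neg_neg] at this
  rw [← this]
  simp only [Complex.ofReal_neg, neg_sq]

/-- Entire functions have primitives. -/
lemma exists_primitive_exp (t y : ℝ) : ∃ E : ℂ → ℂ,
    ∀ z, HasDerivAt E (exp (I * z ^ 2 * t) * exp (-(z * y))) z := by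
  obtain ⟨E, hE⟩ := Differentiable.isExactOn_univ
    (f := fun z : ℂ => exp (I * z ^ 2 * t) * exp (-(z * y))) (by fun_prop)
  exact ⟨E, fun z => hE z (Set.mem_univ z)⟩

lemma HasLineIntegral.tendsto_symm {f : ℝ → ℂ} {v : ℂ} (h : HasLineIntegral f v) :
    Tendsto (fun s : ℝ => ∫ k in (-s)..s, f k) atTop (𝓝 v) := by
  have h2 : Tendsto (fun c : ℝ => (c, c)) atTop (atTop : Filter (ℝ × ℝ)) := tendsto_atTop_diagonal
  have h' : Tendsto (fun c : ℝ × ℝ => ∫ k in (-c.1)..c.2, f k) atTop (𝓝 v) := h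
  exact Tendsto.comp h' h2

section Primitive
variable {t : ℝ} {E : ℝ → ℂ → ℂ}
  (hE : ∀ (y : ℝ) (z : ℂ), HasDerivAt (E y) (exp (I * z ^ 2 * t) * exp (-(z * y))) z)
  {g : ℝ → ℂ} (hgi : IntegrableOn g (Set.Ioi 0))
include hE hgi

/-- The integral over a segment of the line, by means of the primitives `E y` of `e^{itz² - yz}`. -/
lemma integral_line_lap_eq (s : ℝ) : ∫ k in (-s)..s, exp (-(I * t * k ^ 2)) * lap g (-(I * k))
    = ∫ y in Set.Ioi (0 : ℝ), I * (E y (-(I * s)) - E y (I * s)) * g y ∧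
    IntegrableOn (fun y => I * (E y (-(I * s)) - E y (I * s)) * g y) (Set.Ioi 0) := by
  have c1 : ContinuousOn (fun k : ℝ => exp (-(I * t * k ^ 2))) (Set.uIcc (-s) s) := by fun_prop
  have c2 : ContinuousOn (fun k : ℝ => -(I * k)) (Set.uIcc (-s) s) := by fun_prop
  have hi := integrableOn_intervalIntegral_lap hgi c1 c2 fun m _ => by simp
  rw [intervalIntegral_mul_lap hgi c1 c2 fun m _ => by simp]
  suffices he : ∀ y : ℝ, ∫ m in (-s)..s, exp (-(I * t * m ^ 2)) * exp (-(-(I * m) * y))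
      = I * (E y (-(I * s)) - E y (I * s)) by
    simp only [he] at hi ⊢
    exact ⟨trivial, hi⟩
  intro y
  have hder : ∀ k : ℝ, HasDerivAt (fun k : ℝ => I * E y (-(I * k)))
      (exp (-(I * t * k ^ 2)) * exp (-(-(I * k) * y))) k := by
    intro k
    have h1 : HasDerivAt (fun k : ℂ => -(I * k)) (-I) (k : ℂ) := by
      simpa using ((hasDerivAt_id (k : ℂ)).const_mul I).fun_neg
    refine ((((hE y _).comp (k : ℂ) h1).const_mul I).comp_ofReal).congr_deriv ?_
    have : I * (-(I * (k : ℂ))) ^ 2 * t = -(I * t * k ^ 2) := by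
      linear_combination (k : ℂ) ^ 2 * t * I * Complex.I_sq
    rw [this]
    linear_combination -(exp (-(I * t * k ^ 2)) * exp (-(-(I * k) * y))) * Complex.I_sq
  rw [intervalIntegral.integral_eq_sub_of_hasDerivAt (fun k _ => hder k)
    (Continuous.intervalIntegrable (by fun_prop) _ _)]
  push_cast
  ring_nf

/-- The integral over the truncated boundary of the sector, by means of the same primitives: the
substitution `w = ℓ(z)` turns the integrand into `e^{itw² - yw}`. -/
lemma sectorIntegral_term_free_eq {R a c : ℝ} (hR : 0 < R) (ha : 2 * |a| < R ^ 2) (hc : R ≤ c) :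
    sectorIntegral R (term a (fun z => (root a z)⁻¹) 0 g t) c c
      = exp (-(I * a * t)) * ∫ y in Set.Ioi (0 : ℝ),
        (E y (-(I * (√(c ^ 2 - a) : ℝ))) - E y (√(c ^ 2 + a) : ℝ)) * g y ∧
    IntegrableOn (fun y => (E y (-(I * (√(c ^ 2 - a) : ℝ))) - E y (√(c ^ 2 + a) : ℝ)) * g y)
      (Set.Ioi 0) := by
  have hw : ContinuousOn (fun z => (root a z)⁻¹ * exp (I * ell a z ^ 2 * t)) (closedSector R) :=
    (isAmplitude_root_inv hR ha).cont.mul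
      ((continuousOn_const.mul ((continuousOn_ell hR ha).pow 2)).mul continuousOn_const).cexp
  have h1 : Set.EqOn (term a (fun z => (root a z)⁻¹) 0 g t) (fun z => exp (-(I * a * t))
      * ((root a z)⁻¹ * exp (I * ell a z ^ 2 * t) * lap g (ell a z))) (closedSector R) := by
    intro z hz
    simp only [term, ell_sq (ne_zero_of_mem hR hz)]
    have : exp (I * z ^ 2 * t) = exp (-(I * a * t)) * exp (I * (z ^ 2 + a) * t) := by
      rw [← Complex.exp_add]; ring_nf
    rw [this]
    simp only [Complex.ofReal_zero, mul_zero, neg_zero, Complex.exp_zero, one_mul]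
    ring
  have hs := sectorIntegral_mul_lap hR hgi hw (continuousOn_ell hR ha)
      (fun z hz => re_ell_nonneg hR ha hz) hc hc
  rw [sectorIntegral_congr hR h1 hc hc, sectorIntegral_const_mul, hs.2]
  suffices he : ∀ y : ℝ, sectorIntegral R
      (fun z => (root a z)⁻¹ * exp (I * ell a z ^ 2 * t) * exp (-(ell a z * y))) c c
      = E y (-(I * (√(c ^ 2 - a) : ℝ))) - E y (√(c ^ 2 + a) : ℝ) by
    have hs1 := hs.1
    simp only [he] at hs1 ⊢
    exact ⟨trivial, hs1⟩
  intro y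
  rw [sectorIntegral_of_hasDerivAt hR (Φ := fun z => E y (ell a z))
    (f := fun z => (root a z)⁻¹ * exp (I * ell a z ^ 2 * t) * exp (-(ell a z * y)))
    (hw.mul ((continuousOn_ell hR ha).mul continuousOn_const).neg.cexp)
    (fun z hz => ((hE y _).comp z (hasDerivAt_ell hR ha hz)).congr_deriv (by ring)) hc hc,
    ell_ofReal hR ha hc, ell_neg_I_mul hR ha hc]

end Primitive

/-- The contribution of the free propagator, as an integral over the line and as an integral over
the boundary of the sector. -/
theorem exists_hasLineIntegral_free {R a t : ℝ} (hR : 0 < R) (ha : 2 * |a| < R ^ 2) (ht : 0 < t)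
    {G : ℝ → ℂ} (hG : Integrable G) :
    ∃ F, HasLineIntegral
        (fun k : ℝ => exp (-(I * t * k ^ 2)) * ∫ y : ℝ, exp (I * k * y) * G y) F ∧
      HasSymmIntegral R (term a (fun z => (root a z)⁻¹) 0 (fun y => G y + G (-y)) t)
        (-I * exp (-(I * a * t)) * F) := by
  obtain ⟨F, hF⟩ := exists_hasLineIntegral ht hG
  refine ⟨F, hF, ?_⟩
  set g : ℝ → ℂ := fun y => G y + G (-y) with hg
  have hgi : IntegrableOn g (Set.Ioi 0) := (hG.add hG.comp_neg).integrableOn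
  refine ⟨continuousOn_term hR ha hgi (isAmplitude_root_inv hR ha), ?_⟩
  choose E hE using exists_primitive_exp t
  have hRa : ∀ {b r : ℝ}, |b| ≤ |a| → R ≤ r → 0 < r ^ 2 - b := fun {b r} hb hr => by
    have h1 := le_abs_self b
    have h2 : R ^ 2 ≤ r ^ 2 := pow_le_pow_left₀ hR.le hr 2
    linarith [abs_nonneg a]
  have hslim : Tendsto (fun c : ℝ => √(c ^ 2 - a)) atTop atTop :=
    Real.tendsto_sqrt_atTop.comp (tendsto_atTop_add_const_right _ _ (tendsto_pow_atTop two_ne_zero))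
  have hF' : Tendsto (fun c : ℝ => -I * exp (-(I * a * t))
      * ∫ k in (-√(c ^ 2 - a))..√(c ^ 2 - a), exp (-(I * t * k ^ 2)) * lap g (-(I * k))) atTop
      (𝓝 (-I * exp (-(I * a * t)) * F)) := by
    have h1 := (HasLineIntegral.tendsto_symm hF).congr fun s => integral_line_eq hG
    exact (h1.comp hslim).const_mul _
  -- The segment `[-s, s]` with `s = √(c² - a)` corresponds to the path truncated at radius `c`,
  -- whose ends are sent by `ℓ` to `√(c² + a)` and to `-is`.
  refine tendsto_of_tendsto_of_dist hF' ?_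
  have hbound : Tendsto (fun c : ℝ => (Real.pi / (2 * t) + 2 * |a|) / √(c ^ 2 - a)
      * ∫ y in Set.Ioi (0 : ℝ), ‖g y‖) atTop (𝓝 0) := by
    simpa using (hslim.const_div_atTop (Real.pi / (2 * t) + 2 * |a|)).mul_const
      (∫ y in Set.Ioi (0 : ℝ), ‖g y‖)
  refine squeeze_zero' (Eventually.of_forall fun _ => dist_nonneg) ?_ hbound
  filter_upwards [eventually_ge_atTop R] with c hc
  have hs := Real.sqrt_pos.2 (hRa le_rfl hc)
  have hp : 0 < √(c ^ 2 + a) := by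
    have := hRa (b := -a) (abs_neg a).le hc
    rw [sub_neg_eq_add] at this
    exact Real.sqrt_pos.2 this
  have hsp : |√(c ^ 2 - a) - √(c ^ 2 + a)| ≤ 2 * |a| / √(c ^ 2 - a) := by
    rw [le_div_iff₀ hs]
    have h1 := Real.sq_sqrt (Real.sqrt_pos.1 hs).le
    have h2 := Real.sq_sqrt (Real.sqrt_pos.1 hp).le
    calc |√(c ^ 2 - a) - √(c ^ 2 + a)| * √(c ^ 2 - a)
        ≤ |√(c ^ 2 - a) - √(c ^ 2 + a)| * |√(c ^ 2 - a) + √(c ^ 2 + a)| := by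
          gcongr
          exact (le_add_of_nonneg_right hp.le).trans (le_abs_self _)
      _ = 2 * |a| := by
          rw [← abs_mul, show (√(c ^ 2 - a) - √(c ^ 2 + a)) * (√(c ^ 2 - a) + √(c ^ 2 + a))
            = -(2 * a) by linear_combination h1 - h2, abs_neg, abs_mul, abs_two]
  -- Both integrals are expressed by the primitives. At the end on the imaginary ray they agree, and
  -- the difference at the other ends is small uniformly in `y`.
  rw [dist_comm, dist_eq_norm, (sectorIntegral_term_free_eq hE hgi hR ha hc).1,
    (integral_line_lap_eq hE hgi _).1, ← integral_const_mul, ← integral_const_mul,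
    ← integral_sub ((sectorIntegral_term_free_eq hE hgi hR ha hc).2.const_mul _)
      ((integral_line_lap_eq hE hgi _).2.const_mul _), ← integral_const_mul]
  refine norm_integral_le_of_norm_le (hgi.norm.const_mul _) ?_
  filter_upwards [ae_restrict_mem measurableSet_Ioi] with y hy
  have e : exp (-(I * a * t)) * ((E y (-(I * (√(c ^ 2 - a) : ℝ))) - E y (√(c ^ 2 + a) : ℝ)) * g y)
      - -I * exp (-(I * a * t)) * (I * (E y (-(I * (√(c ^ 2 - a) : ℝ)))
        - E y (I * (√(c ^ 2 - a) : ℝ))) * g y)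
      = exp (-(I * a * t)) * ((E y (I * (√(c ^ 2 - a) : ℝ)) - E y (√(c ^ 2 + a) : ℝ)) * g y) := by
    linear_combination exp (-(I * a * t)) * (E y (-(I * (√(c ^ 2 - a) : ℝ)))
        - E y (I * (√(c ^ 2 - a) : ℝ))) * g y * Complex.I_sq
  have hexp : ‖exp (-(I * a * t))‖ = 1 := by
    rw [show -(I * a * t) = ((-(a * t) : ℝ) : ℂ) * I by push_cast; ring,
      Complex.norm_exp_ofReal_mul_I]
  rw [e, norm_mul, hexp, one_mul, norm_mul]
  refine mul_le_mul_of_nonneg_right ?_ (norm_nonneg _)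
  refine (norm_primitive_sub_le ht (le_of_lt hy) hs hp (hE y)).trans ?_
  rw [add_div]
  gcongr

/-! ### Pointwise Fourier inversion -/

/-- The Riemann–Lebesgue lemma. -/
lemma tendsto_integral_exp_I_mul (Q : ℝ → ℂ) (s : ℝ) (hs : s ≠ 0) :
    Tendsto (fun A : ℝ => ∫ u : ℝ, exp (I * (s * A) * u) * Q u) atTop (𝓝 0) := by
  have h := Real.tendsto_integral_exp_smul_cocompact Q
  have hlim : Tendsto (fun A : ℝ => -(s / (2 * Real.pi)) * A) atTop (cocompact ℝ) := by
    have hne : -(s / (2 * Real.pi)) ≠ 0 := neg_ne_zero.2 (div_ne_zero hs (by positivity))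
    have h1 : Tendsto (fun A : ℝ => A) atTop (cocompact ℝ) := atTop_le_cocompact
    exact (Homeomorph.mulLeft₀ _ hne).isClosedEmbedding.tendsto_cocompact.comp h1
  refine (h.comp hlim).congr fun A => ?_
  simp only [Function.comp]
  refine integral_congr_ae (ae_of_all _ fun u => ?_)
  simp only [Circle.smul_def, Real.fourierChar_apply, smul_eq_mul]
  congr 2
  push_cast
  have : (Real.pi : ℂ) ≠ 0 := by exact_mod_cast Real.pi_ne_zero
  field_simp

/-- The quotient is bounded near the origin because of the derivative there. -/
lemma integrable_div_self {H : ℝ → ℂ} (hH : Integrable H) (h0 : H 0 = 0)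
    (hd : DifferentiableAt ℝ H 0) : Integrable fun u : ℝ => H u / u := by
  have hO := hd.hasDerivAt.isBigO_sub
  simp only [h0, sub_zero] at hO
  obtain ⟨C, hC⟩ := hO.bound
  obtain ⟨δ, hδ, hball⟩ := Metric.eventually_nhds_iff.1 hC
  have hm : AEStronglyMeasurable (fun u : ℝ => H u / u) volume :=
    (hH.aestronglyMeasurable.aemeasurable.div
      Complex.continuous_ofReal.measurable.aemeasurable).aestronglyMeasurable
  have hb : Integrable fun u : ℝ => (Set.Ioo (-δ) δ).indicator (fun _ => C) u + δ⁻¹ * ‖H u‖ := by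
    refine Integrable.add ?_ (hH.norm.const_mul _)
    rw [integrable_indicator_iff measurableSet_Ioo]
    exact integrableOn_const (by simp)
  refine hb.mono' hm (ae_of_all _ fun u => ?_)
  rw [norm_div, Complex.norm_real, Real.norm_eq_abs]
  by_cases hu : u ∈ Set.Ioo (-δ) δ
  · rw [Set.indicator_of_mem hu]
    refine le_add_of_le_of_nonneg ?_ (by positivity)
    have h1 := hball (y := u) (by rw [Real.dist_eq, sub_zero]; exact abs_lt.2 hu)
    rw [Real.norm_eq_abs] at h1
    rcases eq_or_ne u 0 with rfl | hu0
    · have hC0 : 0 ≤ C := by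
        have h2 := hball (y := δ / 2) (by
          rw [Real.dist_eq, sub_zero, abs_of_pos (by positivity)]
          linarith)
        have h3 := (norm_nonneg _).trans h2
        rw [Real.norm_eq_abs, abs_of_pos (by positivity)] at h3
        exact nonneg_of_mul_nonneg_left h3 (by positivity)
      simpa using hC0
    · rwa [div_le_iff₀ (abs_pos.2 hu0)]
  · rw [Set.indicator_of_notMem hu, zero_add, div_eq_inv_mul]
    have h1 : δ ≤ |u| := by
      by_contra! h
      exact hu (abs_lt.1 h)
    gcongr

/-- The Dirichlet kernel. The factors `±1` match `tendsto_integral_exp_I_mul`. -/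
lemma integral_exp_I_mul (A u : ℝ) (hu : u ≠ 0) : ∫ ξ in (-A)..A, exp (I * ξ * u)
    = (exp (I * (1 * A) * u) - exp (I * ((-1) * A) * u)) / I / u := by
  have hu' : (u : ℂ) ≠ 0 := by exact_mod_cast hu
  have h := integral_exp_mul_complex (a := -A) (b := A) (c := I * u)
    (mul_ne_zero Complex.I_ne_zero hu')
  rw [div_div, show exp (I * (1 * A) * u) = exp (I * u * A) by ring_nf,
    show exp (I * (-1 * A) * u) = exp (I * u * (-A : ℝ)) by push_cast; ring_nf, ← h]
  refine intervalIntegral.integral_congr fun ξ _ => ?_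
  ring_nf

/-- Fourier inversion at a zero: `H(u) / u` is integrable, so that the lemma of Riemann and Lebesgue
applies. -/
lemma tendsto_dirichlet_of_vanishing {H : ℝ → ℂ} (hH : Integrable H) (h0 : H 0 = 0)
    (hd : DifferentiableAt ℝ H 0) :
    Tendsto (fun A : ℝ => ∫ ξ in (-A)..A, ∫ u : ℝ, exp (I * ξ * u) * H u) atTop (𝓝 0) := by
  have hQ := integrable_div_self hH h0 hd
  have hn : ∀ m y : ℝ, ‖exp (I * m * y)‖ = 1 := fun m y => by
    rw [show I * m * y = ((m * y : ℝ) : ℂ) * I by push_cast; ring, Complex.norm_exp_ofReal_mul_I]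
  have h1 := tendsto_integral_exp_I_mul (fun u => H u / u) 1 one_ne_zero
  have h2 := tendsto_integral_exp_I_mul (fun u => H u / u) (-1) (by norm_num)
  have h3 := (h1.sub h2).const_mul I⁻¹
  rw [sub_zero, mul_zero] at h3
  refine h3.congr fun A => ?_
  have hi : ∀ s : ℝ, Integrable fun u : ℝ => exp (I * (s * A) * u) * (H u / u) := fun s => by
    refine Integrable.bdd_mul (c := 1) hQ (Continuous.aestronglyMeasurable (by fun_prop))
      (ae_of_all _ fun u => ?_)
    rw [← Complex.ofReal_mul]
    exact (hn _ _).le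
  rw [intervalIntegral_kernel_swap (C := 1) hH (Continuous.continuousOn (by fun_prop))
    (ae_of_all _ fun y m _ => (hn m y).le), ← integral_sub (hi 1) (hi (-1)), ← integral_const_mul]
  refine integral_congr_ae ?_
  filter_upwards [Measure.ae_ne volume (0 : ℝ)] with u hu
  rw [integral_exp_I_mul A u hu]
  push_cast
  ring

/-- Fourier inversion at the origin for a Gaussian, by explicit computation. -/
lemma tendsto_dirichlet_gaussian : Tendsto (fun A : ℝ => ∫ ξ in (-A)..A, ∫ u : ℝ,
    exp (I * ξ * u) * exp (-1 * u ^ 2)) atTop (𝓝 (2 * Real.pi)) := by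
  have hpi := Real.pi_pos
  have e1 : ∀ ξ : ℝ, ∫ u : ℝ, exp (I * ξ * u) * exp (-1 * (u : ℂ) ^ 2)
      = ((√Real.pi * Real.exp (-(1 / 4) * ξ ^ 2) : ℝ) : ℂ) := by
    intro ξ
    rw [fourierIntegral_gaussian (by simp), Real.sqrt_eq_rpow, div_one]
    push_cast [Complex.ofReal_cpow hpi.le]
    ring_nf
  have hint : Integrable fun ξ : ℝ => √Real.pi * Real.exp (-(1 / 4) * ξ ^ 2) :=
    (integrable_exp_neg_mul_sq (by norm_num)).const_mul _
  have e2 : ∫ ξ : ℝ, √Real.pi * Real.exp (-(1 / 4) * ξ ^ 2) = 2 * Real.pi := by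
    rw [integral_const_mul, integral_gaussian, ← Real.sqrt_mul hpi.le,
      show Real.pi * (Real.pi / (1 / 4)) = (2 * Real.pi) ^ 2 by ring, Real.sqrt_sq (by positivity)]
  simp only [e1]
  have hint' : Integrable fun ξ : ℝ => ((√Real.pi * Real.exp (-(1 / 4) * ξ ^ 2) : ℝ) : ℂ) :=
    hint.ofReal
  have h := intervalIntegral_tendsto_integral hint' tendsto_neg_atTop_atBot tendsto_id
  rw [integral_complex_ofReal, e2] at h
  simpa only [Complex.ofReal_mul, Complex.ofReal_ofNat, id] using h

/-- Fourier inversion at a point of differentiability, by subtraction of a Gaussian with the same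
value at this point. -/
theorem tendsto_dirichlet {G : ℝ → ℂ} (hG : Integrable G) (hd : DifferentiableAt ℝ G 0) :
    Tendsto (fun A : ℝ => ∫ ξ in (-A)..A, ∫ u : ℝ, exp (I * ξ * u) * G u) atTop
      (𝓝 (2 * Real.pi * G 0)) := by
  have hn : ∀ m y : ℝ, ‖exp (I * m * y)‖ = 1 := fun m y => by
    rw [show I * m * y = ((m * y : ℝ) : ℂ) * I by push_cast; ring, Complex.norm_exp_ofReal_mul_I]
  have hi : ∀ {K : ℝ → ℂ}, Integrable K → ∀ ξ : ℝ, Integrable fun u : ℝ => exp (I * ξ * u) * K u :=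
    fun {K} hK ξ => Integrable.bdd_mul (c := 1) hK (Continuous.aestronglyMeasurable (by fun_prop))
      (ae_of_all _ fun u => (hn _ _).le)
  have hc : ∀ {K : ℝ → ℂ}, Integrable K → Continuous fun ξ : ℝ => ∫ u : ℝ, exp (I * ξ * u) * K u :=
    fun {K} hK => continuous_of_dominated (bound := fun y => ‖K y‖)
      (fun k => (hi hK k).aestronglyMeasurable)
      (fun k => ae_of_all _ fun y => by rw [norm_mul, hn, one_mul]) hK.norm
      (ae_of_all _ fun y => by fun_prop)
  have hg : Integrable fun u : ℝ => exp (-1 * (u : ℂ) ^ 2) := by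
    have := (integrable_exp_neg_mul_sq (b := 1) one_pos).ofReal (𝕜 := ℂ)
    refine this.congr (ae_of_all _ fun u => ?_)
    simp
  have hgd : DifferentiableAt ℝ (fun u : ℝ => exp (-1 * (u : ℂ) ^ 2)) 0 := by fun_prop
  have hH : Integrable fun u : ℝ => G u - exp (-1 * (u : ℂ) ^ 2) * G 0 := hG.sub (hg.mul_const _)
  have h1 := tendsto_dirichlet_of_vanishing hH (by simp) (hd.sub (hgd.mul_const _))
  have h2 := h1.add (tendsto_dirichlet_gaussian.mul_const (G 0))
  rw [zero_add] at h2
  refine h2.congr fun A => ?_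
  rw [← intervalIntegral.integral_mul_const, ← intervalIntegral.integral_add
    ((hc hH).intervalIntegrable _ _) (((hc hg).mul_const _).intervalIntegrable _ _)]
  refine intervalIntegral.integral_congr fun ξ _ => ?_
  rw [← integral_mul_const, ← integral_add (hi hH ξ) ((hi hg ξ).mul_const _)]
  refine integral_congr_ae (ae_of_all _ fun u => ?_)
  beta_reduce
  ring

/-- The truncated Laplace transform with respect to time is an entire function. -/
lemma differentiable_truncated_laplace {T : ℝ} (hT : 0 ≤ T) (t : ℝ) {f : ℝ → ℂ}
    (hf : ContinuousOn f (Set.Icc 0 T)) :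
    Differentiable ℂ fun ζ : ℂ => ∫ τ in (0 : ℝ)..T, exp (I * ζ * (t - τ)) * f τ := by
  intro ζ₀
  have hf' : ContinuousOn f (Set.uIcc 0 T) := by rwa [Set.uIcc_of_le hT]
  have hint : ∀ ζ : ℂ, IntervalIntegrable (fun τ : ℝ => exp (I * ζ * (t - τ)) * f τ) volume 0 T :=
    fun ζ => ContinuousOn.intervalIntegrable
      (ContinuousOn.mul (Continuous.continuousOn (by fun_prop)) hf')
  refine (intervalIntegral.hasDerivAt_integral_of_dominated_loc_of_deriv_le
    (F' := fun ζ τ => exp (I * ζ * (t - τ)) * (I * (t - τ)) * f τ)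
    (bound := fun τ => Real.exp ((‖ζ₀‖ + 1) * |t - τ|) * |t - τ| * ‖f τ‖)
    (Metric.ball_mem_nhds ζ₀ one_pos) ?_ (hint ζ₀) ?_ ?_ ?_ ?_).2.differentiableAt
  · exact Eventually.of_forall fun ζ => (hint ζ).def'.aestronglyMeasurable
  · have hc : ContinuousOn (fun τ : ℝ => exp (I * ζ₀ * (t - τ)) * (I * (t - τ)) * f τ)
        (Set.uIcc 0 T) := ContinuousOn.mul (Continuous.continuousOn (by fun_prop)) hf'
    exact hc.intervalIntegrable.def'.aestronglyMeasurable
  · refine ae_of_all _ fun τ _ ζ hζ => ?_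
    have h1 : ‖(t - τ : ℂ)‖ = |t - τ| := by
      rw [← Complex.ofReal_sub, Complex.norm_real, Real.norm_eq_abs]
    rw [norm_mul, norm_mul, norm_mul I, Complex.norm_I, one_mul, h1]
    gcongr
    refine (Complex.norm_exp_le_exp_norm _).trans (Real.exp_le_exp.2 ?_)
    rw [norm_mul, norm_mul, Complex.norm_I, one_mul, h1]
    gcongr
    have h2 := norm_sub_norm_le ζ ζ₀
    have h3 : ‖ζ - ζ₀‖ < 1 := by simpa [dist_eq_norm] using hζ
    linarith
  · exact ContinuousOn.intervalIntegrable
      (ContinuousOn.mul (Continuous.continuousOn (by fun_prop)) hf'.norm)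
  · refine ae_of_all _ fun τ _ ζ _ => ?_
    have := ((((hasDerivAt_id ζ).const_mul I).mul_const ((t : ℂ) - τ)).cexp).mul_const (f τ)
    simpa using this

/-- Inversion of the truncated Laplace transform along the boundary of the sector. The map `z ↦ z²`
sends this path to a deformation of the real line, traversed from `+∞` to `-∞`; the transform is an
entire function of `z²`, so that the deformation is harmless. -/
theorem hasSymmIntegral_laplace_inversion {R T t : ℝ} (hR : 0 < R) (ht : t ∈ Set.Ioo 0 T)
    {f : ℝ → ℂ} (hf : ContinuousOn f (Set.Icc 0 T)) (hd : DifferentiableAt ℝ f t) :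
    HasSymmIntegral R (fun z => z * ∫ τ in (0 : ℝ)..T, exp (I * z ^ 2 * (t - τ)) * f τ)
      (-(Real.pi * f t)) := by
  have hT : 0 ≤ T := (ht.1.trans ht.2).le
  set V : ℂ → ℂ := fun ζ => ∫ τ in (0 : ℝ)..T, exp (I * ζ * (t - τ)) * f τ with hV
  have hVd : Differentiable ℂ V := differentiable_truncated_laplace hT t hf
  obtain ⟨Φ, hΦ⟩ := hVd.isExactOn_univ
  replace hΦ : ∀ z, HasDerivAt Φ (V z) z := fun z => hΦ z (Set.mem_univ z)
  have hc : ContinuousOn (fun z => z * V (z ^ 2)) (closedSector R) :=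
    Continuous.continuousOn (by have := hVd.continuous; fun_prop)
  refine ⟨hc, ?_⟩
  -- On the real line `V` is the Fourier transform of `G`.
  set G : ℝ → ℂ := fun u => (Set.Ioc 0 T).indicator f (t - u) with hG
  have hGi : Integrable G :=
    ((hf.integrableOn_Icc.mono_set Set.Ioc_subset_Icc_self).integrable_indicator
      measurableSet_Ioc).comp_sub_left t
  have hGd : DifferentiableAt ℝ G 0 := by
    have h1 : (fun u => f (t - u)) =ᶠ[𝓝 0] G := by
      have : ∀ᶠ u : ℝ in 𝓝 0, t - u ∈ Set.Ioo 0 T :=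
        (Continuous.tendsto' (by fun_prop) 0 t (by simp)).eventually (isOpen_Ioo.mem_nhds ht)
      filter_upwards [this] with u hu
      rw [hG]
      exact (Set.indicator_of_mem (Set.Ioo_subset_Ioc_self hu) f).symm
    refine DifferentiableAt.congr_of_eventuallyEq ?_ h1.symm
    have hd' : DifferentiableAt ℝ f (t - 0) := by rwa [sub_zero]
    exact DifferentiableAt.comp (0 : ℝ) hd' (by fun_prop)
  have hVG : ∀ ξ : ℝ, V ξ = ∫ u : ℝ, exp (I * ξ * u) * G u := by
    intro ξ
    have h1 := integral_sub_left_eq_self (fun τ : ℝ => exp (I * ξ * (t - τ : ℝ))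
      * (Set.Ioc 0 T).indicator f τ) volume t
    simp only [sub_sub_cancel] at h1
    rw [hG]
    simp only [h1, hV]
    rw [intervalIntegral.integral_of_le hT, ← integral_indicator measurableSet_Ioc]
    refine integral_congr_ae (ae_of_all _ fun τ => ?_)
    by_cases hτ : τ ∈ Set.Ioc 0 T <;> simp [hτ]
  have hlim := (tendsto_dirichlet hGi hGd).comp (tendsto_pow_atTop (α := ℝ) two_ne_zero)
  have hG0 : G 0 = f t := by
    rw [hG]; simp [Set.indicator_of_mem (Set.Ioo_subset_Ioc_self ht)]
  rw [hG0] at hlim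
  have h3 := hlim.const_mul (-(1 / 2 : ℂ))
  rw [show -(1 / 2 : ℂ) * (2 * Real.pi * f t) = -(Real.pi * f t) by ring] at h3
  refine h3.congr' ?_
  filter_upwards [eventually_ge_atTop R] with c hcR
  rw [sectorIntegral_of_hasDerivAt hR (Φ := fun z => Φ (z ^ 2) / 2) hc (fun z _ => ?_) hcR hcR]
  · have h4 : ∫ ξ in (-c ^ 2)..c ^ 2, V ξ = Φ ((c ^ 2 : ℝ) : ℂ) - Φ ((-c ^ 2 : ℝ) : ℂ) :=
      intervalIntegral.integral_eq_sub_of_hasDerivAt (f := fun ξ : ℝ => Φ ξ)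
        (fun ξ _ => (hΦ ξ).comp_ofReal)
        (Continuous.intervalIntegrable (by have := hVd.continuous; fun_prop) _ _)
    simp only [Function.comp, ← hVG, h4]
    have e1 : (-(I * (c : ℂ))) ^ 2 = ((-c ^ 2 : ℝ) : ℂ) := by
      push_cast; linear_combination (c : ℂ) ^ 2 * Complex.I_sq
    rw [e1]
    push_cast
    ring
  · have h5 := ((hΦ (z ^ 2)).comp z (hasDerivAt_pow 2 z)).div_const 2
    refine h5.congr_deriv ?_
    simp only [Nat.cast_ofNat, Nat.add_one_sub_one, pow_one]
    ring

/-! ### Global relations -/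

/-- The truncated Laplace transform `∫_0^T e^{-iζτ} u(x,τ) dτ` with respect to time. -/
def timeTransform (T : ℝ) (ζ : ℂ) (u : ℝ → ℝ → ℂ) (x : ℝ) : ℂ :=
  ∫ τ in (0 : ℝ)..T, exp (-(I * ζ * τ)) * u x τ

/-- The data that enter the global relations: values at time `0`, minus the values at the final
time with the factor `e^{-iζT}`. -/
def endData (T : ℝ) (ζ : ℂ) (ψ : ℝ → ℝ → ℂ) (x : ℝ) : ℂ := ψ x 0 - exp (-(I * ζ * T)) * ψ x T

section Transform
variable {u : ℝ → ℝ → ℂ} (hu : ContinuousOn (fun p : ℝ × ℝ => u p.1 p.2) {p | 0 ≤ p.2})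
  {T : ℝ} (hT : 0 < T)
include hu

lemma continuous_extension : Continuous fun p : ℝ × ℝ => u p.1 (max p.2 0) :=
  hu.comp_continuous (f := fun p : ℝ × ℝ => (p.1, max p.2 0)) (by fun_prop)
    fun p => show (0 : ℝ) ≤ max p.2 0 from le_max_right _ _

lemma continuousOn_section (x : ℝ) : ContinuousOn (u x) (Set.Icc 0 T) :=
  hu.comp (f := fun τ : ℝ => (x, τ)) (by fun_prop) fun τ hτ => hτ.1

lemma continuous_timeTransform (hT : 0 < T) (ζ : ℂ) : Continuous (timeTransform T ζ u) := by
  have h := intervalIntegral.continuous_parametric_intervalIntegral_of_continuous'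
    (μ := volume) (f := fun (x τ : ℝ) => exp (-(I * ζ * τ)) * u x (max τ 0))
    (((by fun_prop : Continuous fun p : ℝ × ℝ => exp (-(I * ζ * p.2)))).mul
      (continuous_extension hu)) 0 T
  refine h.congr fun x => intervalIntegral.integral_congr fun τ hτ => ?_
  rw [Set.uIcc_of_le hT.le] at hτ
  simp only [max_eq_left hτ.1]

omit hu in
lemma integrable_timeTransform (hT : 0 < T)
    (hi : IntegrableOn (fun p : ℝ × ℝ => u p.1 p.2) (Set.univ ×ˢ Set.Ioc 0 T)) (ζ : ℂ) :
    Integrable (timeTransform T ζ u) := by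
  have hi' : Integrable (fun p : ℝ × ℝ => u p.1 p.2)
      (volume.prod (volume.restrict (Set.Ioc 0 T))) := by
    rw [IntegrableOn, Measure.volume_eq_prod, ← Measure.prod_restrict, Measure.restrict_univ] at hi
    exact hi
  obtain ⟨C, hC⟩ := (isCompact_Icc (a := (0 : ℝ)) (b := T)).exists_bound_of_continuousOn
    (f := fun τ : ℝ => exp (-(I * ζ * τ))) (by fun_prop)
  have h : Integrable (fun p : ℝ × ℝ => exp (-(I * ζ * p.2)) * u p.1 p.2)
      (volume.prod (volume.restrict (Set.Ioc 0 T))) := by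
    refine Integrable.bdd_mul (c := C) hi' (Continuous.aestronglyMeasurable (by fun_prop)) ?_
    have := (ae_restrict_mem (μ := volume) (measurableSet_Ioc (a := (0 : ℝ)) (b := T)))
    filter_upwards [Measure.quasiMeasurePreserving_snd.ae this] with p hp
    exact hC _ (Set.Ioc_subset_Icc_self hp)
  refine h.integral_prod_left.congr (ae_of_all _ fun x => ?_)
  rw [timeTransform, intervalIntegral.integral_of_le hT.le]

end Transform

section Relation
variable {α x₂ : ℝ} {ψ₀ : ℝ → ℂ} {ψ : ℝ → ℝ → ℂ} (hψ : IsSolution α x₂ ψ₀ ψ) {T : ℝ} (hT : 0 < T)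
include hψ

/-- The equation in divergence form: the time derivative of `e^{θy-iζτ} ψ` is a `y`-derivative if
`θ² = ζ + a`. -/
lemma hasDerivAt_flux {a : ℝ} {θ ζ : ℂ} (hθ : θ ^ 2 = ζ + a) {y τ : ℝ} (h0 : y ≠ 0) (h2 : y ≠ x₂)
    (hτ : 0 < τ) (ha : potential α x₂ y = a) :
    HasDerivAt (fun y : ℝ => I * (exp (θ * y - I * ζ * τ) *
        (deriv (fun x => ψ x τ) y - θ * ψ y τ)))
      (exp (θ * y - I * ζ * τ) * (deriv (fun s => ψ y s) τ - I * ζ * ψ y τ)) y := by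
  have e1 : HasDerivAt (fun y : ℝ => exp (θ * y - I * ζ * τ)) (exp (θ * y - I * ζ * τ) * θ) y := by
    have := (((hasDerivAt_id (y : ℂ)).const_mul θ).sub_const (I * ζ * τ)).cexp.comp_ofReal
    simpa using this
  have e2 := (hψ.differentiableAt_xx y τ h0 h2 hτ).hasDerivAt
  have e3 := (hψ.differentiable_x τ hτ.le y).hasDerivAt
  have he := hψ.equation y τ h0 h2 hτ
  rw [ha] at he
  refine ((e1.mul (e2.sub (e3.const_mul θ))).const_mul I).congr_deriv ?_
  simp only [Pi.sub_apply]
  linear_combination (exp (θ * y - I * ζ * τ)) * I * he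
    - exp (θ * y - I * ζ * τ) * I * ψ y τ * hθ
    - exp (θ * y - I * ζ * τ) * deriv (fun s => ψ y s) τ * Complex.I_sq

lemma continuousOn_flux_time (θ ζ : ℂ) (x : ℝ) : ContinuousOn (fun τ : ℝ =>
    I * (exp (θ * x - I * ζ * τ) * (deriv (fun x => ψ x τ) x - θ * ψ x τ))) (Set.Icc 0 T) := by
  have h1 := continuousOn_section (T := T) hψ.continuousOn x
  have h2 := continuousOn_section (u := fun x τ => deriv (fun x => ψ x τ) x) (T := T)
    hψ.continuousOn_x x
  exact continuousOn_const.mul ((Continuous.continuousOn (by fun_prop)).mul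
    (h2.sub (continuousOn_const.mul h1)))

include hT

/-- The global relation on a compact interval that avoids the interfaces. -/
lemma global_relation_of_avoids {a : ℝ} {θ ζ : ℂ} (hθ : θ ^ 2 = ζ + a) {x x' : ℝ} (hx : x ≤ x')
    (hI : ∀ y ∈ Set.Icc x x', y ≠ 0 ∧ y ≠ x₂ ∧ potential α x₂ y = a) :
    exp (θ * x') * (timeTransform T ζ (fun x τ => deriv (fun x => ψ x τ) x) x'
        - θ * timeTransform T ζ ψ x')
      - exp (θ * x) * (timeTransform T ζ (fun x τ => deriv (fun x => ψ x τ) x) x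
        - θ * timeTransform T ζ ψ x)
      = I * ∫ y in x..x', exp (θ * y) * endData T ζ ψ y := by
  have hc := continuous_extension hψ.continuousOn
  set Q : ℝ → ℂ := fun τ => ∫ y in x..x', exp (θ * y - I * ζ * τ) * ψ y τ with hQ
  set P : ℝ → ℝ → ℂ := fun x τ =>
    I * (exp (θ * x - I * ζ * τ) * (deriv (fun x => ψ x τ) x - θ * ψ x τ)) with hP
  -- `max τ 0` extends `ψ` continuously to negative times.
  have hQc : ContinuousOn Q (Set.Icc 0 T) := by
    have h := intervalIntegral.continuous_parametric_intervalIntegral_of_continuous'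
      (μ := volume) (f := fun (τ y : ℝ) => exp (θ * y - I * ζ * τ) * ψ y (max τ 0))
      (((by fun_prop : Continuous fun p : ℝ × ℝ => exp (θ * p.2 - I * ζ * p.1))).mul
        (hc.comp continuous_swap)) x x'
    refine h.continuousOn.congr fun τ hτ => ?_
    simp only [hQ, max_eq_left hτ.1]
  have hF'c : ContinuousOn (fun p : ℝ × ℝ => exp (θ * p.1 - I * ζ * p.2) *
      (deriv (fun s => ψ p.1 s) p.2 - I * ζ * ψ p.1 p.2)) (Set.Icc x x' ×ˢ Set.Ioi 0) := by
    refine (Continuous.continuousOn (by fun_prop)).mul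
      ((hψ.continuousOn_t.mono fun p hp => ⟨(hI _ hp.1).1, (hI _ hp.1).2.1, hp.2⟩).sub
        (continuousOn_const.mul
          (hψ.continuousOn.mono fun p hp => show (0 : ℝ) ≤ p.2 from le_of_lt hp.2)))
  have hsec : ∀ τ : ℝ, 0 < τ → ContinuousOn (fun y : ℝ => exp (θ * y - I * ζ * τ) *
      (deriv (fun s => ψ y s) τ - I * ζ * ψ y τ)) (Set.Icc x x') := fun τ hτ =>
    hF'c.comp (f := fun y : ℝ => (y, τ)) (by fun_prop) fun y hy => ⟨hy, hτ⟩
  have hfc : ∀ τ : ℝ, 0 ≤ τ → Continuous fun y : ℝ => exp (θ * y - I * ζ * τ) * ψ y τ :=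
    fun τ hτ => (by fun_prop : Continuous fun y : ℝ => exp (θ * y - I * ζ * τ)).mul
      (hψ.differentiable_x τ hτ).continuous
  have hder : ∀ τ ∈ Set.Ioo 0 T, HasDerivAt Q (P x' τ - P x τ) τ := by
    intro τ hτ
    have hτ0 := hτ.1
    have hK : Set.Icc x x' ×ˢ Set.Icc (τ / 2) (2 * τ) ⊆ Set.Icc x x' ×ˢ Set.Ioi (0 : ℝ) :=
      fun p hp => ⟨hp.1, lt_of_lt_of_le (half_pos hτ0) hp.2.1⟩
    obtain ⟨C, hC⟩ := (isCompact_Icc.prod isCompact_Icc).exists_bound_of_continuousOn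
      (hF'c.mono hK)
    have hs : Set.Icc (τ / 2) (2 * τ) ∈ 𝓝 τ := Icc_mem_nhds (by linarith) (by linarith)
    have h := (intervalIntegral.hasDerivAt_integral_of_dominated_loc_of_deriv_le (μ := volume)
      (F := fun (τ y : ℝ) => exp (θ * y - I * ζ * τ) * ψ y τ)
      (F' := fun (τ y : ℝ) => exp (θ * y - I * ζ * τ) *
        (deriv (fun s => ψ y s) τ - I * ζ * ψ y τ)) (a := x) (b := x') (bound := fun _ => C) hs
      ?_ ((hfc τ hτ0.le).intervalIntegrable _ _) ?_ ?_ (by simp) ?_).2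
    · refine h.congr_deriv ?_
      refine intervalIntegral.integral_eq_sub_of_hasDerivAt (f := fun y => P y τ)
        (fun y hy => ?_) ?_
      · rw [Set.uIcc_of_le hx] at hy
        obtain ⟨h0, h2, ha⟩ := hI y hy
        exact hasDerivAt_flux hψ hθ h0 h2 hτ0 ha
      · refine ContinuousOn.intervalIntegrable ?_
        rw [Set.uIcc_of_le hx]
        exact hsec τ hτ0
    · filter_upwards [lt_mem_nhds hτ0] with s hs0
      exact (hfc s hs0.le).aestronglyMeasurable
    · rw [Set.uIoc_of_le hx]
      exact ((hsec τ hτ0).mono Set.Ioc_subset_Icc_self).aestronglyMeasurable measurableSet_Ioc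
    · refine ae_of_all _ fun y hy s hs => ?_
      rw [Set.uIoc_of_le hx] at hy
      exact hC (y, s) ⟨Set.Ioc_subset_Icc_self hy, hs⟩
    · refine ae_of_all _ fun y hy s hs => ?_
      rw [Set.uIoc_of_le hx] at hy
      obtain ⟨h0, h2, -⟩ := hI y (Set.Ioc_subset_Icc_self hy)
      have hs0 : 0 < s := lt_of_lt_of_le (half_pos hτ0) hs.1
      have e1 : HasDerivAt (fun s : ℝ => exp (θ * y - I * ζ * s))
          (exp (θ * y - I * ζ * s) * -(I * ζ)) s := by
        have := (((hasDerivAt_id (s : ℂ)).const_mul (I * ζ)).const_sub (θ * y)).cexp.comp_ofReal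
        simpa using this
      exact (e1.mul (hψ.differentiableAt_t y s h0 h2 hs0).hasDerivAt).congr_deriv (by ring)
  have hPc : ∀ x : ℝ, ContinuousOn (P x) (Set.Icc 0 T) := fun x => continuousOn_flux_time hψ θ ζ x
  have hPi : ∀ x : ℝ, IntervalIntegrable (P x) volume 0 T := fun x => by
    refine ContinuousOn.intervalIntegrable ?_
    rw [Set.uIcc_of_le hT.le]
    exact hPc x
  -- `Q' = P x' - P x` on the open interval only: the equation is not assumed at time `0`.
  have key := intervalIntegral.integral_eq_sub_of_hasDerivAt_of_le hT.le hQc hder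
    ((hPi x').sub (hPi x))
  have hU : ∀ x : ℝ, ∫ τ in (0 : ℝ)..T, P x τ = I * (exp (θ * x) *
      (timeTransform T ζ (fun x τ => deriv (fun x => ψ x τ) x) x - θ * timeTransform T ζ ψ x)) := by
    intro x
    have hi : ∀ {v : ℝ → ℂ}, ContinuousOn v (Set.Icc 0 T) →
        IntervalIntegrable (fun τ : ℝ => exp (-(I * ζ * τ)) * v τ) volume 0 T := fun {v} hv => by
      refine ContinuousOn.intervalIntegrable ?_
      rw [Set.uIcc_of_le hT.le]
      exact (Continuous.continuousOn (by fun_prop)).mul hv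
    rw [timeTransform, timeTransform, ← intervalIntegral.integral_const_mul θ,
      ← intervalIntegral.integral_sub
        (hi (continuousOn_section (u := fun x τ => deriv (fun x => ψ x τ) x) hψ.continuousOn_x x))
        ((hi (continuousOn_section hψ.continuousOn x)).const_mul θ),
      ← intervalIntegral.integral_const_mul, ← intervalIntegral.integral_const_mul]
    refine intervalIntegral.integral_congr fun τ _ => ?_
    simp only [hP]
    rw [sub_eq_add_neg (θ * x : ℂ), Complex.exp_add]
    ring
  rw [intervalIntegral.integral_sub (hPi x') (hPi x), hU, hU] at key
  have hR : ∫ y in x..x', exp (θ * y) * endData T ζ ψ y = Q 0 - Q T := by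
    simp only [hQ]
    rw [← intervalIntegral.integral_sub ((hfc 0 le_rfl).intervalIntegrable _ _)
      ((hfc T hT.le).intervalIntegrable _ _)]
    refine intervalIntegral.integral_congr fun y _ => ?_
    simp only [endData]
    rw [sub_eq_add_neg (θ * y : ℂ) (I * ζ * (T : ℝ)), Complex.exp_add]
    simp
    ring
  rw [hR]
  rw [← mul_sub] at key
  have h := congrArg (fun w => -I * w) key
  simp only [← mul_assoc, neg_mul, Complex.I_mul_I, neg_neg, one_mul] at h
  linear_combination h

omit hT in
lemma continuous_endData (hT : 0 ≤ T) (ζ : ℂ) : Continuous (endData T ζ ψ) :=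
  (hψ.differentiable_x 0 le_rfl).continuous.sub
    (continuous_const.mul (hψ.differentiable_x T hT).continuous)

/-- The global relation on an interval of constant potential, including the end points. -/
lemma global_relation {s : Set ℝ} (hs : s.OrdConnected) {a : ℝ}
    (hI : ∀ y ∈ s, y ≠ 0 ∧ y ≠ x₂ ∧ potential α x₂ y = a)
    {θ ζ : ℂ} (hθ : θ ^ 2 = ζ + a) {x x' : ℝ} (hx : x ∈ closure s) (hx' : x' ∈ closure s) :
    exp (θ * x') * (timeTransform T ζ (fun x τ => deriv (fun x => ψ x τ) x) x'
        - θ * timeTransform T ζ ψ x')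
      - exp (θ * x) * (timeTransform T ζ (fun x τ => deriv (fun x => ψ x τ) x) x
        - θ * timeTransform T ζ ψ x)
      = I * ∫ y in x..x', exp (θ * y) * endData T ζ ψ y := by
  set V : ℝ → ℂ := fun x => exp (θ * x) *
    (timeTransform T ζ (fun x τ => deriv (fun x => ψ x τ) x) x - θ * timeTransform T ζ ψ x)
  have hV : Continuous V := (by fun_prop : Continuous fun x : ℝ => exp (θ * x)).mul
    ((continuous_timeTransform (u := fun x τ => deriv (fun x => ψ x τ) x)
      hψ.continuousOn_x hT ζ).sub
      (continuous_const.mul (continuous_timeTransform hψ.continuousOn hT ζ)))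
  have hw : Continuous fun y : ℝ => exp (θ * y) * endData T ζ ψ y :=
    (by fun_prop : Continuous fun x : ℝ => exp (θ * x)).mul (continuous_endData hψ hT.le ζ)
  have hW : Continuous fun x : ℝ => ∫ y in (0 : ℝ)..x, exp (θ * y) * endData T ζ ψ y :=
    intervalIntegral.continuous_primitive (fun _ _ => hw.intervalIntegrable _ _) 0
  have hii : ∀ a b, IntervalIntegrable (fun y : ℝ => exp (θ * y) * endData T ζ ψ y) volume a b :=
    fun a b => hw.intervalIntegrable a b
  -- The relation holds inside `s`, and both sides are continuous in the end points.
  have hmem : ∀ y ∈ s, ∀ y' ∈ s, V y' - V y = I * ∫ y in y..y', exp (θ * y) * endData T ζ ψ y := by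
    intro y hy y' hy'
    rcases le_total y y' with h | h
    · exact global_relation_of_avoids hψ hT hθ h fun r hr => hI r (hs.out hy hy' hr)
    · rw [intervalIntegral.integral_symm]
      linear_combination -global_relation_of_avoids hψ hT hθ h fun r hr => hI r (hs.out hy' hy hr)
  set G : ℝ → ℂ := fun x => V x - I * ∫ y in (0 : ℝ)..x, exp (θ * y) * endData T ζ ψ y
  have hG : Continuous G := hV.sub (continuous_const.mul hW)
  have hGs : ∀ y ∈ s, ∀ y' ∈ s, G y' = G y := by
    intro y hy y' hy'
    have := hmem y hy y' hy'
    simp only [G]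
    rw [← intervalIntegral.integral_add_adjacent_intervals (hii 0 y) (hii y y')]
    linear_combination this
  have h1 : ∀ y ∈ s, G x' = G y := fun y hy =>
    (Set.EqOn.closure (f := G) (g := fun _ => G y) (hGs y hy) hG continuous_const) hx'
  have h2 : G x = G x' :=
    (Set.EqOn.closure (f := G) (g := fun _ => G x') (fun y hy => (h1 y hy).symm) hG
      continuous_const) hx
  have h3 := intervalIntegral.integral_add_adjacent_intervals (hii 0 x) (hii x x')
  simp only [G] at h2
  linear_combination -h2 - I * h3

lemma integrable_endData (hψ₀ : Integrable ψ₀) (ζ : ℂ) : Integrable (endData T ζ ψ) := by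
  refine Integrable.sub ?_ ((hψ.integrable T hT).const_mul _)
  simpa only [hψ.initial] using hψ₀

end Relation

/-! ### The transformed solution in terms of the data -/

lemma lap_comp_sub {φ : ℝ → ℂ} (x : ℝ) (κ : ℂ) :
    lap (fun y => φ (x - y)) κ = ∫ u in Set.Iic x, exp (-(κ * (x - u))) * φ u := by
  rw [lap, ← integral_indicator measurableSet_Ioi, integral_Iic_eq_integral_Iio,
    ← integral_indicator measurableSet_Iio,
    ← integral_sub_left_eq_self (Set.indicator (Set.Iio x) _) volume x]
  refine integral_congr_ae (ae_of_all _ fun y => ?_)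
  by_cases hy : 0 < y
  · simp [Set.indicator, hy]
  · simp [Set.indicator, hy]

lemma lap_comp_add {φ : ℝ → ℂ} (x : ℝ) (κ : ℂ) :
    lap (fun y => φ (x + y)) κ = ∫ u in Set.Ioi x, exp (-(κ * (u - x))) * φ u := by
  rw [lap, ← integral_indicator measurableSet_Ioi, ← integral_indicator measurableSet_Ioi,
    ← integral_add_left_eq_self (Set.indicator (Set.Ioi x) _) x]
  refine integral_congr_ae (ae_of_all _ fun y => ?_)
  by_cases hy : 0 < y
  · simp [Set.indicator, hy]
  · simp [Set.indicator, hy]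

/-- Convolution of the data on `s` with `e^{-κ|x|}`, as a Laplace transform. -/
lemma lap_fold {φ : ℝ → ℂ} (hφ : Integrable φ) {s : Set ℝ} (hs : MeasurableSet s) (x : ℝ) {κ : ℂ}
    (hκ : 0 ≤ κ.re) :
    lap (fun y => s.indicator φ (x - y) + s.indicator φ (x - -y)) κ
      = (∫ u in Set.Iic x ∩ s, exp (-(κ * (x - u))) * φ u)
        + ∫ u in Set.Ioi x ∩ s, exp (-(κ * (u - x))) * φ u := by
  have hi := hφ.indicator hs
  have h1 := integrableOn_lap (g := fun y => s.indicator φ (x - y))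
    (hi.comp_sub_left x).integrableOn hκ
  have h2 := integrableOn_lap (g := fun y => s.indicator φ (x + y))
    (hi.comp_add_left x).integrableOn hκ
  have e : ∀ (w : ℝ → ℂ) (S : Set ℝ), MeasurableSet S →
      ∫ u in S, w u * s.indicator φ u = ∫ u in S ∩ s, w u * φ u := by
    intro w S hS
    rw [← setIntegral_indicator hs]
    refine integral_congr_ae (ae_of_all _ fun u => ?_)
    by_cases hu : u ∈ s <;> simp [hu]
  rw [← e _ _ measurableSet_Iic, ← e _ _ measurableSet_Ioi, ← lap_comp_sub x κ, ← lap_comp_add x κ]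
  simp only [lap, sub_neg_eq_add]
  rw [← integral_add h1 h2]
  exact integral_congr_ae (ae_of_all _ fun y => mul_add _ _ _)

/-- An integrable function that converges at infinity converges to zero. -/
lemma eq_zero_of_tendsto_atTop {V : ℝ → ℂ} {L : ℂ} {c : ℝ} (hV : IntegrableOn V (Set.Ioi c))
    (h : Tendsto V atTop (𝓝 L)) : L = 0 := by
  refine IntegrableAtFilter.eq_zero_of_tendsto ⟨Set.Ioi c, Ioi_mem_atTop c, hV⟩ (fun s hs => ?_) h
  obtain ⟨b, hb⟩ := mem_atTop_sets.1 hs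
  rw [← top_le_iff, ← Real.volume_Ici (a := b)]
  exact measure_mono hb

/-- The determinant of the linear system for the interface values of the transformed solution,
with `E = e^{-λ x₂}`. -/
def dispersion (κ l E : ℂ) : ℂ := (κ + l) ^ 2 - (κ - l) ^ 2 * E ^ 2

lemma lap_reflect_indicator {x₂ : ℝ} (hx₂ : 0 ≤ x₂) (φ : ℝ → ℂ) (l : ℂ) :
    lap ((Set.Iic x₂).indicator fun y => φ (x₂ - y)) l
      = exp (-(l * x₂)) * ∫ y in (0 : ℝ)..x₂, exp (l * y) * φ y := by
  rw [lap_indicator_Iic hx₂, ← intervalIntegral.integral_const_mul]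
  have h := intervalIntegral.integral_comp_sub_left (a := 0) (b := x₂)
    (fun y : ℝ => exp (-(l * x₂)) * (exp (l * y) * φ y)) x₂
  rw [sub_self, sub_zero] at h
  rw [← h]
  refine intervalIntegral.integral_congr fun y _ => ?_
  simp only [← mul_assoc, ← Complex.exp_add]
  push_cast
  ring_nf

section Regions
variable {α x₂ : ℝ} {ψ₀ : ℝ → ℂ} {ψ : ℝ → ℝ → ℂ} (hψ : IsSolution α x₂ ψ₀ ψ) (hx₂ : 0 < x₂)
  (hψ₀ : Integrable ψ₀) {T : ℝ} (hT : 0 < T) {κ l ζ : ℂ} (hκ : κ ^ 2 = ζ) (hl : l ^ 2 = ζ + α)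
  (hκ0 : 0 ≤ κ.re) (hl0 : 0 ≤ l.re)
include hψ hx₂ hT

lemma global_relation_left {θ : ℂ} (hθ : θ ^ 2 = ζ) {x x' : ℝ} (hx : x ≤ 0) (hx' : x' ≤ 0) :
    exp (θ * x') * (timeTransform T ζ (fun x τ => deriv (fun x => ψ x τ) x) x'
        - θ * timeTransform T ζ ψ x')
      - exp (θ * x) * (timeTransform T ζ (fun x τ => deriv (fun x => ψ x τ) x) x
        - θ * timeTransform T ζ ψ x)
      = I * ∫ y in x..x', exp (θ * y) * endData T ζ ψ y := by
  refine global_relation hψ hT (s := Set.Iio 0) Set.ordConnected_Iio (a := 0) (fun y hy => ?_)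
    (by simpa using hθ) (by simpa using hx) (by simpa using hx')
  have hy' : y < 0 := hy
  exact ⟨hy'.ne, (hy'.trans hx₂).ne, if_neg fun h => absurd h.1 hy'.not_gt⟩

lemma global_relation_right {θ : ℂ} (hθ : θ ^ 2 = ζ) {x x' : ℝ} (hx : x₂ ≤ x) (hx' : x₂ ≤ x') :
    exp (θ * x') * (timeTransform T ζ (fun x τ => deriv (fun x => ψ x τ) x) x'
        - θ * timeTransform T ζ ψ x')
      - exp (θ * x) * (timeTransform T ζ (fun x τ => deriv (fun x => ψ x τ) x) x
        - θ * timeTransform T ζ ψ x)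
      = I * ∫ y in x..x', exp (θ * y) * endData T ζ ψ y := by
  refine global_relation hψ hT (s := Set.Ioi x₂) Set.ordConnected_Ioi (a := 0) (fun y hy => ?_)
    (by simpa using hθ) (by simpa using hx) (by simpa using hx')
  have hy' : x₂ < y := hy
  exact ⟨(hx₂.trans hy').ne', hy'.ne', if_neg fun h => absurd h.2 hy'.not_gt⟩

lemma global_relation_middle {θ : ℂ} (hθ : θ ^ 2 = ζ + α) {x x' : ℝ} (hx : x ∈ Set.Icc 0 x₂)
    (hx' : x' ∈ Set.Icc 0 x₂) :
    exp (θ * x') * (timeTransform T ζ (fun x τ => deriv (fun x => ψ x τ) x) x'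
        - θ * timeTransform T ζ ψ x')
      - exp (θ * x) * (timeTransform T ζ (fun x τ => deriv (fun x => ψ x τ) x) x
        - θ * timeTransform T ζ ψ x)
      = I * ∫ y in x..x', exp (θ * y) * endData T ζ ψ y := by
  refine global_relation hψ hT (s := Set.Ioo 0 x₂) Set.ordConnected_Ioo (a := α) (fun y hy => ?_)
    hθ (by rwa [closure_Ioo hx₂.ne]) (by rwa [closure_Ioo hx₂.ne])
  exact ⟨hy.1.ne', hy.2.ne, if_pos hy⟩

include hl

/-- The global relation of the well with the decaying exponential `e^{-λy}`. -/
lemma interface_relation_minus :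
    exp (-(l * x₂)) * (timeTransform T ζ (fun x τ => deriv (fun x => ψ x τ) x) x₂
        + l * timeTransform T ζ ψ x₂)
      - (timeTransform T ζ (fun x τ => deriv (fun x => ψ x τ) x) 0 + l * timeTransform T ζ ψ 0)
      = I * lap ((Set.Iic x₂).indicator (endData T ζ ψ)) l := by
  have h := global_relation_middle hψ hx₂ hT (θ := -l) (by rw [neg_sq, hl])
    (Set.left_mem_Icc.2 hx₂.le) (Set.right_mem_Icc.2 hx₂.le)
  rw [lap_indicator_Iic hx₂.le]
  simpa only [neg_mul, sub_neg_eq_add, Complex.ofReal_zero, mul_zero, neg_zero, Complex.exp_zero,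
    one_mul] using h

/-- The global relation of the well with the growing exponential `e^{λy}`, normalised by
`e^{-λx₂}`. -/
lemma interface_relation_plus :
    (timeTransform T ζ (fun x τ => deriv (fun x => ψ x τ) x) x₂ - l * timeTransform T ζ ψ x₂)
      - exp (-(l * x₂)) * (timeTransform T ζ (fun x τ => deriv (fun x => ψ x τ) x) 0
        - l * timeTransform T ζ ψ 0)
      = I * lap ((Set.Iic x₂).indicator fun y => endData T ζ ψ (x₂ - y)) l := by
  have h := global_relation_middle hψ hx₂ hT hl
    (Set.left_mem_Icc.2 hx₂.le) (Set.right_mem_Icc.2 hx₂.le)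
  have e : exp (-(l * x₂)) * exp (l * x₂) = 1 := by rw [← Complex.exp_add]; simp
  rw [lap_reflect_indicator hx₂.le]
  simp only [Complex.ofReal_zero, mul_zero, Complex.exp_zero, one_mul] at h
  linear_combination exp (-(l * x₂)) * h
    - (timeTransform T ζ (fun x τ => deriv (fun x => ψ x τ) x) x₂
      - l * timeTransform T ζ ψ x₂) * e

omit hl
include hψ₀ hκ hκ0

/-- Integrability of the transform makes the boundary term at `-∞` vanish. -/
lemma halfLine_relation_left {x : ℝ} (hx : x ≤ 0) :
    timeTransform T ζ (fun x τ => deriv (fun x => ψ x τ) x) x - κ * timeTransform T ζ ψ x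
      = I * ∫ y in Set.Iic x, exp (-(κ * (x - y))) * endData T ζ ψ y := by
  set V : ℝ → ℂ := fun x => exp (κ * x) *
    (timeTransform T ζ (fun x τ => deriv (fun x => ψ x τ) x) x - κ * timeTransform T ζ ψ x)
  have hb : ∀ y ∈ Set.Iic x, ‖exp (κ * y)‖ ≤ 1 := fun y hy => by
    have := norm_exp_neg_mul_le_one hκ0 (y := -y) (by linarith [Set.mem_Iic.1 hy])
    simpa using this
  have hbdd : ∀ {f : ℝ → ℂ}, Integrable f →
      IntegrableOn (fun y : ℝ => exp (κ * y) * f y) (Set.Iic x) := fun {f} hf =>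
    Integrable.bdd_mul (c := 1) hf.integrableOn (Continuous.aestronglyMeasurable (by fun_prop))
      (by filter_upwards [ae_restrict_mem measurableSet_Iic] with y hy using hb y hy)
  have hVi : IntegrableOn V (Set.Iic x) := hbdd
    ((integrable_timeTransform (u := fun x τ => deriv (fun x => ψ x τ) x) hT
      (hψ.integrableOn_strip_x T hT) ζ).sub
      ((integrable_timeTransform hT (hψ.integrableOn_strip T hT) ζ).const_mul κ))
  have hφ := hbdd (integrable_endData hψ hT hψ₀ ζ)
  have hlim : Tendsto (fun X : ℝ => V (-X)) atTop
      (𝓝 (V x - I * ∫ y in Set.Iic x, exp (κ * y) * endData T ζ ψ y)) := by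
    have h := ((intervalIntegral_tendsto_integral_Iic x hφ tendsto_neg_atTop_atBot).const_mul
      I).const_sub (V x)
    refine h.congr' ?_
    filter_upwards [eventually_ge_atTop 0] with X hX
    linear_combination global_relation_left hψ hx₂ hT hκ (x := -X) (x' := x) (by linarith) hx
  have h0 := eq_zero_of_tendsto_atTop (c := -x) (by
    have := (integrableOn_Iic_iff_integrableOn_Iio).1 hVi
    rw [← neg_neg x] at this
    exact this.comp_neg_Ioi) hlim
  have e : ∫ y in Set.Iic x, exp (-(κ * (x - y))) * endData T ζ ψ y
      = exp (-(κ * x)) * ∫ y in Set.Iic x, exp (κ * y) * endData T ζ ψ y := by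
    rw [← integral_const_mul]
    refine integral_congr_ae (ae_of_all _ fun y => ?_)
    simp only [← mul_assoc, ← Complex.exp_add]
    ring_nf
  have e1 : exp (-(κ * x)) * exp (κ * x) = 1 := by rw [← Complex.exp_add]; simp
  rw [e]
  simp only [V] at h0
  linear_combination exp (-(κ * x)) * h0
    - (timeTransform T ζ (fun x τ => deriv (fun x => ψ x τ) x) x
      - κ * timeTransform T ζ ψ x) * e1

/-- Integrability of the transform makes the boundary term at `+∞` vanish. -/
lemma halfLine_relation_right {x : ℝ} (hx : x₂ ≤ x) :
    timeTransform T ζ (fun x τ => deriv (fun x => ψ x τ) x) x + κ * timeTransform T ζ ψ x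
      = -I * ∫ y in Set.Ioi x, exp (-(κ * (y - x))) * endData T ζ ψ y := by
  set V : ℝ → ℂ := fun x => exp (-κ * x) *
    (timeTransform T ζ (fun x τ => deriv (fun x => ψ x τ) x) x - -κ * timeTransform T ζ ψ x)
  have hb : ∀ y ∈ Set.Ioi x, ‖exp (-κ * y)‖ ≤ 1 := fun y hy => by
    have := norm_exp_neg_mul_le_one hκ0 (y := y) (by linarith [Set.mem_Ioi.1 hy])
    simpa using this
  have hbdd : ∀ {f : ℝ → ℂ}, Integrable f →
      IntegrableOn (fun y : ℝ => exp (-κ * y) * f y) (Set.Ioi x) := fun {f} hf =>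
    Integrable.bdd_mul (c := 1) hf.integrableOn (Continuous.aestronglyMeasurable (by fun_prop))
      (by filter_upwards [ae_restrict_mem measurableSet_Ioi] with y hy using hb y hy)
  have hVi : IntegrableOn V (Set.Ioi x) := hbdd
    ((integrable_timeTransform (u := fun x τ => deriv (fun x => ψ x τ) x) hT
      (hψ.integrableOn_strip_x T hT) ζ).sub
      ((integrable_timeTransform hT (hψ.integrableOn_strip T hT) ζ).const_mul (-κ)))
  have hφ := hbdd (integrable_endData hψ hT hψ₀ ζ)
  have hlim : Tendsto V atTop
      (𝓝 (V x + I * ∫ y in Set.Ioi x, exp (-κ * y) * endData T ζ ψ y)) := by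
    have h := ((intervalIntegral_tendsto_integral_Ioi x hφ (b := fun X => X) tendsto_id).const_mul
      I).const_add (V x)
    refine h.congr' ?_
    filter_upwards [eventually_ge_atTop x₂] with X hX
    linear_combination -global_relation_right hψ hx₂ hT (θ := -κ) (by rw [neg_sq, hκ])
      (x := x) (x' := X) hx hX
  have h0 := eq_zero_of_tendsto_atTop hVi hlim
  have e : ∫ y in Set.Ioi x, exp (-(κ * (y - x))) * endData T ζ ψ y
      = exp (κ * x) * ∫ y in Set.Ioi x, exp (-κ * y) * endData T ζ ψ y := by
    rw [← integral_const_mul]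
    refine integral_congr_ae (ae_of_all _ fun y => ?_)
    simp only [← mul_assoc, ← Complex.exp_add]
    ring_nf
  have e1 : exp (κ * x) * exp (-κ * x) = 1 := by rw [← Complex.exp_add]; simp
  rw [e]
  simp only [V] at h0
  linear_combination exp (κ * x) * h0 - (timeTransform T ζ (fun x τ => deriv (fun x => ψ x τ) x) x
    + κ * timeTransform T ζ ψ x) * e1

lemma interface_relation_left :
    timeTransform T ζ (fun x τ => deriv (fun x => ψ x τ) x) 0 - κ * timeTransform T ζ ψ 0
      = I * lap (fun y => endData T ζ ψ (-y)) κ := by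
  rw [halfLine_relation_left hψ hx₂ hψ₀ hT hκ hκ0 le_rfl, ← lap_comp_sub 0]
  simp only [zero_sub]

lemma interface_relation_right :
    timeTransform T ζ (fun x τ => deriv (fun x => ψ x τ) x) x₂ + κ * timeTransform T ζ ψ x₂
      = -I * lap (fun y => endData T ζ ψ (x₂ + y)) κ := by
  rw [halfLine_relation_right hψ hx₂ hψ₀ hT hκ hκ0 le_rfl, ← lap_comp_add x₂]

include hl

/-- The transformed solution to the left of the well. -/
lemma timeTransform_left {x : ℝ} (hx : x < 0) :
    dispersion κ l (exp (-(l * x₂))) * (2 * κ * timeTransform T ζ ψ x) = I * (exp (κ * x) *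
      (α * (1 - exp (-(l * x₂)) ^ 2) * lap (fun y => endData T ζ ψ (-y)) κ
      - 2 * κ * (κ + l) * lap ((Set.Iic x₂).indicator (endData T ζ ψ)) l
      + 2 * κ * (κ - l) * exp (-(l * x₂)) *
        lap ((Set.Iic x₂).indicator fun y => endData T ζ ψ (x₂ - y)) l
      - 4 * κ * l * exp (-(l * x₂)) * lap (fun y => endData T ζ ψ (x₂ + y)) κ)
      - dispersion κ l (exp (-(l * x₂))) *
        lap (fun y => (Set.Iic 0).indicator (endData T ζ ψ) (x - y)
          + (Set.Iic 0).indicator (endData T ζ ψ) (x - -y)) κ) := by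
  have h1 := interface_relation_left hψ hx₂ hψ₀ hT hκ hκ0
  have h2 := interface_relation_minus hψ hx₂ hT hl
  have h3 := interface_relation_plus hψ hx₂ hT hl
  have h4 := interface_relation_right hψ hx₂ hψ₀ hT hκ hκ0
  have h5 := halfLine_relation_left hψ hx₂ hψ₀ hT hκ hκ0 hx.le
  have h6 := global_relation_left hψ hx₂ hT (θ := -κ) (by rw [neg_sq, hκ]) hx.le le_rfl
  have hα : (α : ℂ) = l ^ 2 - κ ^ 2 := by linear_combination hκ - hl
  have e : exp (κ * x) * exp (-κ * x) = 1 := by rw [← Complex.exp_add]; simp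
  have e2 : ∫ u in Set.Ioi x ∩ Set.Iic 0, exp (-(κ * (u - x))) * endData T ζ ψ u
      = exp (κ * x) * ∫ y in x..0, exp (-κ * y) * endData T ζ ψ y := by
    rw [Set.Ioi_inter_Iic, ← intervalIntegral.integral_of_le hx.le,
      ← intervalIntegral.integral_const_mul]
    refine intervalIntegral.integral_congr fun y _ => ?_
    simp only [← mul_assoc, ← Complex.exp_add]
    ring_nf
  rw [lap_fold (integrable_endData hψ hT hψ₀ ζ) measurableSet_Iic x hκ0,
    Set.inter_eq_left.2 (Set.Iic_subset_Iic.2 hx.le), e2, hα]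
  simp only [Complex.ofReal_zero, mul_zero, Complex.exp_zero, one_mul] at h6
  rw [dispersion]
  set E := exp (-(l * x₂))
  set D := (κ + l) ^ 2 - (κ - l) ^ 2 * E ^ 2 with hD
  set U := timeTransform T ζ ψ x
  set U1 := timeTransform T ζ (fun x τ => deriv (fun x => ψ x τ) x) x
  linear_combination exp (κ * x) * ((l ^ 2 - κ ^ 2) * (1 - E ^ 2) * h1 - 2 * κ * (κ + l) * h2
    + 2 * κ * (κ - l) * E * h3 + 4 * κ * l * E * h4) - D * h5 - D * exp (κ * x) * h6
    - D * (U1 + κ * U) * e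

/-- The transformed solution to the right of the well. -/
lemma timeTransform_right {x : ℝ} (hx : x₂ < x) :
    dispersion κ l (exp (-(l * x₂))) * (2 * κ * timeTransform T ζ ψ x) =
      I * (exp (-(κ * (x - x₂))) *
      (α * (1 - exp (-(l * x₂)) ^ 2) * lap (fun y => endData T ζ ψ (x₂ + y)) κ
      - 2 * κ * (κ + l) * lap ((Set.Iic x₂).indicator fun y => endData T ζ ψ (x₂ - y)) l
      + 2 * κ * (κ - l) * exp (-(l * x₂)) * lap ((Set.Iic x₂).indicator (endData T ζ ψ)) l
      - 4 * κ * l * exp (-(l * x₂)) * lap (fun y => endData T ζ ψ (-y)) κ)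
      - dispersion κ l (exp (-(l * x₂))) *
        lap (fun y => (Set.Ioi x₂).indicator (endData T ζ ψ) (x - y)
          + (Set.Ioi x₂).indicator (endData T ζ ψ) (x - -y)) κ) := by
  have h1 := interface_relation_left hψ hx₂ hψ₀ hT hκ hκ0
  have h2 := interface_relation_minus hψ hx₂ hT hl
  have h3 := interface_relation_plus hψ hx₂ hT hl
  have h4 := interface_relation_right hψ hx₂ hψ₀ hT hκ hκ0
  have h5 := halfLine_relation_right hψ hx₂ hψ₀ hT hκ hκ0 hx.le
  have h6 := global_relation_right hψ hx₂ hT hκ le_rfl hx.le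
  have hα : (α : ℂ) = l ^ 2 - κ ^ 2 := by linear_combination hκ - hl
  have e : exp (-(κ * x)) * exp (κ * x) = 1 := by rw [← Complex.exp_add]; simp
  have e' : exp (-(κ * (x - x₂))) = exp (-(κ * x)) * exp (κ * x₂) := by
    rw [← Complex.exp_add]; ring_nf
  have e2 : ∫ u in Set.Iic x ∩ Set.Ioi x₂, exp (-(κ * (x - u))) * endData T ζ ψ u
      = exp (-(κ * x)) * ∫ y in x₂..x, exp (κ * y) * endData T ζ ψ y := by
    rw [Set.inter_comm, Set.Ioi_inter_Iic, ← intervalIntegral.integral_of_le hx.le,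
      ← intervalIntegral.integral_const_mul]
    refine intervalIntegral.integral_congr fun y _ => ?_
    simp only [← mul_assoc, ← Complex.exp_add]
    ring_nf
  rw [lap_fold (integrable_endData hψ hT hψ₀ ζ) measurableSet_Ioi x hκ0,
    Set.inter_eq_left.2 (Set.Ioi_subset_Ioi hx.le), e2, hα, e']
  rw [dispersion]
  set E := exp (-(l * x₂))
  set D := (κ + l) ^ 2 - (κ - l) ^ 2 * E ^ 2 with hD
  set U := timeTransform T ζ ψ x
  set U1 := timeTransform T ζ (fun x τ => deriv (fun x => ψ x τ) x) x
  linear_combination -exp (-(κ * x)) * exp (κ * x₂) * (4 * κ * l * E * h1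
    - 2 * κ * (κ - l) * E * h2 + 2 * κ * (κ + l) * h3 + (l ^ 2 - κ ^ 2) * (1 - E ^ 2) * h4)
    + D * h5 - D * exp (-(κ * x)) * h6 + D * (U1 - κ * U) * e

include hl0

/-- The transformed solution inside the well. -/
lemma timeTransform_middle {x : ℝ} (hx : 0 < x) (hx' : x < x₂) :
    dispersion κ l (exp (-(l * x₂))) * (2 * l * timeTransform T ζ ψ x) =
      I * (exp (-(l * (x₂ - x))) *
      (2 * l * (κ - l) * exp (-(l * x₂)) * lap (fun y => endData T ζ ψ (-y)) κ
      - (κ - l) ^ 2 * exp (-(l * x₂)) * lap ((Set.Iic x₂).indicator (endData T ζ ψ)) l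
      - α * lap ((Set.Iic x₂).indicator fun y => endData T ζ ψ (x₂ - y)) l
      - 2 * l * (κ + l) * lap (fun y => endData T ζ ψ (x₂ + y)) κ)
      - exp (-(l * x)) *
      (2 * l * (κ + l) * lap (fun y => endData T ζ ψ (-y)) κ
      + α * lap ((Set.Iic x₂).indicator (endData T ζ ψ)) l
      + (κ - l) ^ 2 * exp (-(l * x₂)) *
        lap ((Set.Iic x₂).indicator fun y => endData T ζ ψ (x₂ - y)) l
      - 2 * l * (κ - l) * exp (-(l * x₂)) * lap (fun y => endData T ζ ψ (x₂ + y)) κ)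
      - dispersion κ l (exp (-(l * x₂))) *
        lap (fun y => (Set.Ioc 0 x₂).indicator (endData T ζ ψ) (x - y)
          + (Set.Ioc 0 x₂).indicator (endData T ζ ψ) (x - -y)) l) := by
  have h1 := interface_relation_left hψ hx₂ hψ₀ hT hκ hκ0
  have h2 := interface_relation_minus hψ hx₂ hT hl
  have h3 := interface_relation_plus hψ hx₂ hT hl
  have h4 := interface_relation_right hψ hx₂ hψ₀ hT hκ hκ0
  have h5 := global_relation_middle hψ hx₂ hT hl (Set.left_mem_Icc.2 hx₂.le) ⟨hx.le, hx'.le⟩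
  have h6 := global_relation_middle hψ hx₂ hT (θ := -l) (by rw [neg_sq, hl])
    ⟨hx.le, hx'.le⟩ (Set.right_mem_Icc.2 hx₂.le)
  have hα : (α : ℂ) = l ^ 2 - κ ^ 2 := by linear_combination hκ - hl
  have e : exp (-(l * x)) * exp (l * x) = 1 := by rw [← Complex.exp_add]; simp
  have e' : exp (-(l * (x₂ - x))) = exp (l * x) * exp (-(l * x₂)) := by
    rw [← Complex.exp_add]; ring_nf
  have e1 : ∫ u in Set.Iic x ∩ Set.Ioc 0 x₂, exp (-(l * (x - u))) * endData T ζ ψ u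
      = exp (-(l * x)) * ∫ y in (0 : ℝ)..x, exp (l * y) * endData T ζ ψ y := by
    rw [Set.inter_comm, Set.Ioc_inter_Iic, min_eq_right hx'.le,
      ← intervalIntegral.integral_of_le hx.le, ← intervalIntegral.integral_const_mul]
    refine intervalIntegral.integral_congr fun y _ => ?_
    simp only [← mul_assoc, ← Complex.exp_add]
    ring_nf
  have e2 : ∫ u in Set.Ioi x ∩ Set.Ioc 0 x₂, exp (-(l * (u - x))) * endData T ζ ψ u
      = exp (l * x) * ∫ y in x..x₂, exp (-(l * y)) * endData T ζ ψ y := by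
    rw [Set.inter_comm, Set.Ioc_inter_Ioi, max_eq_right hx.le,
      ← intervalIntegral.integral_of_le hx'.le, ← intervalIntegral.integral_const_mul]
    refine intervalIntegral.integral_congr fun y _ => ?_
    simp only [← mul_assoc, ← Complex.exp_add]
    ring_nf
  rw [lap_fold (integrable_endData hψ hT hψ₀ ζ) measurableSet_Ioc x hl0, e1, e2, hα, e']
  simp only [Complex.ofReal_zero, mul_zero, Complex.exp_zero, one_mul] at h5
  simp only [neg_mul] at h6
  rw [dispersion]
  set E := exp (-(l * x₂))
  set D := (κ + l) ^ 2 - (κ - l) ^ 2 * E ^ 2 with hD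
  set U := timeTransform T ζ ψ x
  set U1 := timeTransform T ζ (fun x τ => deriv (fun x => ψ x τ) x) x
  linear_combination exp (l * x) * E * (2 * l * (κ - l) * E * h1 - (κ - l) ^ 2 * E * h2
    - (l ^ 2 - κ ^ 2) * h3 + 2 * l * (κ + l) * h4) - exp (-(l * x)) * (2 * l * (κ + l) * h1
    + (l ^ 2 - κ ^ 2) * h2 + (κ - l) ^ 2 * E * h3 + 2 * l * (κ - l) * E * h4)
    - D * exp (l * x) * h6 - D * exp (-(l * x)) * h5 - D * (U1 + l * U) * e + D * (U1 - l * U) * e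

end Regions

/-! ### Reflection and transmission amplitudes -/

/-- The factor `e^{-λ x₂}`. -/
def wellFactor (c x₂ : ℝ) (z : ℂ) : ℂ := exp (-(ell c z * x₂))

/-- The determinant `dispersion`, divided by `z²`. -/
def ampDet (b c x₂ : ℝ) (z : ℂ) : ℂ := dispersion (root b z) (root c z) (wellFactor c x₂ z)

/-- `z (κ + λ) / D`, with `κ = √(z² + b)`, `λ = √(z² + c)` and `D` the determinant. -/
def ampPlus (b c x₂ : ℝ) (z : ℂ) : ℂ := (root b z + root c z) * (ampDet b c x₂ z)⁻¹

/-- `z (κ - λ) / D`. -/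
def ampMinus (b c x₂ : ℝ) (z : ℂ) : ℂ := (root b z - root c z) * (ampDet b c x₂ z)⁻¹

/-- `z λ / D`. -/
def ampTrans (b c x₂ : ℝ) (z : ℂ) : ℂ := root c z * (ampDet b c x₂ z)⁻¹

/-- `z (λ² - κ²) (1 - e^{-2λx₂}) / (κ D)`. -/
def ampRefl (b c x₂ : ℝ) (z : ℂ) : ℂ :=
  (root c z ^ 2 - root b z ^ 2) * (1 - wellFactor c x₂ z ^ 2) * (root b z)⁻¹ * (ampDet b c x₂ z)⁻¹

/-- `z (κ - λ)² / (λ D)`. -/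
def ampInner (b c x₂ : ℝ) (z : ℂ) : ℂ :=
  (root b z - root c z) ^ 2 * (root c z)⁻¹ * (ampDet b c x₂ z)⁻¹

/-- `z (λ² - κ²) / (λ D)`. -/
def ampMixed (b c x₂ : ℝ) (z : ℂ) : ℂ :=
  (root c z ^ 2 - root b z ^ 2) * (root c z)⁻¹ * (ampDet b c x₂ z)⁻¹

section Amplitudes
variable {R b c x₂ : ℝ} (hR : 0 < R) (hb : 2 * |b| < R ^ 2) (hc : 2 * |c| < R ^ 2)
  (hx₂ : 0 ≤ x₂)
include hR hc hx₂

lemma norm_wellFactor_le_one {z : ℂ} (hz : z ∈ closedSector R) : ‖wellFactor c x₂ z‖ ≤ 1 :=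
  norm_exp_neg_mul_le_one (re_ell_nonneg hR hc hz) hx₂

omit hx₂ in
lemma continuousOn_wellFactor : ContinuousOn (wellFactor c x₂) (closedSector R) :=
  ((continuousOn_ell hR hc).mul continuousOn_const).neg.cexp

omit hx₂ in
lemma differentiableOn_wellFactor : DifferentiableOn ℂ (wellFactor c x₂) (openSector R) :=
  ((differentiableOn_ell hR hc).mul_const _).neg.cexp

lemma wellFactor_sq_isBigO_one :
    (fun z => wellFactor c x₂ z ^ 2) =O[farSector R] fun _ => (1 : ℂ) := by
  simpa [wellFactor] using (exp_ell_isBigO_one hR hc hx₂).pow 2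

include hb

/-- The determinant has no zeros in the sector: `Re(κ \bar λ) > 0` gives `|κ + λ| > |κ - λ|`. -/
lemma ampDet_ne_zero {z : ℂ} (hz : z ∈ closedSector R) : ampDet b c x₂ z ≠ 0 := by
  have b1 := re_root_pos (lt_norm_sq hR hb hz)
  have b2 := abs_im_root_lt (lt_norm_sq hR hb hz)
  have c1 := re_root_pos (lt_norm_sq hR hc hz)
  have c2 := abs_im_root_lt (lt_norm_sq hR hc hz)
  have hE := norm_wellFactor_le_one hR hc hx₂ hz
  set u := root b z
  set v := root c z
  have hre : 0 < u.re * v.re + u.im * v.im := by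
    have h1 : |u.im * v.im| < u.re * v.re := by
      rw [abs_mul]
      exact mul_lt_mul'' b2 c2 (abs_nonneg _) (abs_nonneg _)
    linarith [neg_abs_le (u.im * v.im)]
  have hlt : ‖u - v‖ ^ 2 < ‖u + v‖ ^ 2 := by
    rw [← Complex.normSq_eq_norm_sq, ← Complex.normSq_eq_norm_sq, Complex.normSq_apply,
      Complex.normSq_apply]
    simp only [Complex.sub_re, Complex.sub_im, Complex.add_re, Complex.add_im]
    linarith
  intro h0
  have h1 : (u + v) ^ 2 = (u - v) ^ 2 * wellFactor c x₂ z ^ 2 := sub_eq_zero.1 h0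
  have h2 := congrArg norm h1
  rw [norm_mul, norm_pow, norm_pow, norm_pow] at h2
  have h3 : ‖wellFactor c x₂ z‖ ^ 2 ≤ 1 := pow_le_one₀ (norm_nonneg _) hE
  nlinarith [sq_nonneg ‖u - v‖]

lemma isAmplitude_ampDet_inv : IsAmplitude R (fun z => (ampDet b c x₂ z)⁻¹) (1 / 4) := by
  have hp := (isAmplitude_root hR hb).add (isAmplitude_root hR hc)
  have hm : IsAmplitude R (fun z => (root b z - root c z) * (root b z - root c z)) 0 := by
    simpa using ((isAmplitude_root hR hb).sub (isAmplitude_root hR hc)).mul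
      ((isAmplitude_root hR hb).sub (isAmplitude_root hR hc))
  have h := (hp.mul hp).sub (hm.mul_bounded ((continuousOn_wellFactor hR hc).pow 2)
    ((differentiableOn_wellFactor hR hc).pow 2) (wellFactor_sq_isBigO_one hR hc hx₂))
  have h' : IsAmplitude R (ampDet b c x₂) 4 := by
    have := h.congr (B := ampDet b c x₂) fun z _ => by
      simp only [ampDet, dispersion, Pi.pow_apply]; ring
    convert this using 1
    norm_num
  simpa using h'.inv (by norm_num) fun z hz => ampDet_ne_zero hR hb hc hx₂ hz

lemma isAmplitude_ampPlus : ∃ m, IsAmplitude R (ampPlus b c x₂) m :=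
  ⟨_, ((isAmplitude_root hR hb).add (isAmplitude_root hR hc)).mul
    (isAmplitude_ampDet_inv hR hb hc hx₂)⟩

lemma isAmplitude_ampMinus : ∃ m, IsAmplitude R (ampMinus b c x₂) m :=
  ⟨_, ((isAmplitude_root hR hb).sub (isAmplitude_root hR hc)).mul
    (isAmplitude_ampDet_inv hR hb hc hx₂)⟩

lemma isAmplitude_ampTrans : ∃ m, IsAmplitude R (ampTrans b c x₂) m :=
  ⟨_, (isAmplitude_root hR hc).mul (isAmplitude_ampDet_inv hR hb hc hx₂)⟩

lemma isAmplitude_ampInner : ∃ m, IsAmplitude R (ampInner b c x₂) m := by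
  have hm := (isAmplitude_root hR hb).sub (isAmplitude_root hR hc)
  exact ⟨_, (((hm.mul hm).mul (isAmplitude_root_inv hR hc)).mul
    (isAmplitude_ampDet_inv hR hb hc hx₂)).congr fun z _ => by simp only [ampInner]; ring⟩

omit hx₂ in
lemma isAmplitude_root_sq_sub :
    IsAmplitude R (fun z => root c z ^ 2 - root b z ^ 2) 0 := by
  have h := ((isAmplitude_root hR hc).mul (isAmplitude_root hR hc)).sub
    ((isAmplitude_root hR hb).mul (isAmplitude_root hR hb))
  rw [one_mul, sub_self] at h
  exact h.congr fun z _ => by ring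

lemma isAmplitude_ampMixed : ∃ m, IsAmplitude R (ampMixed b c x₂) m :=
  ⟨_, ((isAmplitude_root_sq_sub hR hb hc).mul (isAmplitude_root_inv hR hc)).mul
    (isAmplitude_ampDet_inv hR hb hc hx₂)⟩

lemma isAmplitude_ampRefl : ∃ m, IsAmplitude R (ampRefl b c x₂) m :=
  ⟨_, (((isAmplitude_root_sq_sub hR hb hc).mul_bounded
    (continuousOn_const.sub ((continuousOn_wellFactor hR hc).pow 2))
    ((differentiableOn_const 1).sub ((differentiableOn_wellFactor hR hc).pow 2))
    ((Asymptotics.isBigO_refl _ _).sub (wellFactor_sq_isBigO_one hR hc hx₂))).mul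
    (isAmplitude_root_inv hR hb)).mul (isAmplitude_ampDet_inv hR hb hc hx₂)⟩

end Amplitudes

/-! ### Evaluation of the contour integrals -/

/-- The integrands of the solution formulas: `A e^{-pκ - qλ} ĝ(√(z² + a)) e^{iζt}` with
`κ = √(z² + b)`, `λ = √(z² + c)`, `ζ = z² + b`, and `ĝ` the Laplace transform. -/
def mode (A : ℂ → ℂ) (a b c p q t : ℝ) (g : ℝ → ℂ) (z : ℂ) : ℂ :=
  A z * exp (-(ell b z * p + ell c z * q)) * lap g (ell a z) * exp (I * (z ^ 2 + b) * t)

section Evaluation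
variable {R : ℝ} (hR : 0 < R) {T t : ℝ} (ht : t ∈ Set.Ioo 0 T)
include hR ht

/-- Data at the final time do not contribute to the contour integrals. -/
theorem exists_hasIntegralD4_mode {a b c p q : ℝ} (ha : 2 * |a| < R ^ 2) (hb : 2 * |b| < R ^ 2)
    (hc : 2 * |c| < R ^ 2) {A : ℂ → ℂ} (hA : ∃ m, IsAmplitude R A m) (k : ℂ) (hpq : 0 < p + q)
    {g h : ℝ → ℂ} (hg : IntegrableOn g (Set.Ioi 0)) (hh : IntegrableOn h (Set.Ioi 0))
    (hdec : HasLapDecay g) :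
    ∃ J, HasIntegralD4 R (mode (fun z => k * A z) a b c p q t g) J ∧
      HasSymmIntegral R (fun z => mode (fun z => k * A z) a b c p q t
        (fun y => g y - exp (-(I * (z ^ 2 + b) * T)) * h y) z) J := by
  obtain ⟨m, hA⟩ := hA
  have hA1 := ((hA.const_mul k).mul (isAmplitude_exp_ell_sub hR ha hb p)).mul
    (isAmplitude_exp_ell_sub hR ha hc q)
  have hA2 := fun s : ℝ => hA1.const_mul (exp (I * b * s))
  have e : ∀ (s : ℝ) (g : ℝ → ℂ) (z : ℂ), term a (fun z => exp (I * b * s) * (k * A z *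
      exp (p * (ell a z - ell b z)) * exp (q * (ell a z - ell c z)))) (p + q) g s z
      = mode (fun z => k * A z) a b c p q s g z := by
    intro s g z
    have e1 : exp (-(ell b z * p + ell c z * q)) = exp (p * (ell a z - ell b z)) *
        exp (q * (ell a z - ell c z)) * exp (-(ell a z * (p + q : ℝ))) := by
      rw [← Complex.exp_add, ← Complex.exp_add]; push_cast; ring_nf
    have e2 : exp (I * (z ^ 2 + b) * s) = exp (I * b * s) * exp (I * z ^ 2 * s) := by
      rw [← Complex.exp_add]; ring_nf
    rw [mode, term, e1, e2]
    ring
  obtain ⟨J, hJ⟩ := exists_hasIntegralD4_term hR ha hg (hA2 t) hdec hpq ht.1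
  have hJ' := hJ.hasSymmIntegral (continuousOn_term hR ha hg (hA2 t))
  have h0 := hasSymmIntegral_term_zero hR ha hh (hA2 (t - T)) hpq.le (sub_neg.2 ht.2)
  have hsub := hJ'.sub hR h0
  rw [sub_zero] at hsub
  refine ⟨J, hJ.congr hR fun z _ => (e t g z).symm, hsub.congr hR fun z hz => ?_⟩
  have hre := re_ell_nonneg hR ha hz
  have e3 : lap (fun y => g y - exp (-(I * (z ^ 2 + b) * T)) * h y) (ell a z)
      = lap g (ell a z) - exp (-(I * (z ^ 2 + b) * T)) * lap h (ell a z) := by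
    simp only [lap]
    rw [← integral_const_mul, ← integral_sub (integrableOn_lap hg hre)
      ((integrableOn_lap hh hre).const_mul _)]
    exact integral_congr_ae (ae_of_all _ fun y => by ring)
  have e4 : exp (I * (z ^ 2 + b) * (t - T : ℝ))
      = exp (-(I * (z ^ 2 + b) * T)) * exp (I * (z ^ 2 + b) * t) := by
    rw [← Complex.exp_add]; push_cast; ring_nf
  simp only [e]
  rw [mode, mode, mode, e3, e4]
  ring

/-- The part of the solution that stems from the data of the region itself is the free evolution
of these data. -/
theorem exists_hasLineIntegral_region {a b : ℝ} (ha : 2 * |a| < R ^ 2) {G H : ℝ → ℂ}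
    (hG : Integrable G) (hH : Integrable H) :
    ∃ F, HasLineIntegral (fun k : ℝ => exp (-(I * (a - b + k ^ 2) * t)) *
        ∫ y : ℝ, exp (I * k * y) * G y) F ∧
      HasSymmIntegral R (fun z => mode (fun z => (root a z)⁻¹) a b b 0 0 t
        (fun y => (G y - exp (-(I * (z ^ 2 + b) * T)) * H y)
          + (G (-y) - exp (-(I * (z ^ 2 + b) * T)) * H (-y))) z) (-I * F) := by
  obtain ⟨F, hF, hS⟩ := exists_hasLineIntegral_free hR ha ht.1 hG
  have hG' : IntegrableOn (fun y => G y + G (-y)) (Set.Ioi 0) := (hG.add hG.comp_neg).integrableOn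
  have hH' : IntegrableOn (fun y => H y + H (-y)) (Set.Ioi 0) := (hH.add hH.comp_neg).integrableOn
  have h0 := hasSymmIntegral_term_zero hR ha hH' (isAmplitude_root_inv hR ha) le_rfl
    (sub_neg.2 ht.2)
  have hsub := (hS.const_mul (exp (I * b * t))).sub hR (h0.const_mul (exp (I * b * (t - T : ℝ))))
  rw [mul_zero, sub_zero] at hsub
  refine ⟨exp (-(I * (a - b) * t)) * F, ?_, ?_⟩
  · refine (hF.const_mul (exp (-(I * (a - b) * t)))).congr fun c => ?_
    rw [← intervalIntegral.integral_const_mul]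
    refine intervalIntegral.integral_congr fun k _ => ?_
    simp only [← mul_assoc, ← Complex.exp_add]
    ring_nf
  have ev : exp (I * b * t) * (-I * exp (-(I * a * t)) * F)
      = -I * (exp (-(I * (a - b) * t)) * F) := by
    have : exp (-(I * (a - b) * t)) = exp (I * b * t) * exp (-(I * a * t)) := by
      rw [← Complex.exp_add]; ring_nf
    rw [this]; ring
  rw [ev] at hsub
  refine hsub.congr hR fun z hz => ?_
  have hre := re_ell_nonneg hR ha hz
  have e3 : lap (fun y => (G y - exp (-(I * (z ^ 2 + b) * T)) * H y)
          + (G (-y) - exp (-(I * (z ^ 2 + b) * T)) * H (-y))) (ell a z)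
      = lap (fun y => G y + G (-y)) (ell a z)
        - exp (-(I * (z ^ 2 + b) * T)) * lap (fun y => H y + H (-y)) (ell a z) := by
    simp only [lap]
    rw [← integral_const_mul, ← integral_sub (integrableOn_lap hG' hre)
      ((integrableOn_lap hH' hre).const_mul _)]
    exact integral_congr_ae (ae_of_all _ fun y => by ring)
  have e4 : exp (I * b * (t - T : ℝ)) * exp (I * z ^ 2 * (t - T : ℝ))
      = exp (-(I * (z ^ 2 + b) * T)) * exp (I * (z ^ 2 + b) * t) := by
    rw [← Complex.exp_add, ← Complex.exp_add]; push_cast; ring_nf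
  have e5 : exp (I * (z ^ 2 + b) * t) = exp (I * b * t) * exp (I * z ^ 2 * t) := by
    rw [← Complex.exp_add]; ring_nf
  simp only [mode, term, e3, Complex.ofReal_zero, mul_zero, add_zero, neg_zero, Complex.exp_zero,
    mul_one, one_mul]
  linear_combination (root a z)⁻¹ * (lap (fun y => G y + G (-y)) (ell a z) * e5
    + lap (fun y => H y + H (-y)) (ell a z) * e4)

lemma hasSymmIntegral_timeTransform {u : ℝ → ℝ → ℂ} {x : ℝ} (b : ℝ)
    (hu : ContinuousOn (u x) (Set.Icc 0 T)) (hd : DifferentiableAt ℝ (u x) t) :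
    HasSymmIntegral R (fun z => z * (timeTransform T (z ^ 2 + b) u x *
      exp (I * (z ^ 2 + b) * t))) (-(Real.pi * u x t)) := by
  have h := (hasSymmIntegral_laplace_inversion hR ht (f := fun τ => exp (-(I * b * τ)) * u x τ)
    ((Continuous.continuousOn (by fun_prop)).mul hu)
    ((by fun_prop : DifferentiableAt ℝ (fun τ : ℝ => exp (-(I * b * τ))) t).mul hd)).const_mul
      (exp (I * b * t))
  have e : exp (I * b * t) * exp (-(I * b * t)) = 1 := by rw [← Complex.exp_add]; simp
  rw [show exp (I * b * t) * -(Real.pi * (exp (-(I * b * t)) * u x t)) = -(Real.pi * u x t) by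
    linear_combination -(Real.pi * u x t) * e] at h
  refine h.congr hR fun z _ => ?_
  simp only [timeTransform]
  rw [mul_left_comm (exp (I * b * t)), ← intervalIntegral.integral_const_mul,
    ← intervalIntegral.integral_mul_const]
  congr 1
  refine intervalIntegral.integral_congr fun τ _ => ?_
  simp only [mul_right_comm _ (u x τ), ← mul_assoc, ← Complex.exp_add]
  ring_nf

end Evaluation

/-! ### The solution as a sum of contour integrals -/

lemma indicator_endData (s : Set ℝ) (T : ℝ) (ζ : ℂ) (ψ : ℝ → ℝ → ℂ) :
    s.indicator (endData T ζ ψ) = fun y => s.indicator (fun x => ψ x 0) y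
      - exp (-(I * ζ * T)) * s.indicator (fun x => ψ x T) y := by
  ext y
  by_cases hy : y ∈ s <;> simp [hy, endData]

lemma indicator_reflect_endData (s : Set ℝ) (x T : ℝ) (ζ : ℂ) (ψ : ℝ → ℝ → ℂ) :
    (s.indicator fun y => endData T ζ ψ (x - y)) = fun y => s.indicator (fun y => ψ (x - y) 0) y
      - exp (-(I * ζ * T)) * s.indicator (fun y => ψ (x - y) T) y := by
  ext y
  by_cases hy : y ∈ s <;> simp [hy, endData]

section Algebra
variable {z u v D E X Y U A M P C L k l α : ℂ} (hz : z ≠ 0) (hu : u ≠ 0) (hv : v ≠ 0) (hD : D ≠ 0)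
  (hk : k = z * u) (hl : l = z * v) (hα : α = z ^ 2 * (v ^ 2 - u ^ 2))
include hz hD hk hl hα

include hu in
/-- Elimination of the factors `z` from `timeTransform_left` and `timeTransform_right`. -/
lemma cancel_outer (key : z ^ 2 * D * (2 * k * U) = I * (X * (α * (1 - E ^ 2) * A
      - 2 * k * (k + l) * M + 2 * k * (k - l) * E * P - 4 * k * l * E * C) - z ^ 2 * D * L)) :
    z * U = I / 2 * (X * ((v ^ 2 - u ^ 2) * (1 - E ^ 2) * u⁻¹ * D⁻¹ * A - 2 * ((u + v) * D⁻¹) * M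
      + 2 * ((u - v) * D⁻¹) * E * P - 4 * (v * D⁻¹) * E * C) - u⁻¹ * L) := by
  subst hk hl hα
  field_simp
  refine mul_left_cancel₀ (pow_ne_zero 2 hz) ?_
  linear_combination key

include hv in
/-- Elimination of the factors `z` from `timeTransform_middle`. -/
lemma cancel_inner (key : z ^ 2 * D * (2 * l * U) = I * (X * (2 * l * (k - l) * E * A
      - (k - l) ^ 2 * E * M - α * P - 2 * l * (k + l) * C) - Y * (2 * l * (k + l) * A
      + α * M + (k - l) ^ 2 * E * P - 2 * l * (k - l) * E * C) - z ^ 2 * D * L)) :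
    z * U = I / 2 * (X * (2 * ((u - v) * D⁻¹) * E * A - (u - v) ^ 2 * v⁻¹ * D⁻¹ * E * M
      - (v ^ 2 - u ^ 2) * v⁻¹ * D⁻¹ * P - 2 * ((u + v) * D⁻¹) * C)
      - Y * (2 * ((u + v) * D⁻¹) * A + (v ^ 2 - u ^ 2) * v⁻¹ * D⁻¹ * M
      + (u - v) ^ 2 * v⁻¹ * D⁻¹ * E * P - 2 * ((u - v) * D⁻¹) * E * C) - v⁻¹ * L) := by
  subst hk hl hα
  field_simp
  refine mul_left_cancel₀ (pow_ne_zero 2 hz) ?_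
  linear_combination key

end Algebra

section Amp
variable {R b c x₂ : ℝ} (hR : 0 < R) (hb : 2 * |b| < R ^ 2) (hc : 2 * |c| < R ^ 2)
  (hx₂ : 0 < x₂) {α : ℝ} (hbc : c = b + α) {z : ℂ} (hz : z ∈ closedSector R)

lemma dispersion_ell : dispersion (ell b z) (ell c z) (exp (-(ell c z * x₂)))
    = z ^ 2 * ampDet b c x₂ z := by
  rw [ampDet, wellFactor, dispersion, dispersion, ell, ell]; ring

include hR hbc hz

lemma ell_sq_eq_add : ell c z ^ 2 = z ^ 2 + b + α := by
  rw [ell_sq (ne_zero_of_mem hR hz), hbc]; push_cast; ring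

lemma eq_mul_root_sq_sub : (α : ℂ) = z ^ 2 * (root c z ^ 2 - root b z ^ 2) := by
  have hl := ell_sq_eq_add hR hbc hz
  have h1 := ell_sq (a := b) (ne_zero_of_mem hR hz)
  rw [ell] at hl h1
  linear_combination h1 - hl

variable {ψ₀ : ℝ → ℂ} {ψ : ℝ → ℝ → ℂ} (hψ : IsSolution α x₂ ψ₀ ψ) (hψ₀ : Integrable ψ₀)
  {T : ℝ} (hT : 0 < T)
include hb hc hx₂ hψ hψ₀ hT

lemma timeTransform_left_eq {x : ℝ} (hx : x < 0) :
    z * timeTransform T (z ^ 2 + b) ψ x = I / 2 * (exp (ell b z * x) *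
      (ampRefl b c x₂ z * lap (fun y => endData T (z ^ 2 + b) ψ (-y)) (ell b z)
      - 2 * ampPlus b c x₂ z * lap ((Set.Iic x₂).indicator (endData T (z ^ 2 + b) ψ)) (ell c z)
      + 2 * ampMinus b c x₂ z * wellFactor c x₂ z *
        lap ((Set.Iic x₂).indicator fun y => endData T (z ^ 2 + b) ψ (x₂ - y)) (ell c z)
      - 4 * ampTrans b c x₂ z * wellFactor c x₂ z *
        lap (fun y => endData T (z ^ 2 + b) ψ (x₂ + y)) (ell b z))
      - (root b z)⁻¹ * lap (fun y => (Set.Iic 0).indicator (endData T (z ^ 2 + b) ψ) (x - y)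
          + (Set.Iic 0).indicator (endData T (z ^ 2 + b) ψ) (x - -y)) (ell b z)) := by
  have hz0 := ne_zero_of_mem hR hz
  have hrb := root_ne_zero (lt_norm_sq hR hb hz)
  have hD := ampDet_ne_zero hR hb hc hx₂.le hz
  have key := timeTransform_left hψ hx₂ hψ₀ hT (ell_sq hz0) (ell_sq_eq_add hR hbc hz)
    (re_ell_nonneg hR hb hz) hx
  rw [dispersion_ell] at key
  exact cancel_outer hz0 hrb hD rfl rfl (eq_mul_root_sq_sub hR hbc hz) key

lemma timeTransform_right_eq {x : ℝ} (hx : x₂ < x) :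
    z * timeTransform T (z ^ 2 + b) ψ x = I / 2 * (exp (-(ell b z * (x - x₂))) *
      (ampRefl b c x₂ z * lap (fun y => endData T (z ^ 2 + b) ψ (x₂ + y)) (ell b z)
      - 2 * ampPlus b c x₂ z *
        lap ((Set.Iic x₂).indicator fun y => endData T (z ^ 2 + b) ψ (x₂ - y)) (ell c z)
      + 2 * ampMinus b c x₂ z * wellFactor c x₂ z *
        lap ((Set.Iic x₂).indicator (endData T (z ^ 2 + b) ψ)) (ell c z)
      - 4 * ampTrans b c x₂ z * wellFactor c x₂ z *
        lap (fun y => endData T (z ^ 2 + b) ψ (-y)) (ell b z))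
      - (root b z)⁻¹ * lap (fun y => (Set.Ioi x₂).indicator (endData T (z ^ 2 + b) ψ) (x - y)
          + (Set.Ioi x₂).indicator (endData T (z ^ 2 + b) ψ) (x - -y)) (ell b z)) := by
  have hz0 := ne_zero_of_mem hR hz
  have hrb := root_ne_zero (lt_norm_sq hR hb hz)
  have hD := ampDet_ne_zero hR hb hc hx₂.le hz
  have key := timeTransform_right hψ hx₂ hψ₀ hT (ell_sq hz0) (ell_sq_eq_add hR hbc hz)
    (re_ell_nonneg hR hb hz) hx
  rw [dispersion_ell] at key
  exact cancel_outer hz0 hrb hD rfl rfl (eq_mul_root_sq_sub hR hbc hz) key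

lemma timeTransform_middle_eq {x : ℝ} (hx : 0 < x) (hx' : x < x₂) :
    z * timeTransform T (z ^ 2 + b) ψ x = I / 2 * (exp (-(ell c z * (x₂ - x))) *
      (2 * ampMinus b c x₂ z * wellFactor c x₂ z *
        lap (fun y => endData T (z ^ 2 + b) ψ (-y)) (ell b z)
      - ampInner b c x₂ z * wellFactor c x₂ z *
        lap ((Set.Iic x₂).indicator (endData T (z ^ 2 + b) ψ)) (ell c z)
      - ampMixed b c x₂ z *
        lap ((Set.Iic x₂).indicator fun y => endData T (z ^ 2 + b) ψ (x₂ - y)) (ell c z)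
      - 2 * ampPlus b c x₂ z * lap (fun y => endData T (z ^ 2 + b) ψ (x₂ + y)) (ell b z))
      - exp (-(ell c z * x)) *
      (2 * ampPlus b c x₂ z * lap (fun y => endData T (z ^ 2 + b) ψ (-y)) (ell b z)
      + ampMixed b c x₂ z * lap ((Set.Iic x₂).indicator (endData T (z ^ 2 + b) ψ)) (ell c z)
      + ampInner b c x₂ z * wellFactor c x₂ z *
        lap ((Set.Iic x₂).indicator fun y => endData T (z ^ 2 + b) ψ (x₂ - y)) (ell c z)
      - 2 * ampMinus b c x₂ z * wellFactor c x₂ z *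
        lap (fun y => endData T (z ^ 2 + b) ψ (x₂ + y)) (ell b z))
      - (root c z)⁻¹ * lap (fun y => (Set.Ioc 0 x₂).indicator (endData T (z ^ 2 + b) ψ) (x - y)
          + (Set.Ioc 0 x₂).indicator (endData T (z ^ 2 + b) ψ) (x - -y)) (ell c z)) := by
  have hz0 := ne_zero_of_mem hR hz
  have hrc := root_ne_zero (lt_norm_sq hR hc hz)
  have hD := ampDet_ne_zero hR hb hc hx₂.le hz
  have key := timeTransform_middle hψ hx₂ hψ₀ hT (ell_sq hz0) (ell_sq_eq_add hR hbc hz)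
    (re_ell_nonneg hR hb hz) (re_ell_nonneg hR hc hz) hx hx'
  rw [dispersion_ell] at key
  exact cancel_inner hz0 hrc hD rfl rfl (eq_mul_root_sq_sub hR hbc hz) key

end Amp

section Datum
variable {f : ℝ → ℂ} (hd : Differentiable ℝ f)
include hd

lemma hasLapDecay_comp_neg (hi : Integrable f) (hi' : Integrable (deriv f)) :
    HasLapDecay fun y => f (-y) :=
  hasLapDecay_of_differentiable (hd.comp differentiable_neg) hi.comp_neg.integrableOn (by
    rw [funext fun y => deriv_comp_neg f y]
    exact hi'.comp_neg.neg.integrableOn)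

lemma hasLapDecay_comp_const_add (hi : Integrable f) (hi' : Integrable (deriv f)) (x : ℝ) :
    HasLapDecay fun y => f (x + y) :=
  hasLapDecay_of_differentiable (hd.comp (by fun_prop)) (hi.comp_add_left x).integrableOn (by
    rw [funext fun y => deriv_comp_const_add f x y]
    exact (hi'.comp_add_left x).integrableOn)

lemma hasLapDecay_indicator_comp_const_sub (hi' : Integrable (deriv f)) {x : ℝ} (hx : 0 ≤ x) :
    HasLapDecay ((Set.Iic x).indicator fun y => f (x - y)) :=
  hasLapDecay_indicator (g := fun y => f (x - y)) (hd.comp (by fun_prop)) (by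
    rw [funext fun y => deriv_comp_const_sub f x y]
    exact (hi'.comp_sub_left x).neg) hx

end Datum

/-- The Fourier integral of data on `s`, seen from `x`. -/
lemma integral_exp_mul_indicator {s : Set ℝ} (hs : MeasurableSet s) (f : ℝ → ℂ) (x : ℝ) (k : ℂ) :
    ∫ y : ℝ, exp (I * k * y) * s.indicator f (x - y)
      = exp (I * k * x) * ∫ u in s, exp (-(I * k * u)) * f u := by
  rw [← integral_sub_left_eq_self _ volume x, ← integral_const_mul, ← integral_indicator hs]
  refine integral_congr_ae (ae_of_all _ fun u => ?_)
  by_cases hu : u ∈ s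
  · simp only [sub_sub_cancel, Set.indicator_of_mem hu, ← mul_assoc, ← Complex.exp_add]
    push_cast
    ring_nf
  · simp [hu]

section Regions
variable {R b c x₂ : ℝ} (hR : 0 < R) (hb : 2 * |b| < R ^ 2) (hc : 2 * |c| < R ^ 2)
  (hx₂ : 0 < x₂) {α : ℝ} (hbc : c = b + α) {ψ₀ : ℝ → ℂ} {ψ : ℝ → ℝ → ℂ}
  (hψ : IsSolution α x₂ ψ₀ ψ) (hψ₀ : IsInitialDatum ψ₀) {T t : ℝ} (ht : t ∈ Set.Ioo 0 T)
include hR hψ ht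

/-- A representation of the transformed solution by functions whose contour integrals are known
gives a representation of the solution. -/
lemma solution_eq {x : ℝ} (h0 : x ≠ 0) (h2 : x ≠ x₂) {f g : ℂ → ℂ} {v F : ℂ}
    (hf : HasSymmIntegral R f v) (hg : HasSymmIntegral R g (-I * F))
    (h : ∀ z ∈ closedSector R, -(1 / Real.pi) * (z * (timeTransform T (z ^ 2 + b) ψ x *
      exp (I * (z ^ 2 + b) * t))) = f z + I / (2 * Real.pi) * g z) :
    ψ x t = 1 / (2 * Real.pi) * F + v := by
  have hpi : (Real.pi : ℂ) ≠ 0 := by exact_mod_cast Real.pi_ne_zero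
  have hU := (hasSymmIntegral_timeTransform hR ht b (continuousOn_section hψ.continuousOn x)
    (hψ.differentiableAt_t x t h0 h2 ht.1)).const_mul (-(1 / Real.pi))
  have h := hU.unique ((hf.add hR (hg.const_mul (I / (2 * Real.pi)))).congr hR h)
  have e : (-(1 / Real.pi) * -(Real.pi * ψ x t) : ℂ) = ψ x t := by field_simp
  rw [e] at h
  rw [h]
  linear_combination (-F / (2 * Real.pi)) * Complex.I_sq

include hψ₀

lemma exists_hasLineIntegral_restrict {s : Set ℝ} (hs : MeasurableSet s) (x β : ℝ) {a : ℝ}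
    (ha : 2 * |a| < R ^ 2) (hab : a = b + β) : ∃ F,
    HasLineIntegral (fun k : ℝ => exp (I * k * x - ω β k * t) *
      ∫ u in s, exp (-(I * k * u)) * ψ₀ u) F ∧
    HasSymmIntegral R (fun z => mode (fun z => (root a z)⁻¹) a b b 0 0 t
      (fun y => s.indicator (endData T (z ^ 2 + b) ψ) (x - y)
        + s.indicator (endData T (z ^ 2 + b) ψ) (x - -y)) z) (-I * F) := by
  obtain rfl : (fun y => ψ y 0) = ψ₀ := funext hψ.initial
  have hiT := hψ.integrable T (ht.1.trans ht.2)
  obtain ⟨F, hF, hF'⟩ := exists_hasLineIntegral_region hR ht (b := b) ha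
    ((hψ₀.integrable.indicator hs).comp_sub_left x) ((hiT.indicator hs).comp_sub_left x)
  refine ⟨F, ?_, ?_⟩
  · refine hF.congr fun c => intervalIntegral.integral_congr fun k _ => ?_
    simp only [ω]
    rw [integral_exp_mul_indicator hs, ← mul_assoc, ← Complex.exp_add, hab]
    push_cast
    ring_nf
  · simpa only [indicator_endData] using hF'

include hb hc
variable {A : ℂ → ℂ} (hA : ∃ m, IsAmplitude R A m) (k : ℂ) {p q : ℝ} (hpq : 0 < p + q)
include hA hpq

lemma exists_mode_left : ∃ J,
    HasIntegralD4 R (mode (fun z => k * A z) b b c p q t fun y => ψ₀ (-y)) J ∧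
    HasSymmIntegral R (fun z => mode (fun z => k * A z) b b c p q t
      (fun y => endData T (z ^ 2 + b) ψ (-y)) z) J := by
  obtain rfl : (fun y => ψ y 0) = ψ₀ := funext hψ.initial
  have hiT := hψ.integrable T (ht.1.trans ht.2)
  exact exists_hasIntegralD4_mode hR ht hb hb hc hA k hpq
    hψ₀.integrable.comp_neg.integrableOn hiT.comp_neg.integrableOn
    (hasLapDecay_comp_neg hψ₀.differentiable hψ₀.integrable hψ₀.integrable_deriv)

lemma exists_mode_right : ∃ J,
    HasIntegralD4 R (mode (fun z => k * A z) b b c p q t fun y => ψ₀ (x₂ + y)) J ∧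
    HasSymmIntegral R (fun z => mode (fun z => k * A z) b b c p q t
      (fun y => endData T (z ^ 2 + b) ψ (x₂ + y)) z) J := by
  obtain rfl : (fun y => ψ y 0) = ψ₀ := funext hψ.initial
  have hiT := hψ.integrable T (ht.1.trans ht.2)
  exact exists_hasIntegralD4_mode hR ht hb hb hc hA k hpq
    (hψ₀.integrable.comp_add_left x₂).integrableOn (hiT.comp_add_left x₂).integrableOn
    (hasLapDecay_comp_const_add hψ₀.differentiable hψ₀.integrable hψ₀.integrable_deriv x₂)

include hx₂

lemma exists_mode_middle : ∃ J,
    HasIntegralD4 R (mode (fun z => k * A z) c b c p q t ((Set.Iic x₂).indicator ψ₀)) J ∧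
    HasSymmIntegral R (fun z => mode (fun z => k * A z) c b c p q t
      ((Set.Iic x₂).indicator (endData T (z ^ 2 + b) ψ)) z) J := by
  obtain rfl : (fun y => ψ y 0) = ψ₀ := funext hψ.initial
  have hiT := hψ.integrable T (ht.1.trans ht.2)
  simp only [indicator_endData]
  exact exists_hasIntegralD4_mode hR ht hc hb hc hA k hpq
    (hψ₀.integrable.indicator measurableSet_Iic).integrableOn
    (hiT.indicator measurableSet_Iic).integrableOn
    (hasLapDecay_indicator hψ₀.differentiable hψ₀.integrable_deriv hx₂.le)

lemma exists_mode_middle_reflect : ∃ J,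
    HasIntegralD4 R (mode (fun z => k * A z) c b c p q t
      ((Set.Iic x₂).indicator fun y => ψ₀ (x₂ - y))) J ∧
    HasSymmIntegral R (fun z => mode (fun z => k * A z) c b c p q t
      ((Set.Iic x₂).indicator fun y => endData T (z ^ 2 + b) ψ (x₂ - y)) z) J := by
  obtain rfl : (fun y => ψ y 0) = ψ₀ := funext hψ.initial
  have hiT := hψ.integrable T (ht.1.trans ht.2)
  simp only [indicator_reflect_endData]
  exact exists_hasIntegralD4_mode hR ht hc hb hc hA k hpq
    ((hψ₀.integrable.comp_sub_left x₂).indicator measurableSet_Iic).integrableOn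
    ((hiT.comp_sub_left x₂).indicator measurableSet_Iic).integrableOn
    (hasLapDecay_indicator_comp_const_sub hψ₀.differentiable hψ₀.integrable_deriv hx₂.le)

end Regions

section Solution
variable {R b c x₂ : ℝ} (hR : 0 < R) (hb : 2 * |b| < R ^ 2) (hc : 2 * |c| < R ^ 2)
  (hx₂ : 0 < x₂) {α : ℝ} (hbc : c = b + α) {ψ₀ : ℝ → ℂ} {ψ : ℝ → ℝ → ℂ}
  (hψ : IsSolution α x₂ ψ₀ ψ) (hψ₀ : IsInitialDatum ψ₀) {t : ℝ} (ht : 0 < t)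
include hR hb hc hx₂ hbc hψ hψ₀ ht

/-- The solution to the left of the well. The reference level `b` is free: the integration variable
is `z = √(ζ - b)`, where `ζ` is the dual variable of time. With `b = 0` this is `κ`, with `b = -α`
it is a rotation of the wave number inside the well. -/
theorem solution_left {x : ℝ} (hx : x < 0) : ∃ F J₁ J₂ J₃ J₄ : ℂ,
    HasLineIntegral (fun k => exp (I * k * x - ω 0 k * t) * hat₁ ψ₀ k) F ∧
    HasIntegralD4 R (mode (fun z => -I / (2 * Real.pi) * ampRefl b c x₂ z) b b c (-x) 0 t
      fun y => ψ₀ (-y)) J₁ ∧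
    HasIntegralD4 R (mode (fun z => -I / Real.pi * ampPlus b c x₂ z) c b c (-x) 0 t
      ((Set.Iic x₂).indicator ψ₀)) J₂ ∧
    HasIntegralD4 R (mode (fun z => -I / Real.pi * ampMinus b c x₂ z) c b c (-x) x₂ t
      ((Set.Iic x₂).indicator fun y => ψ₀ (x₂ - y))) J₃ ∧
    HasIntegralD4 R (mode (fun z => -2 * I / Real.pi * ampTrans b c x₂ z) b b c (-x) x₂ t
      fun y => ψ₀ (x₂ + y)) J₄ ∧
    ψ x t = 1 / (2 * Real.pi) * F + J₁ - J₂ + J₃ - J₄ := by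
  -- Any final time beyond `t` will do.
  have htT : t ∈ Set.Ioo 0 (t + 1) := ⟨ht, by simp⟩
  have hX : 0 < -x := by linarith
  obtain ⟨J₁, h1, h1'⟩ := exists_mode_left hR hb hc hψ hψ₀ htT (isAmplitude_ampRefl hR hb hc hx₂.le)
    (-I / (2 * Real.pi)) (p := -x) (q := 0) (by simpa using hX)
  obtain ⟨J₂, h2, h2'⟩ := exists_mode_middle hR hb hc hx₂ hψ hψ₀ htT
    (isAmplitude_ampPlus hR hb hc hx₂.le) (-I / Real.pi) (p := -x) (q := 0) (by simpa using hX)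
  obtain ⟨J₃, h3, h3'⟩ := exists_mode_middle_reflect hR hb hc hx₂ hψ hψ₀ htT
    (isAmplitude_ampMinus hR hb hc hx₂.le) (-I / Real.pi) (p := -x) (q := x₂) (add_pos hX hx₂)
  obtain ⟨J₄, h4, h4'⟩ := exists_mode_right hR hb hc hψ hψ₀ htT
    (isAmplitude_ampTrans hR hb hc hx₂.le) (-2 * I / Real.pi) (p := -x) (q := x₂) (add_pos hX hx₂)
  obtain ⟨F, hF, hF'⟩ := exists_hasLineIntegral_restrict hR hψ hψ₀ htT
    (measurableSet_Iic (a := (0 : ℝ))) x 0 hb (by ring)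
  refine ⟨F, J₁, J₂, J₃, J₄, hF, h1, h2, h3, h4, ?_⟩
  rw [solution_eq hR hψ htT (b := b) hx.ne (hx.trans hx₂).ne
    (((h1'.sub hR h2').add hR h3').sub hR h4') hF' fun z hz => ?_]
  · ring
  have key := timeTransform_left_eq hR hb hc hx₂ hbc hz hψ hψ₀.integrable (ht.trans htT.2) hx
  have e1 : exp (-(ell b z * (-x : ℝ) + ell c z * (0 : ℝ))) = exp (ell b z * x) := by
    push_cast; ring_nf
  have e2 : exp (-(ell b z * (-x : ℝ) + ell c z * x₂)) = exp (ell b z * x) * wellFactor c x₂ z := by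
    rw [wellFactor, ← Complex.exp_add]; push_cast; ring_nf
  have e3 : exp (-(ell b z * (0 : ℝ) + ell b z * (0 : ℝ))) = 1 := by simp
  simp only [mode, e1, e2, e3]
  linear_combination (-(1 / Real.pi) * exp (I * (z ^ 2 + b) * t)) * key

/-- The solution to the right of the well, with a free reference level `b`. -/
theorem solution_right {x : ℝ} (hx : x₂ < x) : ∃ F J₁ J₂ J₃ J₄ : ℂ,
    HasLineIntegral (fun k => exp (I * k * x - ω 0 k * t) * hat₃ x₂ ψ₀ k) F ∧
    HasIntegralD4 R (mode (fun z => -2 * I / Real.pi * ampTrans b c x₂ z) b b c (x - x₂) x₂ t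
      fun y => ψ₀ (-y)) J₁ ∧
    HasIntegralD4 R (mode (fun z => -I / Real.pi * ampMinus b c x₂ z) c b c (x - x₂) x₂ t
      ((Set.Iic x₂).indicator ψ₀)) J₂ ∧
    HasIntegralD4 R (mode (fun z => -I / Real.pi * ampPlus b c x₂ z) c b c (x - x₂) 0 t
      ((Set.Iic x₂).indicator fun y => ψ₀ (x₂ - y))) J₃ ∧
    HasIntegralD4 R (mode (fun z => -I / (2 * Real.pi) * ampRefl b c x₂ z) b b c (x - x₂) 0 t
      fun y => ψ₀ (x₂ + y)) J₄ ∧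
    ψ x t = 1 / (2 * Real.pi) * F - J₁ + J₂ - J₃ + J₄ := by
  have htT : t ∈ Set.Ioo 0 (t + 1) := ⟨ht, by simp⟩
  have hX : 0 < x - x₂ := by linarith
  obtain ⟨J₁, h1, h1'⟩ := exists_mode_left hR hb hc hψ hψ₀ htT
    (isAmplitude_ampTrans hR hb hc hx₂.le) (-2 * I / Real.pi) (add_pos hX hx₂)
  obtain ⟨J₂, h2, h2'⟩ := exists_mode_middle hR hb hc hx₂ hψ hψ₀ htT
    (isAmplitude_ampMinus hR hb hc hx₂.le) (-I / Real.pi) (add_pos hX hx₂)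
  obtain ⟨J₃, h3, h3'⟩ := exists_mode_middle_reflect hR hb hc hx₂ hψ hψ₀ htT
    (isAmplitude_ampPlus hR hb hc hx₂.le) (-I / Real.pi) (p := x - x₂) (q := 0) (by simpa using hX)
  obtain ⟨J₄, h4, h4'⟩ := exists_mode_right hR hb hc hψ hψ₀ htT
    (isAmplitude_ampRefl hR hb hc hx₂.le) (-I / (2 * Real.pi)) (p := x - x₂) (q := 0)
    (by simpa using hX)
  obtain ⟨F, hF, hF'⟩ := exists_hasLineIntegral_restrict hR hψ hψ₀ htT
    (measurableSet_Ioi (a := x₂)) x 0 hb (by ring)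
  refine ⟨F, J₁, J₂, J₃, J₄, hF, h1, h2, h3, h4, ?_⟩
  rw [solution_eq hR hψ htT (b := b) (hx₂.trans hx).ne' hx.ne'
    (((h2'.sub hR h1').sub hR h3').add hR h4') hF' fun z hz => ?_]
  · ring
  have key := timeTransform_right_eq hR hb hc hx₂ hbc hz hψ hψ₀.integrable (ht.trans htT.2) hx
  have e1 : exp (-(ell b z * (x - x₂ : ℝ) + ell c z * (0 : ℝ))) = exp (-(ell b z * (x - x₂))) := by
    push_cast; ring_nf
  have e2 : exp (-(ell b z * (x - x₂ : ℝ) + ell c z * x₂))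
      = exp (-(ell b z * (x - x₂))) * wellFactor c x₂ z := by
    rw [wellFactor, ← Complex.exp_add]; push_cast; ring_nf
  have e3 : exp (-(ell b z * (0 : ℝ) + ell b z * (0 : ℝ))) = 1 := by simp
  simp only [mode, e1, e2, e3]
  linear_combination (-(1 / Real.pi) * exp (I * (z ^ 2 + b) * t)) * key

/-- The solution inside the well, with a free reference level `b`. -/
theorem solution_middle {x : ℝ} (hx : 0 < x) (hx' : x < x₂) : ∃ F J₁ J₂ J₃ J₄ J₅ J₆ J₇ J₈ : ℂ,
    HasLineIntegral (fun k => exp (I * k * x - ω α k * t) * hat₂ x₂ ψ₀ k) F ∧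
    HasIntegralD4 R (mode (fun z => -I / Real.pi * ampMinus b c x₂ z) b b c 0 (2 * x₂ - x) t
      fun y => ψ₀ (-y)) J₁ ∧
    HasIntegralD4 R (mode (fun z => I / (2 * Real.pi) * ampInner b c x₂ z) c b c 0 (2 * x₂ - x) t
      ((Set.Iic x₂).indicator ψ₀)) J₂ ∧
    HasIntegralD4 R (mode (fun z => I / (2 * Real.pi) * ampMixed b c x₂ z) c b c 0 (x₂ - x) t
      ((Set.Iic x₂).indicator fun y => ψ₀ (x₂ - y))) J₃ ∧
    HasIntegralD4 R (mode (fun z => -I / Real.pi * ampPlus b c x₂ z) b b c 0 (x₂ - x) t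
      fun y => ψ₀ (x₂ + y)) J₄ ∧
    HasIntegralD4 R (mode (fun z => -I / Real.pi * ampPlus b c x₂ z) b b c 0 x t
      fun y => ψ₀ (-y)) J₅ ∧
    HasIntegralD4 R (mode (fun z => I / (2 * Real.pi) * ampMixed b c x₂ z) c b c 0 x t
      ((Set.Iic x₂).indicator ψ₀)) J₆ ∧
    HasIntegralD4 R (mode (fun z => I / (2 * Real.pi) * ampInner b c x₂ z) c b c 0 (x + x₂) t
      ((Set.Iic x₂).indicator fun y => ψ₀ (x₂ - y))) J₇ ∧
    HasIntegralD4 R (mode (fun z => -I / Real.pi * ampMinus b c x₂ z) b b c 0 (x + x₂) t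
      fun y => ψ₀ (x₂ + y)) J₈ ∧
    ψ x t = 1 / (2 * Real.pi) * F + J₁ + J₂ + J₃ - J₄ - J₅ + J₆ + J₇ + J₈ := by
  have htT : t ∈ Set.Ioo 0 (t + 1) := ⟨ht, by simp⟩
  obtain ⟨J₁, h1, h1'⟩ := exists_mode_left hR hb hc hψ hψ₀ htT
    (isAmplitude_ampMinus hR hb hc hx₂.le) (-I / Real.pi) (p := 0) (q := 2 * x₂ - x) (by linarith)
  obtain ⟨J₂, h2, h2'⟩ := exists_mode_middle hR hb hc hx₂ hψ hψ₀ htT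
    (isAmplitude_ampInner hR hb hc hx₂.le) (I / (2 * Real.pi)) (p := 0) (q := 2 * x₂ - x)
    (by linarith)
  obtain ⟨J₃, h3, h3'⟩ := exists_mode_middle_reflect hR hb hc hx₂ hψ hψ₀ htT
    (isAmplitude_ampMixed hR hb hc hx₂.le) (I / (2 * Real.pi)) (p := 0) (q := x₂ - x) (by linarith)
  obtain ⟨J₄, h4, h4'⟩ := exists_mode_right hR hb hc hψ hψ₀ htT
    (isAmplitude_ampPlus hR hb hc hx₂.le) (-I / Real.pi) (p := 0) (q := x₂ - x) (by linarith)
  obtain ⟨J₅, h5, h5'⟩ := exists_mode_left hR hb hc hψ hψ₀ htT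
    (isAmplitude_ampPlus hR hb hc hx₂.le) (-I / Real.pi) (p := 0) (q := x) (by linarith)
  obtain ⟨J₆, h6, h6'⟩ := exists_mode_middle hR hb hc hx₂ hψ hψ₀ htT
    (isAmplitude_ampMixed hR hb hc hx₂.le) (I / (2 * Real.pi)) (p := 0) (q := x) (by linarith)
  obtain ⟨J₇, h7, h7'⟩ := exists_mode_middle_reflect hR hb hc hx₂ hψ hψ₀ htT
    (isAmplitude_ampInner hR hb hc hx₂.le) (I / (2 * Real.pi)) (p := 0) (q := x + x₂) (by linarith)
  obtain ⟨J₈, h8, h8'⟩ := exists_mode_right hR hb hc hψ hψ₀ htT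
    (isAmplitude_ampMinus hR hb hc hx₂.le) (-I / Real.pi) (p := 0) (q := x + x₂) (by linarith)
  obtain ⟨F, hF, hF'⟩ := exists_hasLineIntegral_restrict hR hψ hψ₀ htT
    (measurableSet_Ioc (a := (0 : ℝ)) (b := x₂)) x α hc hbc
  refine ⟨F, J₁, J₂, J₃, J₄, J₅, J₆, J₇, J₈, ?_, h1, h2, h3, h4, h5, h6, h7, h8, ?_⟩
  · simpa only [hat₂, intervalIntegral.integral_of_le hx₂.le] using hF
  rw [solution_eq hR hψ htT (b := b) hx.ne' hx'.ne
    (((((((h1'.add hR h2').add hR h3').sub hR h4').sub hR h5').add hR h6').add hR h7').add hR h8')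
    hF' fun z hz => ?_]
  · ring
  have key := timeTransform_middle_eq hR hb hc hx₂ hbc hz hψ hψ₀.integrable (ht.trans htT.2) hx hx'
  have e1 : ∀ y : ℝ, exp (-(ell b z * (0 : ℝ) + ell c z * y)) = exp (-(ell c z * y)) := fun y => by
    push_cast; ring_nf
  have e2 : exp (-(ell c z * (2 * x₂ - x : ℝ)))
      = exp (-(ell c z * (x₂ - x))) * wellFactor c x₂ z := by
    rw [wellFactor, ← Complex.exp_add]; push_cast; ring_nf
  have e3 : exp (-(ell c z * (x + x₂ : ℝ))) = exp (-(ell c z * x)) * wellFactor c x₂ z := by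
    rw [wellFactor, ← Complex.exp_add]; push_cast; ring_nf
  have e4 : exp (-(ell c z * (x₂ - x : ℝ))) = exp (-(ell c z * (x₂ - x))) := by push_cast; rfl
  have e5 : exp (-(ell b z * (0 : ℝ) + ell b z * (0 : ℝ))) = 1 := by simp
  simp only [mode, e5]
  simp only [e1]
  rw [e2, e3, e4]
  linear_combination (-(1 / Real.pi) * exp (I * (z ^ 2 + b) * t)) * key

end Solution

/-! ### Passage to the contour variables of the statement -/

lemma hat₁_I_mul (f : ℝ → ℂ) (w : ℂ) : hat₁ f (I * w) = lap (fun y => f (-y)) w := by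
  have h := lap_comp_sub (φ := f) 0 w
  simp only [zero_sub] at h
  rw [h, hat₁]
  refine integral_congr_ae (ae_of_all _ fun y => ?_)
  simp only [← mul_assoc, Complex.I_mul_I]
  simp

lemma hat₂_neg_I_mul {x₂ : ℝ} (hx₂ : 0 ≤ x₂) (f : ℝ → ℂ) (w : ℂ) :
    hat₂ x₂ f (-(I * w)) = lap ((Set.Iic x₂).indicator f) w := by
  rw [lap_indicator_Iic hx₂, hat₂]
  refine intervalIntegral.integral_congr fun y _ => ?_
  simp only [mul_neg, ← mul_assoc, Complex.I_mul_I]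
  simp

lemma hat₂_I_mul {x₂ : ℝ} (hx₂ : 0 ≤ x₂) (f : ℝ → ℂ) (w : ℂ) : hat₂ x₂ f (I * w)
    = exp (w * x₂) * lap ((Set.Iic x₂).indicator fun y => f (x₂ - y)) w := by
  have e : exp (w * x₂) * exp (-(w * x₂)) = 1 := by rw [← Complex.exp_add]; simp
  rw [lap_reflect_indicator hx₂, ← mul_assoc, e, one_mul, hat₂]
  refine intervalIntegral.integral_congr fun y _ => ?_
  simp only [← mul_assoc, Complex.I_mul_I]
  simp

lemma hat₃_neg_I_mul (x₂ : ℝ) (f : ℝ → ℂ) (w : ℂ) : hat₃ x₂ f (-(I * w))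
    = (exp (w * x₂))⁻¹ * lap (fun y => f (x₂ + y)) w := by
  rw [lap_comp_add, hat₃, ← integral_const_mul, ← Complex.exp_neg]
  refine integral_congr_ae (ae_of_all _ fun y => ?_)
  simp only [← mul_assoc, ← Complex.exp_add, mul_neg, Complex.I_mul_I]
  ring_nf

lemma wellFactor_eq (c x₂ : ℝ) (z : ℂ) : wellFactor c x₂ z = (exp (ell c z * x₂))⁻¹ := by
  rw [wellFactor, Complex.exp_neg]

/-- The function `Δ` is the determinant of the interface system, up to a factor. -/
lemma Δ_eq {α : ℝ} (x₂ : ℝ) {w l : ℂ} (hν : ν α w = I * l) (hl : l ^ 2 = w ^ 2 + α) :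
    Δ α x₂ w = -(2 * Real.pi) * exp (l * x₂) * dispersion w l (exp (-(l * x₂))) := by
  have e : exp (l * x₂) * exp (-(l * x₂)) = 1 := by rw [← Complex.exp_add]; simp
  have h1 : (x₂ : ℂ) * (I * l) * I = -(l * x₂) := by linear_combination x₂ * l * Complex.I_sq
  have h2 : -((x₂ : ℂ) * (I * l)) * I = l * x₂ := by linear_combination -x₂ * l * Complex.I_sq
  rw [Δ, hν, Complex.sin, Complex.cos, h1, h2, dispersion]
  have hα : (α : ℂ) = l ^ 2 - w ^ 2 := by linear_combination -hl
  rw [hα]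
  linear_combination (2 * Real.pi * (exp (l * x₂) - exp (-(l * x₂))) * (l ^ 2 + w ^ 2)
    + 4 * Real.pi * w * l * (exp (l * x₂) + exp (-(l * x₂)))) * Complex.I_sq
    - 2 * Real.pi * (w - l) ^ 2 * exp (-(l * x₂)) * e

section Rotation
variable {a : ℝ} {z : ℂ}

lemma root_neg_I_mul (a : ℝ) (z : ℂ) : root a (-(I * z)) = root (-a) z := by
  rw [root, root, neg_sq, mul_pow, Complex.I_sq]; push_cast; ring_nf

lemma root_I_mul (a : ℝ) (z : ℂ) : root a (I * z) = root (-a) z := by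
  rw [root, root, mul_pow, Complex.I_sq]; push_cast; ring_nf

/-- The branches `√(z² + a)` and `√(w² - a)` are inverse to each other. -/
lemma root_ell_neg (hz : z ≠ 0) (h : 2 * |a| < ‖z‖ ^ 2) :
    root a (ell (-a) z) = (root (-a) z)⁻¹ := by
  have h' : 2 * |-a| < ‖z‖ ^ 2 := by rwa [abs_neg]
  have h0 := root_ne_zero h'
  have hre := re_root_pos h'
  have e : 1 + (a : ℂ) / ell (-a) z ^ 2 = ((root (-a) z)⁻¹) ^ 2 := by
    have hs := root_sq (-a) z
    have h1 : ell (-a) z ^ 2 ≠ 0 := pow_ne_zero 2 (mul_ne_zero hz h0)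
    have h2 := ell_sq (a := -a) hz
    rw [ell, mul_pow] at h1 h2 ⊢
    field_simp
    push_cast at h2
    linear_combination h2
  rw [root, e, one_div, Complex.sq_cpow_two_inv]
  rw [Complex.inv_re]
  exact div_pos hre (Complex.normSq_pos.2 h0)

lemma ν_ell_neg (hz : z ≠ 0) (h : 2 * |a| < ‖z‖ ^ 2) : ν a (ell (-a) z) = I * z := by
  have h0 : root (-a) z ≠ 0 := root_ne_zero (by rwa [abs_neg])
  rw [ν, root_ell_neg hz h, ell]
  field_simp

end Rotation

section Kappa
variable {R α : ℝ} (hR : 0 < R) (hα : 2 * |α| < R ^ 2) {z : ℂ} (hz : z ∈ closedSector R) (x₂ : ℝ)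

omit x₂ in
lemma ν_eq (α : ℝ) (z : ℂ) : ν α z = I * ell α z := by rw [ν, ell, mul_assoc]

include hR hz in
lemma Δ_eq_ampDet : Δ α x₂ z
    = -(2 * Real.pi) * exp (ell α z * x₂) * (z ^ 2 * ampDet 0 α x₂ z) := by
  rw [Δ_eq x₂ (ν_eq α z) (ell_sq (ne_zero_of_mem hR hz)), ← dispersion_ell (b := 0), ell_zero]

include hR hα hz in
omit x₂ in
lemma kappa_facts {x₂ : ℝ} (hx₂ : 0 < x₂) : z ≠ 0 ∧ ampDet 0 α x₂ z ≠ 0 ∧ Δ α x₂ z ≠ 0 ∧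
    Δ α x₂ z = -(2 * Real.pi) * exp (ell α z * x₂) * (z ^ 2 * ampDet 0 α x₂ z) := by
  have hpi : (Real.pi : ℂ) ≠ 0 := by exact_mod_cast Real.pi_ne_zero
  have hz0 := ne_zero_of_mem hR hz
  have hD := ampDet_ne_zero hR (b := 0) (by simpa using pow_pos hR 2) hα hx₂.le hz
  refine ⟨hz0, hD, ?_, Δ_eq_ampDet hR hz x₂⟩
  rw [Δ_eq_ampDet hR hz x₂]
  exact mul_ne_zero (mul_ne_zero (by simp [hpi]) (Complex.exp_ne_zero _))
    (mul_ne_zero (pow_ne_zero 2 hz0) hD)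

include hR hα hz in
omit x₂ in
lemma k_facts {x₂ : ℝ} (hx₂ : 0 < x₂) : z ≠ 0 ∧ ampDet (-α) 0 x₂ z ≠ 0 ∧
    Δ α x₂ (z * root (-α) z) ≠ 0 ∧ Δ α x₂ (z * root (-α) z)
      = -(2 * Real.pi) * exp (ell 0 z * x₂) * (z ^ 2 * ampDet (-α) 0 x₂ z) := by
  have hpi : (Real.pi : ℂ) ≠ 0 := by exact_mod_cast Real.pi_ne_zero
  have hz0 := ne_zero_of_mem hR hz
  have hD := ampDet_ne_zero hR (b := -α) (c := 0) (by rwa [abs_neg]) (by simpa using pow_pos hR 2)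
    hx₂.le hz
  have e : Δ α x₂ (z * root (-α) z)
      = -(2 * Real.pi) * exp (ell 0 z * x₂) * (z ^ 2 * ampDet (-α) 0 x₂ z) := by
    have h1 := ell_sq_eq_add hR (neg_add_cancel α).symm hz
    have h2 := ell_sq (a := -α) hz0
    rw [← dispersion_ell, ← Δ_eq (α := α) (w := ell (-α) z), ell]
    · rw [ν_ell_neg hz0 (lt_norm_sq hR hα hz), ell_zero]
    · rw [h1, h2]
  refine ⟨hz0, hD, ?_, e⟩
  rw [e]
  exact mul_ne_zero (mul_ne_zero (by simp [hpi]) (Complex.exp_ne_zero _))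
    (mul_ne_zero (pow_ne_zero 2 hz0) hD)

end Kappa

section Mode
variable {A : ℂ → ℂ} {a b c p q t x₂ : ℝ} {f : ℝ → ℂ} {z co d e k s : ℂ}

/-- A mode, rewritten in the form of the integrands of the formulas: a coefficient with the
denominator `d`, an exponential, and a transform of the initial datum. The factor `s` is the
derivative of a rotation of the variable. -/
lemma mode_eq {g : ℝ → ℂ} {h : ℂ} (W w : ℂ) (hd : d ≠ 0)
    (he : e = -(ell b z * p + ell c z * q) + I * (z ^ 2 + b) * t + W)
    (hh : exp W * h = w * lap g (ell a z)) (hc : co * w * s = A z * d) :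
    mode A a b c p q t g z = co / d * exp e * h * s := by
  rw [mode, he, Complex.exp_add, Complex.exp_add]
  field_simp
  linear_combination -lap g (ell a z) * hc - co * s * hh

lemma mode_eq_hat₁ (W : ℂ) (hd : d ≠ 0)
    (he : e = -(ell b z * p + ell c z * q) + I * (z ^ 2 + b) * t + W) (hk : k = I * ell b z)
    (hc : co * exp W * s = A z * d) :
    mode A b b c p q t (fun y => f (-y)) z = co / d * exp e * hat₁ f k * s :=
  mode_eq W (exp W) hd he (by rw [hk, hat₁_I_mul]) hc

lemma mode_eq_hat₂_neg (hx₂ : 0 ≤ x₂) (hd : d ≠ 0)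
    (he : e = -(ell b z * p + ell c z * q) + I * (z ^ 2 + b) * t + ell c z * x₂)
    (hk : k = -(I * ell c z)) (hc : co * exp (ell c z * x₂) * s = A z * d) :
    mode A c b c p q t ((Set.Iic x₂).indicator f) z = co / d * exp e * hat₂ x₂ f k * s :=
  mode_eq _ _ hd he (by rw [hk, hat₂_neg_I_mul hx₂]) hc

lemma mode_eq_hat₂ (hx₂ : 0 ≤ x₂) (hd : d ≠ 0)
    (he : e = -(ell b z * p + ell c z * q) + I * (z ^ 2 + b) * t)
    (hk : k = I * ell c z) (hc : co * exp (ell c z * x₂) * s = A z * d) :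
    mode A c b c p q t ((Set.Iic x₂).indicator fun y => f (x₂ - y)) z
      = co / d * exp e * hat₂ x₂ f k * s :=
  mode_eq 0 _ hd (by rw [he, add_zero]) (by rw [hk, hat₂_I_mul hx₂, Complex.exp_zero, one_mul]) hc

lemma mode_eq_hat₃ (W : ℂ) (hd : d ≠ 0)
    (he : e = -(ell b z * p + ell c z * q) + I * (z ^ 2 + b) * t + (W + ell b z * x₂))
    (hk : k = -(I * ell b z)) (hc : co * exp W * s = A z * d) :
    mode A b b c p q t (fun y => f (x₂ + y)) z = co / d * exp e * hat₃ x₂ f k * s :=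
  mode_eq _ (exp W) hd he (by
    rw [hk, hat₃_neg_I_mul, Complex.exp_add]
    field_simp [Complex.exp_ne_zero]) hc

end Mode

section Solution
variable {R x₂ : ℝ} (hR : 0 < R) {α : ℝ} (hα : 2 * |α| < R ^ 2)
  (hx₂ : 0 < x₂) {ψ₀ : ℝ → ℂ} {ψ : ℝ → ℝ → ℂ}
  (hψ : IsSolution α x₂ ψ₀ ψ) (hψ₀ : IsInitialDatum ψ₀) {t : ℝ} (ht : 0 < t)
include hR hα hx₂ hψ hψ₀ ht

/-- The choice `b = 0` makes `ell b z = z` the variable `κ`. -/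
theorem kappa_formula_left {x : ℝ} (hx : x < 0) : ∃ F J₁ J₂ J₃ J₄ : ℂ,
    HasLineIntegral (fun k => exp (I * k * x - ω 0 k * t) * hat₁ ψ₀ k) F ∧
    HasIntegralD4 R (fun κ =>
      I * α * (exp (-(I * x₂ * ν α κ)) - exp (I * x₂ * ν α κ)) / Δ α x₂ κ
        * exp (κ * x + I * κ ^ 2 * t) * hat₁ ψ₀ (I * κ)) J₁ ∧
    HasIntegralD4 R (fun κ =>
      2 * I * κ * (κ - I * ν α κ) / Δ α x₂ κ
        * exp (κ * x - I * x₂ * ν α κ + I * κ ^ 2 * t) * hat₂ x₂ ψ₀ (-ν α κ)) J₂ ∧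
    HasIntegralD4 R (fun κ =>
      2 * I * κ * (κ + I * ν α κ) / Δ α x₂ κ
        * exp (κ * x + I * x₂ * ν α κ + I * κ ^ 2 * t) * hat₂ x₂ ψ₀ (ν α κ)) J₃ ∧
    HasIntegralD4 R (fun κ =>
      4 * κ * ν α κ / Δ α x₂ κ
        * exp (κ * (x + x₂) + I * κ ^ 2 * t) * hat₃ x₂ ψ₀ (-(I * κ))) J₄ ∧
    ψ x t = 1 / (2 * Real.pi) * F + J₁ - J₂ + J₃ - J₄ := by
  have h0 : 2 * |(0 : ℝ)| < R ^ 2 := by simpa using pow_pos hR 2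
  obtain ⟨F, J₁, J₂, J₃, J₄, hF, h1, h2, h3, h4, h⟩ :=
    solution_left hR h0 hα hx₂ (by ring) hψ hψ₀ ht hx
  refine ⟨F, J₁, J₂, J₃, J₄, hF, h1.congr hR fun z hz => ?_, h2.congr hR fun z hz => ?_,
    h3.congr hR fun z hz => ?_, h4.congr hR fun z hz => ?_, h⟩
  all_goals
    obtain ⟨hz0, hD, hΔ0, hΔ⟩ := kappa_facts hR hα hz hx₂
    have hpi : (Real.pi : ℂ) ≠ 0 := by exact_mod_cast Real.pi_ne_zero
    have hII : I * (I * ell α z) = -ell α z := by rw [← mul_assoc, Complex.I_mul_I, neg_one_mul]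
  · have hαz := eq_mul_root_sq_sub hR (b := 0) (zero_add α).symm hz
    have e1 : exp (-(I * x₂ * ν α z)) = exp (ell α z * x₂) := by
      rw [ν_eq]; congr 1; linear_combination (-x₂ * ell α z) * Complex.I_sq
    have e2 : exp (I * x₂ * ν α z) = (exp (ell α z * x₂))⁻¹ := by
      rw [ν_eq, ← Complex.exp_neg]; congr 1; linear_combination (x₂ * ell α z) * Complex.I_sq
    refine ((mode_eq_hat₁ 0 hΔ0 ?_ ?_ ?_).trans (mul_one _)).symm
    · simp only [ell_zero]; push_cast; ring
    · rw [ell_zero]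
    · rw [e1, e2, hαz, hΔ, ampRefl, wellFactor_eq, Complex.exp_zero, root_zero]
      have hY := Complex.exp_ne_zero (ell α z * x₂)
      field_simp
  · refine ((mode_eq_hat₂_neg hx₂.le hΔ0 ?_ ?_ ?_).trans (mul_one _)).symm
    · simp only [ell_zero, ν_eq]; push_cast; linear_combination (-x₂ * ell α z) * Complex.I_sq
    · rw [ν_eq]
    · rw [hΔ, ampPlus, root_zero, ν_eq, hII]
      generalize exp (ell α z * x₂) = Y
      rw [ell]
      field_simp
      ring
  · refine ((mode_eq_hat₂ hx₂.le hΔ0 ?_ ?_ ?_).trans (mul_one _)).symm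
    · simp only [ell_zero, ν_eq]; push_cast; linear_combination (x₂ * ell α z) * Complex.I_sq
    · rw [ν_eq]
    · rw [hΔ, ampMinus, root_zero, ν_eq, hII]
      generalize exp (ell α z * x₂) = Y
      rw [ell]
      field_simp
      ring
  · refine ((mode_eq_hat₃ (ell α z * x₂) hΔ0 ?_ ?_ ?_).trans (mul_one _)).symm
    · simp only [ell_zero]; push_cast; ring
    · rw [ell_zero]
    · rw [hΔ, ampTrans, ν_eq]
      generalize exp (ell α z * x₂) = Y
      rw [ell]
      field_simp
      ring

theorem kappa_formula_right {x : ℝ} (hx : x₂ < x) : ∃ F J₁ J₂ J₃ J₄ : ℂ,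
    HasLineIntegral (fun k => exp (I * k * x - ω 0 k * t) * hat₃ x₂ ψ₀ k) F ∧
    HasIntegralD4 R (fun κ =>
      4 * κ * ν α κ / Δ α x₂ κ
        * exp (κ * (x₂ - x) + I * κ ^ 2 * t) * hat₁ ψ₀ (I * κ)) J₁ ∧
    HasIntegralD4 R (fun κ =>
      2 * I * κ * (κ + I * ν α κ) / Δ α x₂ κ
        * exp (κ * (x₂ - x) + I * κ ^ 2 * t) * hat₂ x₂ ψ₀ (-ν α κ)) J₂ ∧
    HasIntegralD4 R (fun κ =>
      2 * I * κ * (κ - I * ν α κ) / Δ α x₂ κ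
        * exp (κ * (x₂ - x) + I * κ ^ 2 * t) * hat₂ x₂ ψ₀ (ν α κ)) J₃ ∧
    HasIntegralD4 R (fun κ =>
      I * α * (exp (-(I * x₂ * ν α κ)) - exp (I * x₂ * ν α κ)) / Δ α x₂ κ
        * exp (κ * (2 * x₂ - x) + I * κ ^ 2 * t) * hat₃ x₂ ψ₀ (-(I * κ))) J₄ ∧
    ψ x t = 1 / (2 * Real.pi) * F - J₁ + J₂ - J₃ + J₄ := by
  have h0 : 2 * |(0 : ℝ)| < R ^ 2 := by simpa using pow_pos hR 2
  obtain ⟨F, J₁, J₂, J₃, J₄, hF, h1, h2, h3, h4, h⟩ :=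
    solution_right hR h0 hα hx₂ (by ring) hψ hψ₀ ht hx
  refine ⟨F, J₁, J₂, J₃, J₄, hF, h1.congr hR fun z hz => ?_, h2.congr hR fun z hz => ?_,
    h3.congr hR fun z hz => ?_, h4.congr hR fun z hz => ?_, h⟩
  all_goals
    obtain ⟨hz0, hD, hΔ0, hΔ⟩ := kappa_facts hR hα hz hx₂
    have hpi : (Real.pi : ℂ) ≠ 0 := by exact_mod_cast Real.pi_ne_zero
    have hII : I * (I * ell α z) = -ell α z := by rw [← mul_assoc, Complex.I_mul_I, neg_one_mul]
  · refine ((mode_eq_hat₁ (ell α z * x₂) hΔ0 ?_ ?_ ?_).trans (mul_one _)).symm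
    · simp only [ell_zero]; push_cast; ring
    · rw [ell_zero]
    · rw [hΔ, ampTrans, ν_eq]
      generalize exp (ell α z * x₂) = Y
      rw [ell]
      field_simp
      ring
  · refine ((mode_eq_hat₂_neg hx₂.le hΔ0 ?_ ?_ ?_).trans (mul_one _)).symm
    · simp only [ell_zero]; push_cast; ring
    · rw [ν_eq]
    · rw [hΔ, ampMinus, root_zero, ν_eq, hII]
      generalize exp (ell α z * x₂) = Y
      rw [ell]
      field_simp
      ring
  · refine ((mode_eq_hat₂ hx₂.le hΔ0 ?_ ?_ ?_).trans (mul_one _)).symm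
    · simp only [ell_zero]; push_cast; ring
    · rw [ν_eq]
    · rw [hΔ, ampPlus, root_zero, ν_eq, hII]
      generalize exp (ell α z * x₂) = Y
      rw [ell]
      field_simp
      ring
  · have hαz := eq_mul_root_sq_sub hR (b := 0) (zero_add α).symm hz
    have e1 : exp (-(I * x₂ * ν α z)) = exp (ell α z * x₂) := by
      rw [ν_eq]; congr 1; linear_combination (-x₂ * ell α z) * Complex.I_sq
    have e2 : exp (I * x₂ * ν α z) = (exp (ell α z * x₂))⁻¹ := by
      rw [ν_eq, ← Complex.exp_neg]; congr 1; linear_combination (x₂ * ell α z) * Complex.I_sq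
    refine ((mode_eq_hat₃ 0 hΔ0 ?_ ?_ ?_).trans (mul_one _)).symm
    · simp only [ell_zero]; push_cast; ring
    · rw [ell_zero]
    · rw [e1, e2, hαz, hΔ, ampRefl, wellFactor_eq, Complex.exp_zero, root_zero]
      have hY := Complex.exp_ne_zero (ell α z * x₂)
      field_simp

theorem kappa_formula_middle {x : ℝ} (hx : 0 < x) (hx' : x < x₂) : ∃ F J₁ J₂ J₃ J₄ J₅ J₆ J₇ J₈ : ℂ,
    HasLineIntegral (fun k => exp (I * k * x - ω α k * t) * hat₂ x₂ ψ₀ k) F ∧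
    HasIntegralD4 R (fun κ =>
      2 * I * κ * (κ + I * ν α κ) / Δ α x₂ κ
        * exp (I * ν α κ * (x₂ - x) + I * κ ^ 2 * t) * hat₁ ψ₀ (I * κ)) J₁ ∧
    HasIntegralD4 R (fun κ =>
      κ * (κ + I * ν α κ) ^ 2 / (ν α κ * Δ α x₂ κ)
        * exp (I * ν α κ * (x₂ - x) + I * κ ^ 2 * t) * hat₂ x₂ ψ₀ (-ν α κ)) J₂ ∧
    HasIntegralD4 R (fun κ =>
      α * κ / (ν α κ * Δ α x₂ κ)
        * exp (I * ν α κ * (x₂ - x) + I * κ ^ 2 * t) * hat₂ x₂ ψ₀ (ν α κ)) J₃ ∧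
    HasIntegralD4 R (fun κ =>
      2 * I * κ * (κ - I * ν α κ) / Δ α x₂ κ
        * exp (-(I * ν α κ * x) + κ * x₂ + I * κ ^ 2 * t) * hat₃ x₂ ψ₀ (-(I * κ))) J₄ ∧
    HasIntegralD4 R (fun κ =>
      2 * I * κ * (κ - I * ν α κ) / Δ α x₂ κ
        * exp (I * ν α κ * (x - x₂) + I * κ ^ 2 * t) * hat₁ ψ₀ (I * κ)) J₅ ∧
    HasIntegralD4 R (fun κ =>
      α * κ / (ν α κ * Δ α x₂ κ)
        * exp (I * ν α κ * (x - x₂) + I * κ ^ 2 * t) * hat₂ x₂ ψ₀ (-ν α κ)) J₆ ∧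
    HasIntegralD4 R (fun κ =>
      κ * (κ + I * ν α κ) ^ 2 / (ν α κ * Δ α x₂ κ)
        * exp (I * ν α κ * (x₂ + x) + I * κ ^ 2 * t) * hat₂ x₂ ψ₀ (ν α κ)) J₇ ∧
    HasIntegralD4 R (fun κ =>
      2 * I * κ * (κ + I * ν α κ) / Δ α x₂ κ
        * exp (I * ν α κ * x + κ * x₂ + I * κ ^ 2 * t) * hat₃ x₂ ψ₀ (-(I * κ))) J₈ ∧
    ψ x t = 1 / (2 * Real.pi) * F + J₁ + J₂ + J₃ - J₄ - J₅ + J₆ + J₇ + J₈ := by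
  have h0 : 2 * |(0 : ℝ)| < R ^ 2 := by simpa using pow_pos hR 2
  obtain ⟨F, J₁, J₂, J₃, J₄, J₅, J₆, J₇, J₈, hF, h1, h2, h3, h4, h5, h6, h7, h8, h⟩ :=
    solution_middle hR h0 hα hx₂ (by ring) hψ hψ₀ ht hx hx'
  refine ⟨F, J₁, J₂, J₃, J₄, J₅, J₆, J₇, J₈, hF, h1.congr hR fun z hz => ?_,
    h2.congr hR fun z hz => ?_, h3.congr hR fun z hz => ?_, h4.congr hR fun z hz => ?_,
    h5.congr hR fun z hz => ?_, h6.congr hR fun z hz => ?_, h7.congr hR fun z hz => ?_,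
    h8.congr hR fun z hz => ?_, h⟩
  all_goals
    obtain ⟨hz0, hD, hΔ0, hΔ⟩ := kappa_facts hR hα hz hx₂
    have hpi : (Real.pi : ℂ) ≠ 0 := by exact_mod_cast Real.pi_ne_zero
    have hII : I * (I * ell α z) = -ell α z := by rw [← mul_assoc, Complex.I_mul_I, neg_one_mul]
    have hαz := eq_mul_root_sq_sub hR (b := 0) (zero_add α).symm hz
    have hr := root_ne_zero (lt_norm_sq hR hα hz)
    have hd : ν α z * Δ α x₂ z ≠ 0 :=
      mul_ne_zero (by rw [ν_eq]; exact mul_ne_zero Complex.I_ne_zero (ell_ne_zero hR hα hz)) hΔ0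
  · refine ((mode_eq_hat₁ (ell α z * x₂) hΔ0 ?_ ?_ ?_).trans (mul_one _)).symm
    · simp only [ell_zero, ν_eq]; push_cast; linear_combination (ell α z * (x₂ - x)) * Complex.I_sq
    · rw [ell_zero]
    · rw [hΔ, ampMinus, root_zero, ν_eq, hII]
      generalize exp (ell α z * x₂) = Y
      rw [ell]
      field_simp
      ring
  · refine ((mode_eq_hat₂_neg hx₂.le hd ?_ ?_ ?_).trans (mul_one _)).symm
    · simp only [ell_zero, ν_eq]; push_cast; linear_combination (ell α z * (x₂ - x)) * Complex.I_sq
    · rw [ν_eq]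
    · rw [hΔ, ampInner, root_zero, ν_eq, hII]
      generalize exp (ell α z * x₂) = Y
      rw [ell]
      field_simp
      simp only [Complex.I_sq]
      ring
  · refine ((mode_eq_hat₂ hx₂.le hd ?_ ?_ ?_).trans (mul_one _)).symm
    · simp only [ell_zero, ν_eq]; push_cast; linear_combination (ell α z * (x₂ - x)) * Complex.I_sq
    · rw [ν_eq]
    · rw [hαz, hΔ, ampMixed, root_zero, ν_eq]
      generalize exp (ell α z * x₂) = Y
      rw [ell]
      field_simp
      simp only [Complex.I_sq]
      ring
  · refine ((mode_eq_hat₃ (ell α z * x₂) hΔ0 ?_ ?_ ?_).trans (mul_one _)).symm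
    · simp only [ell_zero, ν_eq]; push_cast; linear_combination (ell α z * (-x)) * Complex.I_sq
    · rw [ell_zero]
    · rw [hΔ, ampPlus, root_zero, ν_eq, hII]
      generalize exp (ell α z * x₂) = Y
      rw [ell]
      field_simp
      ring
  · refine ((mode_eq_hat₁ (ell α z * x₂) hΔ0 ?_ ?_ ?_).trans (mul_one _)).symm
    · simp only [ell_zero, ν_eq]; push_cast; linear_combination (ell α z * (x - x₂)) * Complex.I_sq
    · rw [ell_zero]
    · rw [hΔ, ampPlus, root_zero, ν_eq, hII]
      generalize exp (ell α z * x₂) = Y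
      rw [ell]
      field_simp
      ring
  · refine ((mode_eq_hat₂_neg hx₂.le hd ?_ ?_ ?_).trans (mul_one _)).symm
    · simp only [ell_zero, ν_eq]; push_cast; linear_combination (ell α z * (x - x₂)) * Complex.I_sq
    · rw [ν_eq]
    · rw [hαz, hΔ, ampMixed, root_zero, ν_eq]
      generalize exp (ell α z * x₂) = Y
      rw [ell]
      field_simp
      simp only [Complex.I_sq]
      ring
  · refine ((mode_eq_hat₂ hx₂.le hd ?_ ?_ ?_).trans (mul_one _)).symm
    · simp only [ell_zero, ν_eq]; push_cast; linear_combination (ell α z * (x₂ + x)) * Complex.I_sq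
    · rw [ν_eq]
    · rw [hΔ, ampInner, root_zero, ν_eq, hII]
      generalize exp (ell α z * x₂) = Y
      rw [ell]
      field_simp
      simp only [Complex.I_sq]
      ring
  · refine ((mode_eq_hat₃ (ell α z * x₂) hΔ0 ?_ ?_ ?_).trans (mul_one _)).symm
    · simp only [ell_zero, ν_eq]; push_cast; linear_combination (ell α z * (x)) * Complex.I_sq
    · rw [ell_zero]
    · rw [hΔ, ampMinus, root_zero, ν_eq, hII]
      generalize exp (ell α z * x₂) = Y
      rw [ell]
      field_simp
      ring

/-- The rotation `k = -iκ` carries the sector of the fourth quadrant to that of the third. -/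
theorem k_formula_left {x : ℝ} (hx : x < 0) : ∃ F J₁ J₂ J₃ J₄ : ℂ,
    HasLineIntegral (fun k => exp (I * k * x - ω 0 k * t) * hat₁ ψ₀ k) F ∧
    HasIntegralD3 R (fun k =>
      α * (exp (-(I * k * x₂ * root (-α) k)) - exp (I * k * x₂ * root (-α) k))
          / Δ α x₂ (I * k)
        * exp (I * k * x - ω 0 k * t) * hat₁ ψ₀ (-k)) J₁ ∧
    HasIntegralD3 R (fun k =>
      2 * k ^ 2 * (1 + root (-α) k) / Δ α x₂ (I * k)
        * exp (I * k * (x + x₂ * root (-α) k) - ω 0 k * t)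
        * hat₂ x₂ ψ₀ (k * root (-α) k)) J₂ ∧
    HasIntegralD3 R (fun k =>
      2 * k ^ 2 * (1 - root (-α) k) / Δ α x₂ (I * k)
        * exp (I * k * (x - x₂ * root (-α) k) - ω 0 k * t)
        * hat₂ x₂ ψ₀ (-(k * root (-α) k))) J₃ ∧
    HasIntegralD3 R (fun k =>
      4 * k ^ 2 * root (-α) k / Δ α x₂ (I * k)
        * exp (I * k * (x + x₂) - ω 0 k * t) * hat₃ x₂ ψ₀ k) J₄ ∧
    ψ x t = 1 / (2 * Real.pi) * F + J₁ - J₂ + J₃ - J₄ := by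
  have h0 : 2 * |(0 : ℝ)| < R ^ 2 := by simpa using pow_pos hR 2
  obtain ⟨F, J₁, J₂, J₃, J₄, hF, h1, h2, h3, h4, h⟩ :=
    solution_left hR h0 hα hx₂ (by ring) hψ hψ₀ ht hx
  refine ⟨F, J₁, J₂, J₃, J₄, hF, h1.hasIntegralD3 hR fun z hz => ?_,
    h2.hasIntegralD3 hR fun z hz => ?_, h3.hasIntegralD3 hR fun z hz => ?_,
    h4.hasIntegralD3 hR fun z hz => ?_, h⟩
  all_goals
    obtain ⟨hz0, hD, hΔ0, hΔ⟩ := kappa_facts hR hα hz hx₂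
    have hpi : (Real.pi : ℂ) ≠ 0 := by exact_mod_cast Real.pi_ne_zero
    have hk : I * -(I * z) = z := by linear_combination -z * Complex.I_sq
    simp only [root_neg_I_mul, neg_neg, hk]
  · have hαz := eq_mul_root_sq_sub hR (b := 0) (zero_add α).symm hz
    have e1 : exp (-(z * x₂ * root α z)) = (exp (ell α z * x₂))⁻¹ := by
      rw [← Complex.exp_neg, ell]; ring_nf
    have e2 : exp (z * x₂ * root α z) = exp (ell α z * x₂) := by rw [ell]; ring_nf
    refine mode_eq_hat₁ 0 hΔ0 ?_ ?_ ?_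
    · simp only [ω, ell_zero]; push_cast; linear_combination (-I * z ^ 2 * t) * Complex.I_sq
    · rw [ell_zero]
    · rw [e1, e2, hαz, hΔ, ampRefl, wellFactor_eq, Complex.exp_zero, root_zero]
      have hY := Complex.exp_ne_zero (ell α z * x₂)
      field_simp
      ring
  · refine mode_eq_hat₂_neg hx₂.le hΔ0 ?_ ?_ ?_
    · simp only [ω, ell, root_zero, mul_one]
      push_cast
      linear_combination (-I * z ^ 2 * t) * Complex.I_sq
    · rw [ell]; ring
    · rw [hΔ, ampPlus, root_zero]
      generalize exp (ell α z * x₂) = Y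
      field_simp
      simp only [Complex.I_sq]
      ring
  · refine mode_eq_hat₂ hx₂.le hΔ0 ?_ ?_ ?_
    · simp only [ω, ell, root_zero, mul_one]
      push_cast
      linear_combination (-I * z ^ 2 * t) * Complex.I_sq
    · rw [ell]; ring
    · rw [hΔ, ampMinus, root_zero]
      generalize exp (ell α z * x₂) = Y
      field_simp
      simp only [Complex.I_sq]
      ring
  · refine mode_eq_hat₃ (ell α z * x₂) hΔ0 ?_ ?_ ?_
    · simp only [ω, ell_zero]; push_cast; linear_combination (-I * z ^ 2 * t) * Complex.I_sq
    · rw [ell_zero]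
    · rw [hΔ, ampTrans]
      generalize exp (ell α z * x₂) = Y
      field_simp
      simp only [Complex.I_sq]
      ring

/-- The rotation `k = iκ` carries the sector of the fourth quadrant to that of the first. -/
theorem k_formula_right {x : ℝ} (hx : x₂ < x) : ∃ F J₁ J₂ J₃ J₄ : ℂ,
    HasLineIntegral (fun k => exp (I * k * x - ω 0 k * t) * hat₃ x₂ ψ₀ k) F ∧
    HasIntegralD1 R (fun k =>
      4 * k ^ 2 * root (-α) k / Δ α x₂ (-(I * k))
        * exp (I * k * (x - x₂) - ω 0 k * t) * hat₁ ψ₀ k) J₁ ∧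
    HasIntegralD1 R (fun k =>
      2 * k ^ 2 * (1 + root (-α) k) / Δ α x₂ (-(I * k))
        * exp (I * k * (x - x₂) - ω 0 k * t) * hat₂ x₂ ψ₀ (k * root (-α) k)) J₂ ∧
    HasIntegralD1 R (fun k =>
      2 * k ^ 2 * (1 - root (-α) k) / Δ α x₂ (-(I * k))
        * exp (I * k * (x - x₂) - ω 0 k * t) * hat₂ x₂ ψ₀ (-(k * root (-α) k))) J₃ ∧
    HasIntegralD1 R (fun k =>
      α * (exp (-(I * k * x₂ * root (-α) k)) - exp (I * k * x₂ * root (-α) k))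
          / Δ α x₂ (-(I * k))
        * exp (I * k * (x - 2 * x₂) - ω 0 k * t) * hat₃ x₂ ψ₀ (-k)) J₄ ∧
    ψ x t = 1 / (2 * Real.pi) * F + J₁ + J₂ - J₃ + J₄ := by
  have h0 : 2 * |(0 : ℝ)| < R ^ 2 := by simpa using pow_pos hR 2
  obtain ⟨F, J₁, J₂, J₃, J₄, hF, h1, h2, h3, h4, h⟩ :=
    solution_right hR h0 hα hx₂ (by ring) hψ hψ₀ ht hx
  refine ⟨F, -J₁, -J₃, -J₂, J₄, hF, h1.neg.hasIntegralD1 hR fun z hz => ?_,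
    h3.neg.hasIntegralD1 hR fun z hz => ?_, h2.neg.hasIntegralD1 hR fun z hz => ?_,
    h4.hasIntegralD1 hR fun z hz => ?_, by rw [h]; ring⟩
  all_goals
    obtain ⟨hz0, hD, hΔ0, hΔ⟩ := kappa_facts hR hα hz hx₂
    have hpi : (Real.pi : ℂ) ≠ 0 := by exact_mod_cast Real.pi_ne_zero
    have hk : I * (I * z) = -z := by linear_combination z * Complex.I_sq
    simp only [root_I_mul, neg_neg, hk]
  · rw [neg_eq_iff_eq_neg, ← mul_neg]
    refine mode_eq_hat₁ (ell α z * x₂) hΔ0 ?_ ?_ ?_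
    · simp only [ω, ell_zero]; push_cast; linear_combination (-I * z ^ 2 * t) * Complex.I_sq
    · rw [ell_zero]
    · rw [hΔ, ampTrans]
      generalize exp (ell α z * x₂) = Y
      field_simp
      simp only [Complex.I_sq]
      ring
  · rw [neg_eq_iff_eq_neg, ← mul_neg]
    refine mode_eq_hat₂ hx₂.le hΔ0 ?_ ?_ ?_
    · simp only [ω, ell_zero]; push_cast; linear_combination (-I * z ^ 2 * t) * Complex.I_sq
    · rw [ell]; ring
    · rw [hΔ, ampPlus, root_zero]
      generalize exp (ell α z * x₂) = Y
      field_simp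
      simp only [Complex.I_sq]
      ring
  · rw [neg_eq_iff_eq_neg, ← mul_neg]
    refine mode_eq_hat₂_neg hx₂.le hΔ0 ?_ ?_ ?_
    · simp only [ω, ell_zero]; push_cast; linear_combination (-I * z ^ 2 * t) * Complex.I_sq
    · rw [ell]; ring
    · rw [hΔ, ampMinus, root_zero]
      generalize exp (ell α z * x₂) = Y
      field_simp
      simp only [Complex.I_sq]
      ring
  · have hαz := eq_mul_root_sq_sub hR (b := 0) (zero_add α).symm hz
    have e1 : exp (-(-z * x₂ * root α z)) = exp (ell α z * x₂) := by
      rw [ell]; ring_nf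
    have e2 : exp (-z * x₂ * root α z) = (exp (ell α z * x₂))⁻¹ := by
      rw [← Complex.exp_neg, ell]; ring_nf
    refine mode_eq_hat₃ 0 hΔ0 ?_ ?_ ?_
    · simp only [ω, ell_zero]; push_cast; linear_combination (-I * z ^ 2 * t) * Complex.I_sq
    · rw [ell_zero]
    · rw [e1, e2, hαz, hΔ, ampRefl, wellFactor_eq, Complex.exp_zero, root_zero]
      have hY := Complex.exp_ne_zero (ell α z * x₂)
      field_simp

/-- The choice `b = -α` makes `ell c z = z`, with `c = 0`, the variable inside the well; the terms
that decay away from `x₂` are rotated to the third quadrant, those that decay away from `0` to the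
first. -/
theorem k_formula_middle {x : ℝ} (hx : 0 < x) (hx' : x < x₂) : ∃ F J₁ J₂ J₃ J₄ J₅ J₆ J₇ J₈ : ℂ,
    HasLineIntegral (fun k => exp (I * k * x - ω α k * t) * hat₂ x₂ ψ₀ k) F ∧
    HasIntegralD3 R (fun k =>
      2 * k ^ 2 * (1 - root α k) / Δ α x₂ (I * k * root α k)
        * exp (I * k * (x - x₂) - ω α k * t) * hat₁ ψ₀ (-(k * root α k))) J₁ ∧
    HasIntegralD3 R (fun k =>
      k ^ 2 * (root α k - 1) ^ 2 / Δ α x₂ (I * k * root α k)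
        * exp (I * k * (x - x₂) - ω α k * t) * hat₂ x₂ ψ₀ k) J₂ ∧
    HasIntegralD3 R (fun k =>
      α / Δ α x₂ (I * k * root α k)
        * exp (I * k * (x - x₂) - ω α k * t) * hat₂ x₂ ψ₀ (-k)) J₃ ∧
    HasIntegralD3 R (fun k =>
      2 * k ^ 2 * (1 + root α k) / Δ α x₂ (I * k * root α k)
        * exp (I * k * (x + x₂ * root α k) - ω α k * t)
        * hat₃ x₂ ψ₀ (k * root α k)) J₄ ∧
    HasIntegralD1 R (fun k =>
      2 * k ^ 2 * (1 + root α k) / Δ α x₂ (-(I * k * root α k))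
        * exp (I * k * (x - x₂) - ω α k * t) * hat₁ ψ₀ (k * root α k)) J₅ ∧
    HasIntegralD1 R (fun k =>
      k ^ 2 * (root α k - 1) ^ 2 / Δ α x₂ (-(I * k * root α k))
        * exp (I * k * (x + x₂) - ω α k * t) * hat₂ x₂ ψ₀ k) J₆ ∧
    HasIntegralD1 R (fun k =>
      α / Δ α x₂ (-(I * k * root α k))
        * exp (I * k * (x - x₂) - ω α k * t) * hat₂ x₂ ψ₀ (-k)) J₇ ∧
    HasIntegralD1 R (fun k =>
      2 * k ^ 2 * (1 - root α k) / Δ α x₂ (-(I * k * root α k))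
        * exp (I * k * (x - x₂ * root α k) - ω α k * t)
        * hat₃ x₂ ψ₀ (-(k * root α k))) J₈ ∧
    ψ x t = 1 / (2 * Real.pi) * F - J₁ - J₂ + J₃ - J₄ + J₅ + J₆ - J₇ + J₈ := by
  have h0 : 2 * |(0 : ℝ)| < R ^ 2 := by simpa using pow_pos hR 2
  have hα' : 2 * |-α| < R ^ 2 := by rwa [abs_neg]
  obtain ⟨F, J₁, J₂, J₃, J₄, J₅, J₆, J₇, J₈, hF, h1, h2, h3, h4, h5, h6, h7, h8, h⟩ :=
    solution_middle hR hα' h0 hx₂ (by ring) hψ hψ₀ ht hx hx'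
  refine ⟨F, -J₁, -J₂, J₃, J₄, -J₅, J₇, -J₆, J₈, hF, h1.neg.hasIntegralD3 hR fun z hz => ?_,
    h2.neg.hasIntegralD3 hR fun z hz => ?_, h3.hasIntegralD3 hR fun z hz => ?_,
    h4.hasIntegralD3 hR fun z hz => ?_, h5.neg.hasIntegralD1 hR fun z hz => ?_,
    h7.hasIntegralD1 hR fun z hz => ?_, h6.neg.hasIntegralD1 hR fun z hz => ?_,
    h8.hasIntegralD1 hR fun z hz => ?_, by rw [h]; ring⟩
  all_goals
    obtain ⟨hz0, hD, hΔ0, hΔ⟩ := k_facts hR hα hz hx₂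
    have hpi : (Real.pi : ℂ) ≠ 0 := by exact_mod_cast Real.pi_ne_zero
    have hαz := eq_mul_root_sq_sub hR (b := -α) (neg_add_cancel α).symm hz
    have hk3 : I * -(I * z) = z := by linear_combination -z * Complex.I_sq
    have hk1 : I * (I * z) = -z := by linear_combination z * Complex.I_sq
    simp only [root_neg_I_mul, root_I_mul, neg_neg, neg_mul, hk3, hk1]
  · rw [neg_eq_iff_eq_neg, ← mul_neg]
    refine mode_eq_hat₁ (ell 0 z * x₂) hΔ0 ?_ ?_ ?_
    · simp only [ω, ell, root_zero, mul_one]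
      push_cast
      linear_combination (-I * z ^ 2 * t) * Complex.I_sq
    · simp only [ell]; ring
    · rw [hΔ, ampMinus, root_zero]
      generalize exp (ell 0 z * x₂) = Y
      field_simp
      simp only [Complex.I_sq]
      ring
  · rw [neg_eq_iff_eq_neg, ← mul_neg]
    refine mode_eq_hat₂_neg hx₂.le hΔ0 ?_ ?_ ?_
    · simp only [ω, ell, root_zero, mul_one]
      push_cast
      linear_combination (-I * z ^ 2 * t) * Complex.I_sq
    · simp only [ell, root_zero, mul_one]
    · rw [hΔ, ampInner, root_zero]
      generalize exp (ell 0 z * x₂) = Y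
      field_simp
      simp only [Complex.I_sq]
      ring
  · refine mode_eq_hat₂ hx₂.le hΔ0 ?_ ?_ ?_
    · simp only [ω, ell, root_zero, mul_one]
      push_cast
      linear_combination (-I * z ^ 2 * t) * Complex.I_sq
    · simp only [ell, root_zero, mul_one]
    · rw [hαz, hΔ, ampMixed, root_zero]
      generalize exp (ell 0 z * x₂) = Y
      field_simp
  · refine mode_eq_hat₃ (ell 0 z * x₂) hΔ0 ?_ ?_ ?_
    · simp only [ω, ell, root_zero, mul_one]
      push_cast
      linear_combination (-I * z ^ 2 * t) * Complex.I_sq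
    · simp only [ell]; ring
    · rw [hΔ, ampPlus, root_zero]
      generalize exp (ell 0 z * x₂) = Y
      field_simp
      simp only [Complex.I_sq]
      ring
  · rw [neg_eq_iff_eq_neg, ← mul_neg]
    refine mode_eq_hat₁ (ell 0 z * x₂) hΔ0 ?_ ?_ ?_
    · simp only [ω, ell, root_zero, mul_one]
      push_cast
      linear_combination (-I * z ^ 2 * t) * Complex.I_sq
    · simp only [ell]; ring
    · rw [hΔ, ampPlus, root_zero]
      generalize exp (ell 0 z * x₂) = Y
      field_simp
      simp only [Complex.I_sq]
      ring
  · refine mode_eq_hat₂ hx₂.le hΔ0 ?_ ?_ ?_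
    · simp only [ω, ell, root_zero, mul_one]
      push_cast
      linear_combination (-I * z ^ 2 * t) * Complex.I_sq
    · simp only [ell, root_zero, mul_one]
    · rw [hΔ, ampInner, root_zero]
      generalize exp (ell 0 z * x₂) = Y
      field_simp
      simp only [Complex.I_sq]
      ring
  · rw [neg_eq_iff_eq_neg, ← mul_neg]
    refine mode_eq_hat₂_neg hx₂.le hΔ0 ?_ ?_ ?_
    · simp only [ω, ell, root_zero, mul_one]
      push_cast
      linear_combination (-I * z ^ 2 * t) * Complex.I_sq
    · simp only [ell, root_zero, mul_one]
    · rw [hαz, hΔ, ampMixed, root_zero]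
      generalize exp (ell 0 z * x₂) = Y
      field_simp
  · refine mode_eq_hat₃ (ell 0 z * x₂) hΔ0 ?_ ?_ ?_
    · simp only [ω, ell, root_zero, mul_one]
      push_cast
      linear_combination (-I * z ^ 2 * t) * Complex.I_sq
    · simp only [ell]; ring
    · rw [hΔ, ampMinus, root_zero]
      generalize exp (ell 0 z * x₂) = Y
      field_simp
      simp only [Complex.I_sq]
      ring

end Solution

end SquareWell

end

theorem mainTheorem3 (α x₂ : ℝ) (hx₂ : 0 < x₂) (ψ₀ : ℝ → ℂ) (ψ : ℝ → ℝ → ℂ)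
    (hψ₀ : IsInitialDatum ψ₀) (hψ : IsSolution α x₂ ψ₀ ψ)
    (R : ℝ) (hR : √(2 * |α|) < R) (t : ℝ) (ht : 0 < t) :
    -- the left region, contour integrals in the variable κ
    (∀ x : ℝ, x < 0 → ∃ F J₁ J₂ J₃ J₄ : ℂ,
      HasLineIntegral (fun k => exp (I * k * x - ω 0 k * t) * hat₁ ψ₀ k) F ∧
      HasIntegralD4 R (fun κ =>
        I * α * (exp (-(I * x₂ * ν α κ)) - exp (I * x₂ * ν α κ)) / Δ α x₂ κ
          * exp (κ * x + I * κ ^ 2 * t) * hat₁ ψ₀ (I * κ)) J₁ ∧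
      HasIntegralD4 R (fun κ =>
        2 * I * κ * (κ - I * ν α κ) / Δ α x₂ κ
          * exp (κ * x - I * x₂ * ν α κ + I * κ ^ 2 * t) * hat₂ x₂ ψ₀ (-ν α κ)) J₂ ∧
      HasIntegralD4 R (fun κ =>
        2 * I * κ * (κ + I * ν α κ) / Δ α x₂ κ
          * exp (κ * x + I * x₂ * ν α κ + I * κ ^ 2 * t) * hat₂ x₂ ψ₀ (ν α κ)) J₃ ∧
      HasIntegralD4 R (fun κ =>
        4 * κ * ν α κ / Δ α x₂ κ
          * exp (κ * (x + x₂) + I * κ ^ 2 * t) * hat₃ x₂ ψ₀ (-(I * κ))) J₄ ∧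
      ψ x t = 1 / (2 * Real.pi) * F + J₁ - J₂ + J₃ - J₄) ∧
    -- the middle region, contour integrals in the variable κ
    (∀ x : ℝ, 0 < x → x < x₂ → ∃ F J₁ J₂ J₃ J₄ J₅ J₆ J₇ J₈ : ℂ,
      HasLineIntegral (fun k => exp (I * k * x - ω α k * t) * hat₂ x₂ ψ₀ k) F ∧
      HasIntegralD4 R (fun κ =>
        2 * I * κ * (κ + I * ν α κ) / Δ α x₂ κ
          * exp (I * ν α κ * (x₂ - x) + I * κ ^ 2 * t) * hat₁ ψ₀ (I * κ)) J₁ ∧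
      HasIntegralD4 R (fun κ =>
        κ * (κ + I * ν α κ) ^ 2 / (ν α κ * Δ α x₂ κ)
          * exp (I * ν α κ * (x₂ - x) + I * κ ^ 2 * t) * hat₂ x₂ ψ₀ (-ν α κ)) J₂ ∧
      HasIntegralD4 R (fun κ =>
        α * κ / (ν α κ * Δ α x₂ κ)
          * exp (I * ν α κ * (x₂ - x) + I * κ ^ 2 * t) * hat₂ x₂ ψ₀ (ν α κ)) J₃ ∧
      HasIntegralD4 R (fun κ =>
        2 * I * κ * (κ - I * ν α κ) / Δ α x₂ κ
          * exp (-(I * ν α κ * x) + κ * x₂ + I * κ ^ 2 * t) * hat₃ x₂ ψ₀ (-(I * κ))) J₄ ∧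
      HasIntegralD4 R (fun κ =>
        2 * I * κ * (κ - I * ν α κ) / Δ α x₂ κ
          * exp (I * ν α κ * (x - x₂) + I * κ ^ 2 * t) * hat₁ ψ₀ (I * κ)) J₅ ∧
      HasIntegralD4 R (fun κ =>
        α * κ / (ν α κ * Δ α x₂ κ)
          * exp (I * ν α κ * (x - x₂) + I * κ ^ 2 * t) * hat₂ x₂ ψ₀ (-ν α κ)) J₆ ∧
      HasIntegralD4 R (fun κ =>
        κ * (κ + I * ν α κ) ^ 2 / (ν α κ * Δ α x₂ κ)
          * exp (I * ν α κ * (x₂ + x) + I * κ ^ 2 * t) * hat₂ x₂ ψ₀ (ν α κ)) J₇ ∧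
      HasIntegralD4 R (fun κ =>
        2 * I * κ * (κ + I * ν α κ) / Δ α x₂ κ
          * exp (I * ν α κ * x + κ * x₂ + I * κ ^ 2 * t) * hat₃ x₂ ψ₀ (-(I * κ))) J₈ ∧
      ψ x t = 1 / (2 * Real.pi) * F + J₁ + J₂ + J₃ - J₄ - J₅ + J₆ + J₇ + J₈) ∧
    -- the right region, contour integrals in the variable κ
    (∀ x : ℝ, x₂ < x → ∃ F J₁ J₂ J₃ J₄ : ℂ,
      HasLineIntegral (fun k => exp (I * k * x - ω 0 k * t) * hat₃ x₂ ψ₀ k) F ∧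
      HasIntegralD4 R (fun κ =>
        4 * κ * ν α κ / Δ α x₂ κ
          * exp (κ * (x₂ - x) + I * κ ^ 2 * t) * hat₁ ψ₀ (I * κ)) J₁ ∧
      HasIntegralD4 R (fun κ =>
        2 * I * κ * (κ + I * ν α κ) / Δ α x₂ κ
          * exp (κ * (x₂ - x) + I * κ ^ 2 * t) * hat₂ x₂ ψ₀ (-ν α κ)) J₂ ∧
      HasIntegralD4 R (fun κ =>
        2 * I * κ * (κ - I * ν α κ) / Δ α x₂ κ
          * exp (κ * (x₂ - x) + I * κ ^ 2 * t) * hat₂ x₂ ψ₀ (ν α κ)) J₃ ∧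
      HasIntegralD4 R (fun κ =>
        I * α * (exp (-(I * x₂ * ν α κ)) - exp (I * x₂ * ν α κ)) / Δ α x₂ κ
          * exp (κ * (2 * x₂ - x) + I * κ ^ 2 * t) * hat₃ x₂ ψ₀ (-(I * κ))) J₄ ∧
      ψ x t = 1 / (2 * Real.pi) * F - J₁ + J₂ - J₃ + J₄) ∧
    -- the left region, contour integrals in the variable k
    (∀ x : ℝ, x < 0 → ∃ F J₁ J₂ J₃ J₄ : ℂ,
      HasLineIntegral (fun k => exp (I * k * x - ω 0 k * t) * hat₁ ψ₀ k) F ∧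
      HasIntegralD3 R (fun k =>
        α * (exp (-(I * k * x₂ * root (-α) k)) - exp (I * k * x₂ * root (-α) k))
            / Δ α x₂ (I * k)
          * exp (I * k * x - ω 0 k * t) * hat₁ ψ₀ (-k)) J₁ ∧
      HasIntegralD3 R (fun k =>
        2 * k ^ 2 * (1 + root (-α) k) / Δ α x₂ (I * k)
          * exp (I * k * (x + x₂ * root (-α) k) - ω 0 k * t)
          * hat₂ x₂ ψ₀ (k * root (-α) k)) J₂ ∧
      HasIntegralD3 R (fun k =>
        2 * k ^ 2 * (1 - root (-α) k) / Δ α x₂ (I * k)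
          * exp (I * k * (x - x₂ * root (-α) k) - ω 0 k * t)
          * hat₂ x₂ ψ₀ (-(k * root (-α) k))) J₃ ∧
      HasIntegralD3 R (fun k =>
        4 * k ^ 2 * root (-α) k / Δ α x₂ (I * k)
          * exp (I * k * (x + x₂) - ω 0 k * t) * hat₃ x₂ ψ₀ k) J₄ ∧
      ψ x t = 1 / (2 * Real.pi) * F + J₁ - J₂ + J₃ - J₄) ∧
    -- the middle region, contour integrals in the variable k
    (∀ x : ℝ, 0 < x → x < x₂ → ∃ F J₁ J₂ J₃ J₄ J₅ J₆ J₇ J₈ : ℂ,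
      HasLineIntegral (fun k => exp (I * k * x - ω α k * t) * hat₂ x₂ ψ₀ k) F ∧
      HasIntegralD3 R (fun k =>
        2 * k ^ 2 * (1 - root α k) / Δ α x₂ (I * k * root α k)
          * exp (I * k * (x - x₂) - ω α k * t) * hat₁ ψ₀ (-(k * root α k))) J₁ ∧
      HasIntegralD3 R (fun k =>
        k ^ 2 * (root α k - 1) ^ 2 / Δ α x₂ (I * k * root α k)
          * exp (I * k * (x - x₂) - ω α k * t) * hat₂ x₂ ψ₀ k) J₂ ∧
      HasIntegralD3 R (fun k =>
        α / Δ α x₂ (I * k * root α k)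
          * exp (I * k * (x - x₂) - ω α k * t) * hat₂ x₂ ψ₀ (-k)) J₃ ∧
      HasIntegralD3 R (fun k =>
        2 * k ^ 2 * (1 + root α k) / Δ α x₂ (I * k * root α k)
          * exp (I * k * (x + x₂ * root α k) - ω α k * t)
          * hat₃ x₂ ψ₀ (k * root α k)) J₄ ∧
      HasIntegralD1 R (fun k =>
        2 * k ^ 2 * (1 + root α k) / Δ α x₂ (-(I * k * root α k))
          * exp (I * k * (x - x₂) - ω α k * t) * hat₁ ψ₀ (k * root α k)) J₅ ∧
      HasIntegralD1 R (fun k =>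
        k ^ 2 * (root α k - 1) ^ 2 / Δ α x₂ (-(I * k * root α k))
          * exp (I * k * (x + x₂) - ω α k * t) * hat₂ x₂ ψ₀ k) J₆ ∧
      HasIntegralD1 R (fun k =>
        α / Δ α x₂ (-(I * k * root α k))
          * exp (I * k * (x - x₂) - ω α k * t) * hat₂ x₂ ψ₀ (-k)) J₇ ∧
      HasIntegralD1 R (fun k =>
        2 * k ^ 2 * (1 - root α k) / Δ α x₂ (-(I * k * root α k))
          * exp (I * k * (x - x₂ * root α k) - ω α k * t)
          * hat₃ x₂ ψ₀ (-(k * root α k))) J₈ ∧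
      ψ x t = 1 / (2 * Real.pi) * F - J₁ - J₂ + J₃ - J₄ + J₅ + J₆ - J₇ + J₈) ∧
    -- the right region, contour integrals in the variable k
    (∀ x : ℝ, x₂ < x → ∃ F J₁ J₂ J₃ J₄ : ℂ,
      HasLineIntegral (fun k => exp (I * k * x - ω 0 k * t) * hat₃ x₂ ψ₀ k) F ∧
      HasIntegralD1 R (fun k =>
        4 * k ^ 2 * root (-α) k / Δ α x₂ (-(I * k))
          * exp (I * k * (x - x₂) - ω 0 k * t) * hat₁ ψ₀ k) J₁ ∧
      HasIntegralD1 R (fun k =>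
        2 * k ^ 2 * (1 + root (-α) k) / Δ α x₂ (-(I * k))
          * exp (I * k * (x - x₂) - ω 0 k * t) * hat₂ x₂ ψ₀ (k * root (-α) k)) J₂ ∧
      HasIntegralD1 R (fun k =>
        2 * k ^ 2 * (1 - root (-α) k) / Δ α x₂ (-(I * k))
          * exp (I * k * (x - x₂) - ω 0 k * t) * hat₂ x₂ ψ₀ (-(k * root (-α) k))) J₃ ∧
      HasIntegralD1 R (fun k =>
        α * (exp (-(I * k * x₂ * root (-α) k)) - exp (I * k * x₂ * root (-α) k))
            / Δ α x₂ (-(I * k))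
          * exp (I * k * (x - 2 * x₂) - ω 0 k * t) * hat₃ x₂ ψ₀ (-k)) J₄ ∧
      ψ x t = 1 / (2 * Real.pi) * F + J₁ + J₂ - J₃ + J₄) := by
  have hR0 : 0 < R := (Real.sqrt_nonneg _).trans_lt hR
  have hα : 2 * |α| < R ^ 2 := (Real.sqrt_lt' hR0).1 hR
  exact ⟨fun x hx => kappa_formula_left hR0 hα hx₂ hψ hψ₀ ht hx,
    fun x hx hx' => kappa_formula_middle hR0 hα hx₂ hψ hψ₀ ht hx hx',
    fun x hx => kappa_formula_right hR0 hα hx₂ hψ hψ₀ ht hx,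
    fun x hx => k_formula_left hR0 hα hx₂ hψ hψ₀ ht hx,
    fun x hx hx' => k_formula_middle hR0 hα hx₂ hψ hψ₀ ht hx hx',
    fun x hx => k_formula_right hR0 hα hx₂ hψ hψ₀ ht hx⟩
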